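/- **Setting.** Rows $a_1,a_2,\dots,a_n\in\mathbb R^{1\times d}$ arrive one at a time; $A_t\in\mathbb R^{t\times d}$ is the matrix of the first $t$ rows and $A=A_n$. For a matrix $M$ and an integer $k\ge 1$ let $M_k$ be a best approximation of $M$ of rank at most $k$ in the Frobenius norm. In the online model each row must, on arrival, be irrevocably kept (possibly rescaled) or discarded, on the basis of the rows seen so far and of random bits. A matrix $B$ is a $(1+\varepsilon)$ rank $k$ projection-cost preserving sample of $A$ if its rows are rescaled rows of $A$ (each row of $A$ used at most once) and, for every rank $k$ orthogonal projection matrix $P\in\mathbb R^{d\times d}$, $$(1-\varepsilon)\|A-AP\|_F^2\le\|B-BP\|_F^2\le(1+\varepsilon)\|A-AP\|_F^2 .$$ **Algorithm OnlineLRA** (accuracy $0<\varepsilon\le\frac12$, integer $k\ge1$, constant $\alpha>0$). Put $c=6\alpha\varepsilon^{-2}\log d$ and let $\tilde A_0$ be the $0\times d$ matrix. Run in parallel, with independent randomness, a procedure Residual that reads the rows one by one and that, given any $M\in\mathbb R^{t\times d}$ with $1\le t\le n$ as the rows read so far, returns a number $R_t$ with $\frac12\cdot\frac{\|M-M_k\|_F^2}{k}\le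 R_t\le 2\cdot\frac{\|M-M_k\|_F^2}{k}$ with probability at least $1-\delta$. When $a_t$ arrives, set $\tilde\lambda_t=\frac12R_t$ and $$p_t=\min\bigl(2c\cdot a_t(\tilde A_{t-1}^\top\tilde A_{t-1}+a_t^\top a_t+\tilde\lambda_t I)^\dagger a_t^\top,\;1\bigr),$$ where $\dagger$ is the Moore–Penrose pseudoinverse; with probability $p_t$ (using fresh randomness) append the row $a_t/\sqrt{p_t}$ to $\tilde A_{t-1}$ to get $\tilde A_t$, otherwise put $\tilde A_t=\tilde A_{t-1}$. The output is $\tilde A_n$. **Theorem.** Let $p,q\ge0$ be integers. 1. There is a constant $\alpha_0\ge p$, $\alpha_0>0$, depending only on $p,q$, such that for every constant $\alpha\ge\alpha_0$ there is a constant $C>0$ depending only on $p,q,\alpha$ with the following property. Let $n\le d^{\,p}$, $k\ge1$, $0<\varepsilon\le\frac12$, let Residual be any procedure as above with failure probability $\delta=n^{-(q+1)}$, and let $\mu>0$ be such that all nonzero singular values of $A_1,\dots,A_n$ are at least $\mu$. Then, with probability at least $1-2n^{-q}$, the output $\tilde A_n$ of OnlineLRA is a $(1+\varepsilon)$ rank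 $k$ projection-cost preserving sample of $A$, it has at most $$C\,\frac{k}{\varepsilon^2}\Bigl(1+\log\frac{\|A\|_F}{\mu}\Bigr)^2\log d$$ rows (for $A=0$, the factor $1+\log(\|A\|_F/\mu)$ is read as $1$), and $$(1-\varepsilon)\|A-A_k\|_F^2\le\|\tilde A_n-(\tilde A_n)_k\|_F^2\le(1+\varepsilon)\|A-A_k\|_F^2 .$$ In particular, when the input is normalized so that one can take $\mu=1$, the number of rows is $O\bigl(\frac{k}{\varepsilon^2}\log^2\|A\|_F\,\log d\bigr)$ once $\|A\|_F\ge2$. 2. (Corollary.) There is a constant $C>0$ depending only on $p,q$ such that for all $n\le d^{\,p}$, $k\ge1$ and $0<\varepsilon\le\frac12$ there is a randomized online algorithm (it does not know $\mu$ or the stream) that, for every stream $a_1,\dots,a_n$ and every $\mu$ as in part 1, outputs with probability at least $1-n^{-q}$ a matrix $B$ of at most $C\frac{k}{\varepsilon^2}\bigl(1+\log\frac{\|A\|_F}{\mu}\bigr)^2\log d$ rescaled rows of $A$ with $$(1-\varepsilon)\|A-A_k\|_F^2\le\|B-B_k\|_F^2\le(1+\varepsilon)\|A-A_k\|_F^2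 .$$ -/

import Mathlib

open MeasureTheory Matrix

noncomputable section

namespace OnlineLowRank

/-! ### Matrices, low-rank residuals, projection-cost preserving samples -/

/-- Squared Frobenius norm `‖M‖_F²`. -/
def frobSq {m d : ℕ} (M : Matrix (Fin m) (Fin d) ℝ) : ℝ := ∑ i, ∑ j, M i j ^ 2

/-- Frobenius norm `‖M‖_F`. -/
def frob {m d : ℕ} (M : Matrix (Fin m) (Fin d) ℝ) : ℝ := √(frobSq M)

/-- `‖M - M_k‖_F²`, where `M_k` is a best approximation of `M` of rank at most `k`
in the Frobenius norm. -/
def lowRankResidual {m d : ℕ} (M : Matrix (Fin m) (Fin d) ℝ) (k : ℕ) : ℝ :=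
  ⨅ X : {X : Matrix (Fin m) (Fin d) ℝ // X.rank ≤ k}, frobSq (M - X.1)

/-- `P` is a rank `k` orthogonal projection matrix. -/
def IsRankOrthProj {d : ℕ} (k : ℕ) (P : Matrix (Fin d) (Fin d) ℝ) : Prop :=
  P * P = P ∧ Pᵀ = P ∧ P.rank = k

/-- The rows of `B` are rescaled rows of `A`, taken from pairwise different positions of `A`
and listed in the order in which they occur in `A`. -/
def IsRescaledRowSample {n r d : ℕ} (A : Matrix (Fin n) (Fin d) ℝ)
    (B : Matrix (Fin r) (Fin d) ℝ) : Prop :=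
  ∃ (f : Fin r → Fin n) (s : Fin r → ℝ), StrictMono f ∧ ∀ i j, B i j = s i * A (f i) j

/-- `B` is a `(1 + ε)` rank `k` projection-cost preserving sample of `A` (row version). -/
def IsPCPSample {n r d : ℕ} (k : ℕ) (ε : ℝ) (A : Matrix (Fin n) (Fin d) ℝ)
    (B : Matrix (Fin r) (Fin d) ℝ) : Prop :=
  IsRescaledRowSample A B ∧
    ∀ P : Matrix (Fin d) (Fin d) ℝ, IsRankOrthProj k P →
      (1 - ε) * frobSq (A - A * P) ≤ frobSq (B - B * P) ∧
        frobSq (B - B * P) ≤ (1 + ε) * frobSq (A - A * P)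

/-- Every nonzero singular value of `M` is at least `μ`. -/
def SingularValuesGE {m d : ℕ} (M : Matrix (Fin m) (Fin d) ℝ) (μ : ℝ) : Prop :=
  ∀ i : ℕ, (Matrix.toEuclideanLin M).singularValues i ≠ 0 →
    μ ≤ (Matrix.toEuclideanLin M).singularValues i

/-- Moore-Penrose pseudoinverse of a real symmetric matrix: in an orthonormal eigenbasis, the
nonzero eigenvalues are inverted and the zero eigenvalues are kept
(the value for a matrix that is not symmetric is irrelevant). -/
def pinv {d : ℕ} (M : Matrix (Fin d) (Fin d) ℝ) : Matrix (Fin d) (Fin d) ℝ :=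
  open Classical in
  if h : M.IsHermitian then
    (h.eigenvectorUnitary : Matrix (Fin d) (Fin d) ℝ) * diagonal (fun i => (h.eigenvalues i)⁻¹) *
      star (h.eigenvectorUnitary : Matrix (Fin d) (Fin d) ℝ)
  else 0

/-- The four Penrose equations, which characterize the pseudoinverse. -/
theorem pinv_penrose {d : ℕ} (M : Matrix (Fin d) (Fin d) ℝ) (h : M.IsHermitian) :
    M * pinv M * M = M ∧ pinv M * M * pinv M = pinv M ∧
      (M * pinv M)ᵀ = M * pinv M ∧ (pinv M * M)ᵀ = pinv M * M := by
  set U : Matrix (Fin d) (Fin d) ℝ := (h.eigenvectorUnitary : Matrix (Fin d) (Fin d) ℝ) with hU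
  have hUU : star U * U = 1 := Unitary.coe_star_mul_self h.eigenvectorUnitary
  set D : Matrix (Fin d) (Fin d) ℝ := diagonal h.eigenvalues with hD
  set E : Matrix (Fin d) (Fin d) ℝ := diagonal (fun i => (h.eigenvalues i)⁻¹) with hE
  have hM : M = U * D * star U := by
    have := h.spectral_theorem
    rw [Unitary.conjStarAlgAut_apply] at this
    simpa [hU, hD, Function.comp_def] using this
  have hP : pinv M = U * E * star U := by
    simp only [pinv, h, dif_pos, hE, hU]
  have hmul : ∀ X Y : Matrix (Fin d) (Fin d) ℝ,
      U * X * star U * (U * Y * star U) = U * (X * Y) * star U := by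
    intro X Y
    calc U * X * star U * (U * Y * star U) = U * X * (star U * U) * Y * star U := by
          simp only [Matrix.mul_assoc]
      _ = U * (X * Y) * star U := by rw [hUU]; simp only [Matrix.mul_assoc, Matrix.mul_one]
  have hT : ∀ v : Fin d → ℝ, (U * diagonal v * star U)ᵀ = U * diagonal v * star U := by
    intro v
    have : star U = Uᵀ := by rw [star_eq_conjTranspose, conjTranspose_eq_transpose_of_trivial]
    rw [this]
    simp [Matrix.transpose_mul, Matrix.mul_assoc]
  have h1 : D * E * D = D := by
    simp only [hD, hE, diagonal_mul_diagonal]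
    congr 1; funext i; exact mul_inv_mul_cancel _
  have h2 : E * D * E = E := by
    simp only [hD, hE, diagonal_mul_diagonal]
    congr 1; funext i
    simpa using mul_inv_mul_cancel (h.eigenvalues i)⁻¹
  rw [hP]
  refine ⟨?_, ?_, ?_, ?_⟩
  · conv_lhs => rw [hM]
    rw [hmul, hmul, h1, ← hM]
  · conv_lhs => rw [hM]
    rw [hmul, hmul, h2]
  · rw [hM, hmul, hD, hE, diagonal_mul_diagonal, hT]
  · rw [hM, hmul, hD, hE, diagonal_mul_diagonal, hT]

/-! ### Streams of rows -/

/-- The matrix `A_t = a₁ ∘ … ∘ a_t` of the first `t` rows of a stream (rows are indexed from `0`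
in the code). -/
def prefixMatrix {d : ℕ} (a : ℕ → Fin d → ℝ) (t : ℕ) : Matrix (Fin t) (Fin d) ℝ :=
  Matrix.of fun i => a i

/-- The matrix whose rows are the entries of a list. -/
def rowsMatrix {d : ℕ} (L : List (Fin d → ℝ)) : Matrix (Fin L.length) (Fin d) ℝ :=
  Matrix.of L.get

/-- `Res` is a (possibly randomized) procedure which, for every matrix `M` of
`1 ≤ t ≤ n` rows (the rows that have been streamed so far), returns a `2`-approximation of `‖M - M_k‖_F² / k` with probability at
least `1 - δ`. Its random seed is drawn from `ν`. -/
def IsResidualProcedure {d : ℕ} {Ω : Type*} [MeasurableSpace Ω] (ν : Measure Ω) (n k : ℕ) (δ : ℝ)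
    (Res : (t : ℕ) → Matrix (Fin t) (Fin d) ℝ → Ω → ℝ) : Prop :=
  ∀ t : ℕ, 1 ≤ t → t ≤ n → ∀ M : Matrix (Fin t) (Fin d) ℝ, Measurable (Res t M) ∧
    ν {ω | ¬ (1 / 2 * (lowRankResidual M k / k) ≤ Res t M ω ∧
        Res t M ω ≤ 2 * (lowRankResidual M k / k))} ≤ ENNReal.ofReal δ

/-- Such procedures exist: one may recompute the residual exactly. -/
theorem isResidualProcedure_exact {d : ℕ} {Ω : Type*} [MeasurableSpace Ω] (ν : Measure Ω)
    (n k : ℕ) (δ : ℝ) :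
    IsResidualProcedure (d := d) ν n k δ (fun _ M _ => lowRankResidual M k / k) := by
  intro t _ _ M
  refine ⟨measurable_const, ?_⟩
  have h0 : 0 ≤ lowRankResidual M k / k := by
    refine div_nonneg (Real.iInf_nonneg fun X => ?_) (Nat.cast_nonneg k)
    exact Finset.sum_nonneg fun i _ => Finset.sum_nonneg fun j _ => sq_nonneg _
  have : {ω : Ω | ¬ (1 / 2 * (lowRankResidual M k / k) ≤ lowRankResidual M k / k ∧
      lowRankResidual M k / k ≤ 2 * (lowRankResidual M k / k))} = ∅ := by
    ext ω
    simp only [Set.mem_ofPred_eq, Set.mem_empty_iff_false, iff_false, not_not]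
    constructor <;> linarith
  rw [this]
  simp

/-! ### The algorithm -/

/-- `min (2c · r (SᵀS + rᵀr + lam·I)† rᵀ, 1)`: the probability of keeping the row `r` when the rows
kept so far form `S` and the regularization is `lam`. -/
def samplingProb {m d : ℕ} (c : ℝ) (S : Matrix (Fin m) (Fin d) ℝ) (r : Fin d → ℝ) (lam : ℝ) : ℝ :=
  min (2 * c * (r ⬝ᵥ (pinv (Sᵀ * S + vecMulVec r r + lam • 1) *ᵥ r))) 1

/-- The oversampling factor `c = 6 α log d / ε²`. -/
def oversampling (α ε : ℝ) (d : ℕ) : ℝ := 6 * α * Real.log d / ε ^ 2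

/-- `OnlineLRA`: the list of rescaled rows kept after `t` rows of the stream `a`.
`est s` is the output of the residual procedure after the first `s` rows.
The `i`-th row is kept iff the `i`-th coin, uniform on `[0, 1]`, falls below the probability
`p` computed from the rows kept so far; the decision is never revised. -/
def onlineLRA {d : ℕ} (c : ℝ) (a : ℕ → Fin d → ℝ) (est : ℕ → ℝ) :
    (t : ℕ) → (Fin t → unitInterval) → List (Fin d → ℝ)
  | 0, _ => []
  | t + 1, u =>
    let S := onlineLRA c a est t (Fin.init u)
    let p := samplingProb c (rowsMatrix S) (a t) (1 / 2 * est (t + 1))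
    open Classical in
    if (u (Fin.last t) : ℝ) < p then S ++ [(1 / √p) • a t] else S

/-- A randomized online row-sampling algorithm. When the row with index `t` arrives, it decides, from
the rows that have arrived so far (including this one) and its random seed only, either to discard
the row (`none`) or to keep it, rescaled by a factor `s` (`some s`). -/
structure OnlineSampler (d : ℕ) where
  Seed : Type
  [measurableSeed : MeasurableSpace Seed]
  law : Measure Seed
  [isProbabilityLaw : IsProbabilityMeasure law]
  decide : (t : ℕ) → Matrix (Fin (t + 1)) (Fin d) ℝ → Seed → Option ℝ

attribute [instance] OnlineSampler.measurableSeed OnlineSampler.isProbabilityLaw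

/-- The rescaled rows kept by an online sampler after the first `n` rows of the stream `a`. -/
def OnlineSampler.output {d : ℕ} (alg : OnlineSampler d) (a : ℕ → Fin d → ℝ) (n : ℕ)
    (ω : alg.Seed) : List (Fin d → ℝ) :=
  (List.range n).filterMap fun t =>
    (alg.decide t (prefixMatrix a (t + 1)) ω).map fun s => s • a t

/-- `(k / ε²) (1 + log (‖A‖_F / μ))² log d`. -/
def rowBound {n d : ℕ} (k : ℕ) (ε μ : ℝ) (A : Matrix (Fin n) (Fin d) ℝ) : ℝ :=
  k / ε ^ 2 * (1 + Real.log (frob A / μ)) ^ 2 * Real.log d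

end OnlineLowRank

end

namespace OnlineLowRank

/-! ### Exponentials of real symmetric matrices -/

section Trotter

open NormedSpace Filter Topology

variable {𝔸 : Type*} [NormedRing 𝔸] [NormOneClass 𝔸]

/-! Suppose first that all residual estimates are accurate. Let G_t be the Gram matrix of the first
t rows and D the Gram matrix of the kept rows minus that of all rows read so far.

Concentration: in coordinates that whiten G_t plus a ridge, for a fixed time t, D is a matrix
martingale with rank one increments along vectors whose squared lengths are the ridge leverage
scores. As long as the kept rows have not overshot, the sampling probabilities dominate c times
these scores. By Golden–Thompson, the trace of a compensated exponential of D is then a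
supermartingale (`treeExp_trace_exp_le`, `treeExp_deviation_le`). The circularity, that the
probabilities depend on the D they are meant to control, is broken by setting the potential to zero
after a bad past. The first bad time would itself be a large deviation, and a union bound over pairs
s ≤ t excludes it (`treeExp_not_histSuccess_le`).

Projection costs: a spectral bound on D alone would lose one error term for each of the d - k tail
directions. So an eigenbasis of AᵀA is split at the level residual / k. The head is small; the tail
block of (1 - P) D is the tail trace of D minus a contribution of P, which has trace k; the cross
terms follow from Cauchy–Schwarz (`abs_sum_compl_proj_mul_le`). The tail trace is a scalar
martingale, controlled by the one-dimensional case of the same deviation bound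
(`treeExp_tailTrace_le`). The residual bounds for the sample follow by evaluating at optimal
projections.

Number of rows: the two-sided spectral bound at each time makes the next sampling probability at
most 32 c times the online leverage score (`histProb_le_leverage`). These scores are summed with the
potential log det(I + G_t / ridge): a new row raises it by at least its score, and changing the
ridge costs O(k) times the logarithm of the ratio, because all but k eigenvalues sum to the residual
(`sum_online_leverage_le`). A scalar exponential bound then controls the count (`treeExp_count_le`).

A vanishing residual is replaced by μ² in the ridge. This is harmless because the form of D sees
only the row space, where G_t is at least μ². The random coins enter through a binary tree of
outcomes (`lintegral_coins`). Random residual estimates are clamped to their admissible range and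
integrated out by Fubini, which requires measurability of the pseudoinverse form. The corollary runs
the same process with exact residuals. -/

theorem norm_pow_sub_pow_le {X Y : 𝔸} {K : ℝ} (hK : 1 ≤ K) (hX : ‖X‖ ≤ K) (hY : ‖Y‖ ≤ K) (n : ℕ) :
    ‖X ^ n - Y ^ n‖ ≤ n * K ^ n * ‖X - Y‖ := by
  induction n with
  | zero => simp
  | succ n ih =>
    have e : X ^ (n + 1) - Y ^ (n + 1) = X ^ n * (X - Y) + (X ^ n - Y ^ n) * Y := by
      rw [pow_succ, pow_succ]; noncomm_ring
    have hXn : ‖X ^ n‖ ≤ K ^ n := (norm_pow_le X n).trans (pow_le_pow_left₀ (norm_nonneg _) hX n)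
    have hKn : K ^ n ≤ K ^ (n + 1) := pow_le_pow_right₀ hK n.le_succ
    calc ‖X ^ (n + 1) - Y ^ (n + 1)‖ ≤ ‖X ^ n * (X - Y)‖ + ‖(X ^ n - Y ^ n) * Y‖ := by
          rw [e]; exact norm_add_le _ _
      _ ≤ ‖X ^ n‖ * ‖X - Y‖ + ‖X ^ n - Y ^ n‖ * ‖Y‖ :=
          add_le_add (norm_mul_le _ _) (norm_mul_le _ _)
      _ ≤ K ^ (n + 1) * ‖X - Y‖ + (n * K ^ n * ‖X - Y‖) * K := by
          gcongr
          exact hXn.trans hKn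
      _ = ((n + 1 : ℕ) : ℝ) * K ^ (n + 1) * ‖X - Y‖ := by push_cast; ring

variable [NormedAlgebra ℝ 𝔸] [CompleteSpace 𝔸]

theorem norm_exp_le_exp_norm (x : 𝔸) : ‖exp x‖ ≤ Real.exp ‖x‖ := by
  have h1 := NormedSpace.exp_series_hasSum_exp' (𝕂 := ℝ) x
  have h2 := NormedSpace.exp_series_hasSum_exp' (𝕂 := ℝ) ‖x‖
  rw [← Real.exp_eq_exp_ℝ] at h2
  rw [← h1.tsum_eq]
  refine tsum_of_norm_bounded h2 fun n => ?_
  rw [norm_smul, Real.norm_of_nonneg (by positivity), smul_eq_mul]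
  gcongr
  exact norm_pow_le x n

/-- The two curves agree to first order at 0, so at 1/n they differ by o(1/n). Taking n-th powers
amplifies the difference by at most n times a bounded constant. -/
theorem tendsto_trotter (A B : 𝔸) :
    Tendsto (fun n : ℕ => (exp ((n : ℝ)⁻¹ • A) * exp ((n : ℝ)⁻¹ • B)) ^ n) atTop
      (𝓝 (exp (A + B))) := by
  have hd : HasDerivAt (fun t : ℝ => exp (t • A) * exp (t • B) - exp (t • (A + B))) 0 0 := by
    have h := ((hasDerivAt_exp_smul_const (𝕂 := ℝ) A 0).mul
      (hasDerivAt_exp_smul_const (𝕂 := ℝ) B 0)).sub (hasDerivAt_exp_smul_const (𝕂 := ℝ) (A + B) 0)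
    have h' : HasDerivAt (fun t : ℝ => exp (t • A) * exp (t • B) - exp (t • (A + B))) _ 0 := h
    convert h' using 1
    simp
  have hinv : Tendsto (fun n : ℕ => (n : ℝ)⁻¹) atTop (𝓝[≠] 0) := by
    refine tendsto_nhdsWithin_iff.2 ⟨tendsto_inv_atTop_nhds_zero_nat, ?_⟩
    filter_upwards [eventually_gt_atTop 0] with n hn
    simpa using hn.ne'
  have hs := (hasDerivAt_iff_tendsto_slope.1 hd).comp hinv
  have hs0 := hs.norm.const_mul (Real.exp (‖A‖ + ‖B‖))
  rw [norm_zero, mul_zero] at hs0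
  rw [tendsto_iff_norm_sub_tendsto_zero]
  refine squeeze_zero' (Eventually.of_forall fun _ => norm_nonneg _) ?_ hs0
  filter_upwards [eventually_gt_atTop 0] with n hn
  have hn' : (0 : ℝ) < n := by exact_mod_cast hn
  set r : ℝ := (n : ℝ)⁻¹ with hr
  have hr0 : 0 ≤ r := by positivity
  set X := exp (r • A) * exp (r • B)
  set Y := exp (r • (A + B))
  set K := Real.exp (r * (‖A‖ + ‖B‖))
  have hYn : Y ^ n = exp (A + B) := by
    let _ : NormedAlgebra ℚ 𝔸 := NormedAlgebra.restrictScalars ℚ ℝ 𝔸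
    rw [← NormedSpace.exp_nsmul, ← Nat.cast_smul_eq_nsmul ℝ, smul_smul, hr, mul_inv_cancel₀ hn'.ne', one_smul]
  have hK : 1 ≤ K := Real.one_le_exp (by positivity)
  have hX : ‖X‖ ≤ K := by
    refine (norm_mul_le _ _).trans ?_
    refine (mul_le_mul (norm_exp_le_exp_norm _) (norm_exp_le_exp_norm _) (norm_nonneg _)
      (Real.exp_pos _).le).trans ?_
    rw [← Real.exp_add, norm_smul, norm_smul, Real.norm_of_nonneg hr0, ← mul_add]
  have hY : ‖Y‖ ≤ K := by
    refine (norm_exp_le_exp_norm _).trans (Real.exp_le_exp.2 ?_)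
    rw [norm_smul, Real.norm_of_nonneg hr0]
    gcongr
    exact norm_add_le _ _
  have hKn : K ^ n = Real.exp (‖A‖ + ‖B‖) := by
    rw [← Real.exp_nat_mul, ← mul_assoc, hr, mul_inv_cancel₀ hn'.ne', one_mul]
  have := norm_pow_sub_pow_le hK hX hY n
  rw [hKn, hYn] at this
  refine this.trans (le_of_eq ?_)
  simp only [Function.comp, slope_def_module, norm_smul, sub_zero, zero_smul, exp_zero, mul_one,
    sub_self]
  rw [Real.norm_of_nonneg (by positivity), ← hr, hr, inv_inv]
  ring

end Trotter

/-! ### The Golden–Thompson inequality for real symmetric matrices -/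

section GoldenThompson

open NormedSpace Filter Topology

variable {m : Type*} [Fintype m]

theorem trace_mul_le_half (P Q : Matrix m m ℝ) :
    (P * Qᵀ).trace ≤ ((P * Pᵀ).trace + (Q * Qᵀ).trace) / 2 := by
  have h : 0 ≤ ((P - Q) * (P - Q)ᵀ).trace := by
    simp only [trace, diag_apply, mul_apply, transpose_apply]
    exact Finset.sum_nonneg fun i _ => Finset.sum_nonneg fun j _ => mul_self_nonneg _
  have h2 : (Q * Pᵀ).trace = (P * Qᵀ).trace := by
    rw [← trace_transpose, transpose_mul, transpose_transpose]
  rw [transpose_sub, sub_mul, mul_sub, mul_sub, trace_sub, trace_sub, trace_sub, h2] at h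
  linarith

variable [DecidableEq m]

/-- The two families are proved by a joint induction. The first, applied to PQ and rearranged
cyclically to P²Q², lifts the second by one level. The first applied to M², then the second applied
to MᵀM and MMᵀ, and finally Cauchy–Schwarz for the trace form lift the first. -/
theorem trace_pow_two_pow_le (j : ℕ) :
    (∀ M : Matrix m m ℝ, (M ^ 2 ^ (j + 1)).trace ≤ ((M * Mᵀ) ^ 2 ^ j).trace) ∧
      ∀ P Q : Matrix m m ℝ, Pᵀ = P → Qᵀ = Q →
        ((P * Q) ^ 2 ^ j).trace ≤ (P ^ 2 ^ j * Q ^ 2 ^ j).trace := by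
  have cyc : ∀ (X Y : Matrix m m ℝ) (n : ℕ), ((X * Y) ^ n).trace = ((Y * X) ^ n).trace := by
    intro X Y n
    cases n with
    | zero => simp
    | succ n =>
      have : ∀ k : ℕ, (X * Y) ^ k * X = X * (Y * X) ^ k := by
        intro k
        induction k with
        | zero => simp
        | succ k ih => rw [pow_succ', mul_assoc, ih, pow_succ']; simp only [mul_assoc]
      rw [pow_succ, ← mul_assoc, this, trace_mul_comm, pow_succ', mul_assoc, ← mul_assoc]
  induction j with
  | zero =>
    refine ⟨fun M => ?_, fun P Q _ _ => by simp⟩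
    have := trace_mul_le_half M Mᵀ
    rw [transpose_transpose, trace_mul_comm Mᵀ M] at this
    rw [zero_add, pow_one, pow_two, pow_zero, pow_one]
    linarith
  | succ j ih =>
    obtain ⟨hC, hL⟩ := ih
    have hL' : ∀ P Q : Matrix m m ℝ, Pᵀ = P → Qᵀ = Q →
        ((P * Q) ^ 2 ^ (j + 1)).trace ≤ (P ^ 2 ^ (j + 1) * Q ^ 2 ^ (j + 1)).trace := by
      intro P Q hP hQ
      refine (hC _).trans ?_
      have e : ((P * Q * (P * Q)ᵀ) ^ 2 ^ j).trace = ((P ^ 2 * Q ^ 2) ^ 2 ^ j).trace := by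
        rw [transpose_mul, hP, hQ, ← mul_assoc, cyc]
        simp only [pow_two, mul_assoc]
      rw [e]
      refine (hL _ _ (by rw [transpose_pow, hP]) (by rw [transpose_pow, hQ])).trans ?_
      rw [← pow_mul, ← pow_mul, ← pow_succ']
    refine ⟨fun M => ?_, hL'⟩
    have e1 : (M ^ 2 ^ (j + 1 + 1)).trace = ((M ^ 2) ^ 2 ^ (j + 1)).trace := by
      rw [← pow_mul, ← pow_succ']
    have e2 : ((M ^ 2 * (M ^ 2)ᵀ) ^ 2 ^ j).trace = ((Mᵀ * M * (M * Mᵀ)) ^ 2 ^ j).trace := by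
      rw [transpose_pow, pow_two, pow_two,
        show M * M * (Mᵀ * Mᵀ) = (M * (M * Mᵀ)) * Mᵀ by simp only [mul_assoc], cyc]
      simp only [mul_assoc]
    rw [e1]
    refine (hC _).trans ?_
    rw [e2]
    have s1 : (Mᵀ * M)ᵀ = Mᵀ * M := by rw [transpose_mul, transpose_transpose]
    have s2 : (M * Mᵀ)ᵀ = M * Mᵀ := by rw [transpose_mul, transpose_transpose]
    refine (hL _ _ s1 s2).trans ?_
    have := trace_mul_le_half ((Mᵀ * M) ^ 2 ^ j) ((M * Mᵀ) ^ 2 ^ j)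
    rw [transpose_pow, transpose_pow, s1, s2, ← pow_two, ← pow_two, ← pow_mul, ← pow_mul,
      ← pow_succ, cyc Mᵀ M] at this
    linarith

/-- Golden–Thompson: the product inequality for powers of two, applied to exp(A/2^j) and exp(B/2^j),
in the Trotter limit. -/
theorem trace_exp_add_le (A B : Matrix m m ℝ) (hA : Aᵀ = A) (hB : Bᵀ = B) :
    (exp (A + B)).trace ≤ (exp A * exp B).trace := by
  rcases isEmpty_or_nonempty m with hm | hm
  · simp [trace]
  open scoped Matrix.Norms.Operator in
  have ht := (tendsto_trotter A B).comp (tendsto_pow_atTop_atTop_of_one_lt (one_lt_two (α := ℕ)))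
  have ht2 := ((continuous_id.matrix_trace (R := ℝ) (n := m)).tendsto _).comp ht
  refine le_of_tendsto ht2 (Eventually.of_forall fun j => ?_)
  have hsm : ∀ C : Matrix m m ℝ, exp ((((2 ^ j : ℕ) : ℝ))⁻¹ • C) ^ 2 ^ j = exp C := by
    intro C
    rw [← Matrix.exp_nsmul, ← Nat.cast_smul_eq_nsmul ℝ, smul_smul, mul_inv_cancel₀ (by positivity),
      one_smul]
  have := (trace_pow_two_pow_le j).2 (exp ((((2 ^ j : ℕ) : ℝ))⁻¹ • A))
    (exp ((((2 ^ j : ℕ) : ℝ))⁻¹ • B)) (by rw [← exp_transpose, transpose_smul, hA])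
    (by rw [← exp_transpose, transpose_smul, hB])
  rw [hsm, hsm] at this
  exact this

end GoldenThompson


/-! ### Orthogonal diagonalization and quadratic forms -/

section Spectral

variable {m : Type*} [Fintype m]

theorem dotProduct_self_nonneg (x : m → ℝ) : 0 ≤ x ⬝ᵥ x :=
  Finset.sum_nonneg fun i _ => mul_self_nonneg (x i)

theorem vecMulVec_self_mul_self (x : m → ℝ) :
    vecMulVec x x * vecMulVec x x = (x ⬝ᵥ x) • vecMulVec x x := by
  rw [vecMulVec_mul_vecMulVec, vecMulVec_smul]

theorem transpose_vecMulVec_self {m : Type*} (x : m → ℝ) : (vecMulVec x x)ᵀ = vecMulVec x x :=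
  transpose_vecMulVec x x

theorem dotProduct_vecMulVec_self_mulVec (x y z : m → ℝ) :
    y ⬝ᵥ (vecMulVec x x *ᵥ z) = (x ⬝ᵥ y) * (x ⬝ᵥ z) := by
  rw [vecMulVec_mulVec, dotProduct_smul, dotProduct_comm y x]
  simp

theorem trace_mul_vecMulVec (M : Matrix m m ℝ) (x : m → ℝ) :
    (M * vecMulVec x x).trace = x ⬝ᵥ (M *ᵥ x) := by
  rw [mul_vecMulVec, trace_vecMulVec, dotProduct_comm]

variable [DecidableEq m]

theorem exists_orthogonal_diagonalization (G : Matrix m m ℝ) (hG : Gᵀ = G) :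
    ∃ (U : Matrix m m ℝ) (g : m → ℝ), U * Uᵀ = 1 ∧ Uᵀ * U = 1 ∧ G = U * diagonal g * Uᵀ := by
  have h : G.IsHermitian := by rw [IsHermitian, conjTranspose_eq_transpose_of_trivial, hG]
  have hs : star (h.eigenvectorUnitary : Matrix m m ℝ) = (h.eigenvectorUnitary : Matrix m m ℝ)ᵀ := by
    rw [star_eq_conjTranspose, conjTranspose_eq_transpose_of_trivial]
  refine ⟨h.eigenvectorUnitary, h.eigenvalues, ?_, ?_, ?_⟩
  · rw [← hs]; exact Unitary.coe_mul_star_self h.eigenvectorUnitary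
  · rw [← hs]; exact Unitary.coe_star_mul_self h.eigenvectorUnitary
  · have := h.spectral_theorem
    rw [Unitary.conjStarAlgAut_apply, hs] at this
    simpa [Function.comp_def] using this

theorem dotProduct_conj_diagonal_mulVec (U : Matrix m m ℝ) (g y : m → ℝ) :
    y ⬝ᵥ ((U * diagonal g * Uᵀ) *ᵥ y) = ∑ i, g i * (Uᵀ *ᵥ y) i ^ 2 := by
  rw [← mulVec_mulVec, ← mulVec_mulVec, dotProduct_mulVec, ← mulVec_transpose]
  simp only [dotProduct, mulVec_diagonal]
  exact Finset.sum_congr rfl fun i _ => by ring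

theorem dotProduct_transpose_mulVec_self (U : Matrix m m ℝ) (hU : U * Uᵀ = 1) (y : m → ℝ) :
    ∑ i, (Uᵀ *ᵥ y) i ^ 2 = y ⬝ᵥ y := by
  have := dotProduct_conj_diagonal_mulVec U 1 y
  rw [show (diagonal 1 : Matrix m m ℝ) = 1 from diagonal_one, mul_one, hU, one_mulVec] at this
  simpa using this.symm

end Spectral

/-! ### Trace exponentials and rank one perturbations -/

section ExpTrace

open NormedSpace

variable {m : Type*} [Fintype m] [DecidableEq m]

theorem exp_smul_vecMulVec_self (β : ℝ) (x : m → ℝ) :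
    exp (β • vecMulVec x x) =
      1 + ((Real.exp (β * (x ⬝ᵥ x)) - 1) / (x ⬝ᵥ x)) • vecMulVec x x := by
  set s := x ⬝ᵥ x with hs
  set X := vecMulVec x x with hX
  have hpow : ∀ n : ℕ, X ^ (n + 1) = s ^ n • X := by
    intro n
    induction n with
    | zero => simp
    | succ n ih =>
      rw [pow_succ, ih, smul_mul_assoc, vecMulVec_self_mul_self, smul_smul, ← pow_succ]
  rcases eq_or_ne s 0 with h0 | h0
  · have : x = 0 := dotProduct_self_eq_zero.1 h0
    have hX0 : X = 0 := by rw [hX, this]; simp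
    rw [hX0]; simp
  · open scoped Matrix.Norms.Operator in
    have h1 := NormedSpace.exp_series_hasSum_exp' (𝕂 := ℝ) (β • X)
    have h2 := (NormedSpace.exp_series_hasSum_exp' (𝕂 := ℝ) (β * s)).smul_const (s⁻¹ • X)
    rw [← Real.exp_eq_exp_ℝ] at h2
    -- The scalar series times s⁻¹X agrees with the matrix series except in degree zero, where the
    -- correction turns s⁻¹X into 1.
    have h3 := h2.add (hasSum_ite_eq (0 : ℕ) ((1 : Matrix m m ℝ) - s⁻¹ • X))
    refine (h1.unique (h3.congr_fun ?_)).trans ?_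
    · intro n
      cases n with
      | zero => simp
      | succ n =>
        rw [if_neg n.succ_ne_zero, add_zero, smul_pow, hpow, smul_smul, smul_smul, smul_eq_mul,
          smul_smul]
        congr 1
        field_simp
        ring
    · rw [smul_smul, div_eq_mul_inv, sub_mul, sub_smul, one_mul]
      abel

theorem transpose_exp_of_transpose_eq {Z : Matrix m m ℝ} (hZ : Zᵀ = Z) : (exp Z)ᵀ = exp Z := by
  rw [← exp_transpose, hZ]

theorem dotProduct_exp_mulVec_nonneg {Z : Matrix m m ℝ} (hZ : Zᵀ = Z) (x : m → ℝ) :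
    0 ≤ x ⬝ᵥ (exp Z *ᵥ x) := by
  have hZ2 : ((1 / 2 : ℝ) • Z)ᵀ = (1 / 2 : ℝ) • Z := by rw [transpose_smul, hZ]
  have e : exp Z = (exp ((1 / 2 : ℝ) • Z))ᵀ * exp ((1 / 2 : ℝ) • Z) := by
    rw [transpose_exp_of_transpose_eq hZ2, ← Matrix.exp_add_of_commute _ _ (Commute.refl _),
      ← add_smul]
    norm_num
  rw [e, ← mulVec_mulVec, dotProduct_mulVec, ← mulVec_transpose, transpose_transpose]
  exact dotProduct_self_nonneg _

/-- After Golden–Thompson, the exponential of a multiple of xxᵀ is 1 plus a multiple of xxᵀ. The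
averaged matrix inequality therefore collapses to the scalar inequality at the eigenvalue x·x. -/
theorem trace_exp_rank_one_step {Z : Matrix m m ℝ} (hZ : Zᵀ = Z) (x : m → ℝ) {p β₁ β₀ : ℝ}
    (hp0 : 0 ≤ p) (hp1 : p ≤ 1)
    (h : p * Real.exp (β₁ * (x ⬝ᵥ x)) + (1 - p) * Real.exp (β₀ * (x ⬝ᵥ x)) ≤ 1) :
    p * (exp (Z + β₁ • vecMulVec x x)).trace + (1 - p) * (exp (Z + β₀ • vecMulVec x x)).trace ≤
      (exp Z).trace := by
  have hb : ∀ β : ℝ, (exp (Z + β • vecMulVec x x)).trace ≤ (exp Z).trace +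
      (Real.exp (β * (x ⬝ᵥ x)) - 1) / (x ⬝ᵥ x) * (x ⬝ᵥ (exp Z *ᵥ x)) := by
    intro β
    refine (trace_exp_add_le _ _ hZ (by rw [transpose_smul, transpose_vecMulVec_self])).trans ?_
    rw [exp_smul_vecMulVec_self, mul_add, mul_one, trace_add, mul_smul_comm, trace_smul,
      trace_mul_vecMulVec, smul_eq_mul]
  have h1 := mul_le_mul_of_nonneg_left (hb β₁) hp0
  have h2 := mul_le_mul_of_nonneg_left (hb β₀) (sub_nonneg.2 hp1)
  have hs : 0 ≤ x ⬝ᵥ x := dotProduct_self_nonneg x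
  have hq := dotProduct_exp_mulVec_nonneg hZ x
  have h3 : (p * Real.exp (β₁ * (x ⬝ᵥ x)) + (1 - p) * Real.exp (β₀ * (x ⬝ᵥ x)) - 1) / (x ⬝ᵥ x) *
      (x ⬝ᵥ (exp Z *ᵥ x)) ≤ 0 :=
    mul_nonpos_of_nonpos_of_nonneg (div_nonpos_of_nonpos_of_nonneg (by linarith) hs) hq
  have e : (p * Real.exp (β₁ * (x ⬝ᵥ x)) + (1 - p) * Real.exp (β₀ * (x ⬝ᵥ x)) - 1) / (x ⬝ᵥ x) *
      (x ⬝ᵥ (exp Z *ᵥ x)) = p * ((Real.exp (β₁ * (x ⬝ᵥ x)) - 1) / (x ⬝ᵥ x) * (x ⬝ᵥ (exp Z *ᵥ x))) +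
      (1 - p) * ((Real.exp (β₀ * (x ⬝ᵥ x)) - 1) / (x ⬝ᵥ x) * (x ⬝ᵥ (exp Z *ᵥ x))) := by ring
  rw [e] at h3
  linarith

theorem trace_exp_eq_sum (U : Matrix m m ℝ) (g : m → ℝ) (hU : U * Uᵀ = 1) (hU' : Uᵀ * U = 1) :
    (exp (U * diagonal g * Uᵀ)).trace = ∑ i, Real.exp (g i) := by
  have hinv : U⁻¹ = Uᵀ := inv_eq_right_inv hU
  have hunit : IsUnit U := ⟨⟨U, Uᵀ, hU, hU'⟩, rfl⟩
  rw [← hinv, Matrix.exp_conj U _ hunit, trace_mul_comm, ← mul_assoc, hinv, hU', one_mul,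
    exp_diagonal, trace_diagonal]
  simp [Real.exp_eq_exp_ℝ]

theorem trace_exp_nonneg {Z : Matrix m m ℝ} (hZ : Zᵀ = Z) : 0 ≤ (exp Z).trace := by
  obtain ⟨U, g, h1, h2, rfl⟩ := exists_orthogonal_diagonalization Z hZ
  rw [trace_exp_eq_sum U g h1 h2]
  positivity

/-- The Rayleigh quotient at y forces an eigenvalue of at least r, which contributes one term to a
sum of positive exponentials. -/
theorem exp_le_trace_exp {Z : Matrix m m ℝ} (hZ : Zᵀ = Z) {r : ℝ} {y : m → ℝ} (hy : y ≠ 0)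
    (h : r * (y ⬝ᵥ y) ≤ y ⬝ᵥ (Z *ᵥ y)) : Real.exp r ≤ (exp Z).trace := by
  obtain ⟨U, g, h1, h2, rfl⟩ := exists_orthogonal_diagonalization Z hZ
  rw [trace_exp_eq_sum U g h1 h2]
  have hex : ∃ i, r ≤ g i := by
    by_contra! hlt
    rw [dotProduct_conj_diagonal_mulVec, ← dotProduct_transpose_mulVec_self U h1 y,
      Finset.mul_sum] at h
    have hne : ∃ i, (Uᵀ *ᵥ y) i ≠ 0 := by
      by_contra! hz
      apply hy
      have : y ⬝ᵥ y = 0 := by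
        rw [← dotProduct_transpose_mulVec_self U h1 y]; simp [hz]
      exact dotProduct_self_eq_zero.1 this
    obtain ⟨i, hi⟩ := hne
    have : ∑ i, g i * (Uᵀ *ᵥ y) i ^ 2 < ∑ i, r * (Uᵀ *ᵥ y) i ^ 2 :=
      Finset.sum_lt_sum (fun j _ => mul_le_mul_of_nonneg_right (hlt j).le (sq_nonneg _))
        ⟨i, Finset.mem_univ i, mul_lt_mul_of_pos_right (hlt i) (by positivity)⟩
    linarith
  obtain ⟨i, hi⟩ := hex
  exact (Real.exp_le_exp.2 hi).trans
    (Finset.single_le_sum (f := fun i => Real.exp (g i)) (fun j _ => (Real.exp_pos _).le)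
      (Finset.mem_univ i))

end ExpTrace


/-! ### Expectations over adaptive coin flips -/

/-- The expectation of `F` over the outcomes (most recent first) of `n` coins, where the next coin
shows `true` with probability `π h` if the previous outcomes are `h`. -/
noncomputable def treeExp (π : List Bool → ℝ) : ℕ → (List Bool → ℝ) → ℝ
  | 0, F => F []
  | n + 1, F => treeExp π n fun h => π h * F (true :: h) + (1 - π h) * F (false :: h)

/-- Every history that strictly precedes `h` satisfies `Good`. -/
def PastGood (Good : List Bool → Prop) : List Bool → Prop
  | [] => True
  | _ :: h => Good h ∧ PastGood Good h

section TreeExp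

variable {π : List Bool → ℝ}

theorem treeExp_mono (hπ : ∀ h, 0 ≤ π h ∧ π h ≤ 1) (n : ℕ) {F F' : List Bool → ℝ}
    (h : ∀ l, l.length = n → F l ≤ F' l) : treeExp π n F ≤ treeExp π n F' := by
  induction n generalizing F F' with
  | zero => exact h [] rfl
  | succ n ih =>
    refine ih fun l hl => ?_
    have := (hπ l).1
    have := sub_nonneg.2 (hπ l).2
    gcongr <;> exact h _ (by simp [hl])

theorem treeExp_congr (n : ℕ) {F F' : List Bool → ℝ}
    (h : ∀ l, l.length = n → F l = F' l) : treeExp π n F = treeExp π n F' := by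
  induction n generalizing F F' with
  | zero => exact h [] rfl
  | succ n ih =>
    refine ih fun l hl => ?_
    rw [h _ (by simp [hl]), h _ (by simp [hl])]

theorem treeExp_zero (n : ℕ) : treeExp π n (fun _ => 0) = 0 := by
  induction n with
  | zero => rfl
  | succ n ih => simpa [treeExp] using ih

theorem treeExp_add (n : ℕ) (F F' : List Bool → ℝ) :
    treeExp π n (fun l => F l + F' l) = treeExp π n F + treeExp π n F' := by
  induction n generalizing F F' with
  | zero => rfl
  | succ n ih =>
    simp only [treeExp]
    rw [← ih]
    exact treeExp_congr n fun l _ => by ring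

theorem treeExp_const_mul (n : ℕ) (r : ℝ) (F : List Bool → ℝ) :
    treeExp π n (fun l => r * F l) = r * treeExp π n F := by
  induction n generalizing F with
  | zero => rfl
  | succ n ih =>
    simp only [treeExp]
    rw [← ih]
    exact treeExp_congr n fun l _ => by ring

theorem treeExp_sum {ι : Type*} (s : Finset ι) (n : ℕ) (F : ι → List Bool → ℝ) :
    treeExp π n (fun l => ∑ i ∈ s, F i l) = ∑ i ∈ s, treeExp π n (F i) := by
  classical
  induction s using Finset.induction_on with
  | empty => simpa using treeExp_zero n
  | insert i s hi ih => simp only [Finset.sum_insert hi]; rw [treeExp_add, ih]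

/-- Outcomes are listed most recent first, so dropping r of them leaves the first s coins, and the
later coins average out. -/
theorem treeExp_drop (s r : ℕ) (F : List Bool → ℝ) :
    treeExp π (s + r) (fun l => F (l.drop r)) = treeExp π s F := by
  induction r with
  | zero => simp
  | succ r ih =>
    rw [← ih, ← add_assoc]
    simp only [treeExp, List.drop_succ_cons]
    exact treeExp_congr _ fun l _ => by ring

theorem treeExp_le_of_supermartingale (hπ : ∀ h, 0 ≤ π h ∧ π h ≤ 1) (n : ℕ) {F : List Bool → ℝ}
    (h : ∀ l, l.length < n → π l * F (true :: l) + (1 - π l) * F (false :: l) ≤ F l) :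
    treeExp π n F ≤ F [] := by
  induction n with
  | zero => exact le_rfl
  | succ n ih =>
    refine le_trans (treeExp_mono hπ n fun l hl => h l (by omega)) (ih fun l hl => h l (by omega))

end TreeExp

/-! ### Exponential supermartingales for adaptive sampling -/

section Concentration

theorem exp_le_one_add_add_sq {y : ℝ} (hy : |y| ≤ 1) : Real.exp y ≤ 1 + y + y ^ 2 := by
  have := (abs_le.1 (Real.abs_exp_sub_one_sub_id_le hy)).2
  linarith

/-- If c s ≥ 1, the coin is deterministic. Otherwise p ≥ c s keeps both centred exponents within
[-1, 1], and the second moment, at most θ² s / c, is cancelled by the compensator. -/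
theorem bernoulli_mgf_le {p s c θ : ℝ} (hp0 : 0 ≤ p) (hp1 : p ≤ 1) (hs : 0 ≤ s) (hc : 0 < c)
    (hθ : |θ| ≤ c) (hp : min 1 (c * s) ≤ p) :
    p * Real.exp ((θ * (p⁻¹ - 1) - θ ^ 2 / c) * s) +
      (1 - p) * Real.exp ((θ * (0 - 1) - θ ^ 2 / c) * s) ≤ 1 := by
  have hγ : 0 ≤ θ ^ 2 / c := by positivity
  rcases le_total 1 (c * s) with h1 | h1
  · rw [min_eq_left h1] at hp
    obtain rfl : p = 1 := le_antisymm hp1 hp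
    simp only [inv_one, sub_self, mul_zero, zero_mul, add_zero, one_mul, zero_sub]
    exact Real.exp_le_one_iff.2 (by nlinarith)
  rw [min_eq_right h1] at hp
  rcases hp0.eq_or_lt with rfl | hp0
  · have : s = 0 := by nlinarith
    simp [this]
  have hcs : 0 ≤ c * s := by positivity
  have hy0 : |-(θ * s)| ≤ 1 := by
    rw [abs_neg, abs_mul, abs_of_nonneg hs]
    nlinarith
  have hy1 : |θ * s * (p⁻¹ - 1)| ≤ 1 := by
    have hpi : 1 ≤ p⁻¹ := (one_le_inv₀ hp0).2 hp1
    rw [abs_mul, abs_mul, abs_of_nonneg hs, abs_of_nonneg (sub_nonneg.2 hpi)]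
    calc |θ| * s * (p⁻¹ - 1) ≤ c * s * (p⁻¹ - 1) := by
          gcongr
      _ ≤ p * (p⁻¹ - 1) := by gcongr
      _ = 1 - p := by field_simp
      _ ≤ 1 := by linarith
  have e1 : (θ * (p⁻¹ - 1) - θ ^ 2 / c) * s = -(θ ^ 2 / c * s) + θ * s * (p⁻¹ - 1) := by ring
  have e0 : (θ * (0 - 1) - θ ^ 2 / c) * s = -(θ ^ 2 / c * s) + -(θ * s) := by ring
  rw [e1, e0, Real.exp_add, Real.exp_add]
  have hb1 := exp_le_one_add_add_sq hy1
  have hb0 := exp_le_one_add_add_sq hy0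
  have hm : p * Real.exp (θ * s * (p⁻¹ - 1)) + (1 - p) * Real.exp (-(θ * s)) ≤
      Real.exp (θ ^ 2 / c * s) := by
    calc p * Real.exp (θ * s * (p⁻¹ - 1)) + (1 - p) * Real.exp (-(θ * s))
        ≤ p * (1 + θ * s * (p⁻¹ - 1) + (θ * s * (p⁻¹ - 1)) ^ 2) +
          (1 - p) * (1 + -(θ * s) + (-(θ * s)) ^ 2) := by
          gcongr
      _ = 1 + θ ^ 2 * s * (s * (1 - p) / p) := by field_simp; ring
      _ ≤ 1 + θ ^ 2 * s * (1 / c) := by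
          have : s * (1 - p) / p ≤ 1 / c := by
            rw [div_le_div_iff₀ hp0 hc]
            nlinarith [mul_nonneg hs hp0.le]
          gcongr
      _ = θ ^ 2 / c * s + 1 := by ring
      _ ≤ _ := Real.add_one_le_exp _
  calc p * (Real.exp (-(θ ^ 2 / c * s)) * Real.exp (θ * s * (p⁻¹ - 1))) +
        (1 - p) * (Real.exp (-(θ ^ 2 / c * s)) * Real.exp (-(θ * s)))
      = Real.exp (-(θ ^ 2 / c * s)) *
        (p * Real.exp (θ * s * (p⁻¹ - 1)) + (1 - p) * Real.exp (-(θ * s))) := by ring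
    _ ≤ Real.exp (-(θ ^ 2 / c * s)) * Real.exp (θ ^ 2 / c * s) := by gcongr
    _ = 1 := by rw [← Real.exp_add]; simp

variable {m : Type*} [Fintype m] [DecidableEq m] {π : List Bool → ℝ}

open NormedSpace in
open Classical in
/-- The exponential potential of adaptive rank one sampling does not increase on average. -/
theorem treeExp_trace_exp_le (hπ : ∀ h, 0 ≤ π h ∧ π h ≤ 1) (n : ℕ) (x : ℕ → m → ℝ)
    (Good : List Bool → Prop) {c θ : ℝ} (hc : 0 < c) (hθ : |θ| ≤ c)
    (hG : ∀ h, h.length < n → Good h → min 1 (c * (x h.length ⬝ᵥ x h.length)) ≤ π h)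
    (Y : List Bool → Matrix m m ℝ) (hY0 : Y [] = 0)
    (hY : ∀ b h, Y (b :: h) = Y h +
      ((if b then (π h)⁻¹ else 0) - 1) • vecMulVec (x h.length) (x h.length)) :
    treeExp π n (fun h => if PastGood Good h then (exp (θ • Y h -
      (θ ^ 2 / c) • ∑ i ∈ Finset.range h.length, vecMulVec (x i) (x i))).trace else 0) ≤
      Fintype.card m := by
  have hYs : ∀ h, (Y h)ᵀ = Y h := by
    intro h
    induction h with
    | nil => simp [hY0]
    | cons b h ih => rw [hY, transpose_add, ih, transpose_smul, transpose_vecMulVec_self]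
  have hZs : ∀ h, (θ • Y h - (θ ^ 2 / c) • ∑ i ∈ Finset.range h.length, vecMulVec (x i) (x i))ᵀ =
      θ • Y h - (θ ^ 2 / c) • ∑ i ∈ Finset.range h.length, vecMulVec (x i) (x i) := by
    intro h
    rw [transpose_sub, transpose_smul, transpose_smul, hYs, transpose_sum]
    simp only [transpose_vecMulVec_self]
  refine (treeExp_le_of_supermartingale hπ n fun h hh => ?_).trans ?_
  · by_cases hg : Good h ∧ PastGood Good h
    · have h1 : ∀ b, PastGood Good (b :: h) := fun _ => hg
      rw [if_pos (h1 _), if_pos (h1 _), if_pos hg.2]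
      have hs : ∀ b : Bool, θ • Y (b :: h) -
          (θ ^ 2 / c) • ∑ i ∈ Finset.range (b :: h).length, vecMulVec (x i) (x i) =
          (θ • Y h - (θ ^ 2 / c) • ∑ i ∈ Finset.range h.length, vecMulVec (x i) (x i)) +
            (θ * ((if b then (π h)⁻¹ else 0) - 1) - θ ^ 2 / c) •
              vecMulVec (x h.length) (x h.length) := by
        intro b
        rw [hY, List.length_cons, Finset.sum_range_succ, smul_add, smul_add, smul_smul, sub_smul]
        abel
      rw [hs, hs]
      refine trace_exp_rank_one_step (hZs h) _ (hπ h).1 (hπ h).2 ?_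
      simpa using bernoulli_mgf_le (hπ h).1 (hπ h).2 (dotProduct_self_nonneg _) hc hθ
        (hG h hh hg.1)
    -- Here the potential vanishes at both children, so no lower bound on the sampling probability
    -- is needed.
    · have h1 : ∀ b, ¬ PastGood Good (b :: h) := fun _ => hg
      rw [if_neg (h1 _), if_neg (h1 _)]
      simp only [mul_zero, add_zero]
      split_ifs
      · exact trace_exp_nonneg (hZs h)
      · exact le_rfl
  · simp [PastGood, hY0]

open Classical in
/-- Adaptive rank one sampling concentrates as long as the sampling probabilities dominate the
leverage scores `‖x i‖²`. -/
theorem treeExp_deviation_le (hπ : ∀ h, 0 ≤ π h ∧ π h ≤ 1) (n : ℕ) (x : ℕ → m → ℝ)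
    (Good : List Bool → Prop) {c ε : ℝ} (hc : 0 < c) (hε0 : 0 ≤ ε) (hε1 : ε ≤ 1)
    (hG : ∀ h, h.length < n → Good h → min 1 (c * (x h.length ⬝ᵥ x h.length)) ≤ π h)
    (Y : List Bool → Matrix m m ℝ) (hY0 : Y [] = 0)
    (hY : ∀ b h, Y (b :: h) = Y h +
      ((if b then (π h)⁻¹ else 0) - 1) • vecMulVec (x h.length) (x h.length))
    (hx : ∀ y, ∑ i ∈ Finset.range n, (x i ⬝ᵥ y) ^ 2 ≤ y ⬝ᵥ y) :
    treeExp π n (fun h => if PastGood Good h ∧ ∃ y, ε * (y ⬝ᵥ y) < |y ⬝ᵥ (Y h *ᵥ y)| then 1 else 0)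
      ≤ 2 * Fintype.card m * Real.exp (-(c * ε ^ 2 / 4)) := by
  -- This value maximizes θ ε - θ² / c, with maximum c ε² / 4.
  set θ := c * ε / 2 with hθ
  have hθ0 : 0 ≤ θ := by positivity
  have hθc : |θ| ≤ c := by rw [abs_of_nonneg hθ0]; nlinarith
  have hp := treeExp_trace_exp_le hπ n x Good hc hθc hG Y hY0 hY
  have hn := treeExp_trace_exp_le hπ n x Good hc (θ := -θ) (by rwa [abs_neg]) hG Y hY0 hY
  set Fp := fun h => if PastGood Good h then (NormedSpace.exp (θ • Y h -
      (θ ^ 2 / c) • ∑ i ∈ Finset.range h.length, vecMulVec (x i) (x i))).trace else 0 with hFp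
  set Fn := fun h => if PastGood Good h then (NormedSpace.exp ((-θ) • Y h -
      ((-θ) ^ 2 / c) • ∑ i ∈ Finset.range h.length, vecMulVec (x i) (x i))).trace else 0 with hFn
  have hYs : ∀ h, (Y h)ᵀ = Y h := by
    intro h
    induction h with
    | nil => simp [hY0]
    | cons b h ih => rw [hY, transpose_add, ih, transpose_smul, transpose_vecMulVec_self]
  have hZs : ∀ (η : ℝ) h,
      (η • Y h - (η ^ 2 / c) • ∑ i ∈ Finset.range h.length, vecMulVec (x i) (x i))ᵀ =
      η • Y h - (η ^ 2 / c) • ∑ i ∈ Finset.range h.length, vecMulVec (x i) (x i) := by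
    intro η h
    rw [transpose_sub, transpose_smul, transpose_smul, hYs, transpose_sum]
    simp only [transpose_vecMulVec_self]
  have hquad : ∀ (η : ℝ) h, h.length = n → ∀ y, η * (y ⬝ᵥ (Y h *ᵥ y)) - η ^ 2 / c * (y ⬝ᵥ y) ≤
      y ⬝ᵥ ((η • Y h - (η ^ 2 / c) •
        ∑ i ∈ Finset.range h.length, vecMulVec (x i) (x i)) *ᵥ y) := by
    intro η h hh y
    rw [sub_mulVec, smul_mulVec, smul_mulVec, dotProduct_sub, dotProduct_smul, dotProduct_smul,
      sum_mulVec, dotProduct_sum, hh, smul_eq_mul, smul_eq_mul]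
    simp only [dotProduct_vecMulVec_self_mulVec, ← pow_two]
    have := hx y
    have h0 : 0 ≤ η ^ 2 / c := by positivity
    nlinarith
  have hθε : θ * ε - θ ^ 2 / c = c * ε ^ 2 / 4 := by rw [hθ]; field_simp; ring
  have hFp0 : ∀ h, 0 ≤ Fp h := by
    intro h; simp only [hFp]; split_ifs
    · exact trace_exp_nonneg (hZs _ h)
    · exact le_rfl
  have hFn0 : ∀ h, 0 ≤ Fn h := by
    intro h; simp only [hFn]; split_ifs
    · exact trace_exp_nonneg (hZs _ h)
    · exact le_rfl
  calc _ ≤ treeExp π n (fun h => Real.exp (-(c * ε ^ 2 / 4)) * (Fp h + Fn h)) := by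
        refine treeExp_mono hπ n fun h hh => ?_
        split_ifs with hb
        · obtain ⟨hg, y, hy⟩ := hb
          have hy0 : y ≠ 0 := by rintro rfl; simp at hy
          rw [Real.exp_neg, inv_mul_eq_div, one_le_div (Real.exp_pos _)]
          rcases lt_abs.1 hy with hy | hy
          · have : Real.exp (c * ε ^ 2 / 4) ≤ Fp h := by
              simp only [hFp]; rw [if_pos hg]
              refine exp_le_trace_exp (hZs _ h) hy0 (le_trans ?_ (hquad θ h hh y))
              rw [← hθε]; nlinarith
            linarith [hFn0 h]
          · have : Real.exp (c * ε ^ 2 / 4) ≤ Fn h := by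
              simp only [hFn]; rw [if_pos hg]
              refine exp_le_trace_exp (hZs _ h) hy0 (le_trans ?_ (hquad (-θ) h hh y))
              have := mul_le_mul_of_nonneg_left hy.le hθ0
              rw [← hθε, neg_sq]; linarith
            linarith [hFp0 h]
        · exact mul_nonneg (Real.exp_pos _).le (add_nonneg (hFp0 h) (hFn0 h))
    _ = Real.exp (-(c * ε ^ 2 / 4)) * (treeExp π n Fp + treeExp π n Fn) := by
        rw [treeExp_const_mul, treeExp_add]
    _ ≤ Real.exp (-(c * ε ^ 2 / 4)) * (Fintype.card m + Fintype.card m) := by gcongr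
    _ = _ := by ring

/-- The number of kept rows is at most twice a deterministic bound on the sum of the sampling
probabilities, up to an additive error. -/
theorem treeExp_count_le (hπ : ∀ h, 0 ≤ π h ∧ π h ≤ 1) (n : ℕ) (Good : List Bool → Prop)
    (q : ℕ → ℝ) (hG : ∀ h, h.length < n → Good h → π h ≤ q h.length) (r : ℝ) :
    open Classical in
    treeExp π n (fun h => if PastGood Good h ∧
      2 * ∑ i ∈ Finset.range n, q i + r < h.count true then 1 else 0) ≤ Real.exp (-r) := by
  classical
  set F : List Bool → ℝ := fun h => if PastGood Good h then
    Real.exp (h.count true - 2 * ∑ i ∈ Finset.range h.length, q i) else 0 with hF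
  have hsup : treeExp π n F ≤ F [] := by
    refine treeExp_le_of_supermartingale hπ n fun h hh => ?_
    simp only [hF]
    by_cases hg : Good h ∧ PastGood Good h
    · have h1 : ∀ b, PastGood Good (b :: h) := fun _ => hg
      rw [if_pos (h1 _), if_pos (h1 _), if_pos hg.2]
      simp only [List.length_cons, Finset.sum_range_succ, List.count_cons_self]
      rw [List.count_cons_of_ne (by simp)]
      set E := Real.exp (h.count true - 2 * ∑ i ∈ Finset.range h.length, q i) with hE
      have e1 : Real.exp (((h.count true + 1 : ℕ) : ℝ) -
          2 * (∑ i ∈ Finset.range h.length, q i + q h.length)) =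
          E * (Real.exp (-(2 * q h.length)) * Real.exp 1) := by
        rw [hE, ← Real.exp_add, ← Real.exp_add]; push_cast; congr 1; ring
      have e0 : Real.exp ((h.count true : ℝ) -
          2 * (∑ i ∈ Finset.range h.length, q i + q h.length)) =
          E * Real.exp (-(2 * q h.length)) := by
        rw [hE, ← Real.exp_add]; congr 1; ring
      rw [e1, e0]
      have hE0 : 0 < E := Real.exp_pos _
      have hx0 : 0 < Real.exp (-(2 * q h.length)) := Real.exp_pos _
      -- The factor 2 in the statement comes from e < 3: one coin multiplies the exponential moment
      -- by π e + 1 - π ≤ 1 + 2 π.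
      have h2 : 1 + 2 * π h ≤ Real.exp (2 * q h.length) := by
        have := Real.add_one_le_exp (2 * q h.length)
        have := hG h hh hg.1
        linarith
      have he : Real.exp 1 < 3 := Real.exp_one_lt_three
      have h3 : Real.exp (-(2 * q h.length)) * (1 + 2 * π h) ≤ 1 := by
        calc _ ≤ Real.exp (-(2 * q h.length)) * Real.exp (2 * q h.length) := by gcongr
          _ = 1 := by rw [← Real.exp_add]; simp
      have h4 : Real.exp (-(2 * q h.length)) * (π h * Real.exp 1 + (1 - π h)) ≤
          Real.exp (-(2 * q h.length)) * (1 + 2 * π h) := by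
        refine mul_le_mul_of_nonneg_left ?_ hx0.le
        nlinarith [(hπ h).1]
      nlinarith
    · have h1 : ∀ b, ¬ PastGood Good (b :: h) := fun _ => hg
      rw [if_neg (h1 _), if_neg (h1 _)]
      simp only [mul_zero, add_zero]
      split_ifs
      · exact (Real.exp_pos _).le
      · exact le_rfl
  have hF0 : F [] = 1 := by simp [hF, PastGood]
  calc _ ≤ treeExp π n (fun h => Real.exp (-r) * F h) := by
        refine treeExp_mono hπ n fun h hh => ?_
        split_ifs with hb
        · simp only [hF]
          rw [if_pos hb.1, ← Real.exp_add, hh]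
          exact Real.one_le_exp (by linarith [hb.2])
        · simp only [hF]
          split_ifs <;> positivity
    _ = Real.exp (-r) * treeExp π n F := treeExp_const_mul _ _ _
    _ ≤ Real.exp (-r) * 1 := by rw [← hF0]; gcongr
    _ = _ := mul_one _

end Concentration


/-! ### Gram matrices and low rank residuals -/

section Frobenius

variable {n d : ℕ}

theorem frobSq_nonneg (M : Matrix (Fin n) (Fin d) ℝ) : 0 ≤ frobSq M :=
  Finset.sum_nonneg fun _ _ => Finset.sum_nonneg fun _ _ => sq_nonneg _

theorem frobSq_eq_trace (M : Matrix (Fin n) (Fin d) ℝ) : frobSq M = (Mᵀ * M).trace := by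
  simp only [frobSq, trace, diag_apply, mul_apply, transpose_apply, ← pow_two]
  exact Finset.sum_comm

theorem dotProduct_gram_mulVec (M : Matrix (Fin n) (Fin d) ℝ) (y : Fin d → ℝ) :
    y ⬝ᵥ ((Mᵀ * M) *ᵥ y) = (M *ᵥ y) ⬝ᵥ (M *ᵥ y) := by
  rw [← mulVec_mulVec, dotProduct_mulVec, ← mulVec_transpose, transpose_transpose]

theorem transpose_gram (M : Matrix (Fin n) (Fin d) ℝ) : (Mᵀ * M)ᵀ = Mᵀ * M := by
  rw [transpose_mul, transpose_transpose]

theorem frobSq_sub_mul_proj (A : Matrix (Fin n) (Fin d) ℝ) {P : Matrix (Fin d) (Fin d) ℝ}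
    (h1 : P * P = P) (h2 : Pᵀ = P) : frobSq (A - A * P) = ((1 - P) * (Aᵀ * A)).trace := by
  have hQ : (1 - P)ᵀ = 1 - P := by rw [transpose_sub, transpose_one, h2]
  have hQQ : (1 - P) * (1 - P) = 1 - P := by
    rw [mul_sub, sub_mul, sub_mul, h1]; simp
  rw [show A - A * P = A * (1 - P) by rw [Matrix.mul_sub, Matrix.mul_one], frobSq_eq_trace,
    transpose_mul, hQ, trace_mul_comm, Matrix.mul_assoc, ← Matrix.mul_assoc (1 - P), hQQ,
    trace_mul_comm, Matrix.mul_assoc, trace_mul_comm, Matrix.mul_assoc, trace_mul_comm,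
    Matrix.mul_assoc]

theorem lowRankResidual_nonneg (A : Matrix (Fin n) (Fin d) ℝ) (k : ℕ) : 0 ≤ lowRankResidual A k :=
  Real.iInf_nonneg fun _ => frobSq_nonneg _

theorem lowRankResidual_le (A X : Matrix (Fin n) (Fin d) ℝ) {k : ℕ} (h : X.rank ≤ k) :
    lowRankResidual A k ≤ frobSq (A - X) :=
  ciInf_le (f := fun X : {X : Matrix (Fin n) (Fin d) ℝ // X.rank ≤ k} => frobSq (A - X.1))
    ⟨0, by rintro _ ⟨X, rfl⟩; exact frobSq_nonneg _⟩ ⟨X, h⟩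

theorem le_lowRankResidual (A : Matrix (Fin n) (Fin d) ℝ) {k : ℕ} {r : ℝ}
    (h : ∀ X : Matrix (Fin n) (Fin d) ℝ, X.rank ≤ k → r ≤ frobSq (A - X)) :
    r ≤ lowRankResidual A k := by
  have : Nonempty {X : Matrix (Fin n) (Fin d) ℝ // X.rank ≤ k} := ⟨⟨0, by simp⟩⟩
  exact le_ciInf fun X => h X.1 X.2

theorem lowRankResidual_le_frobSq (A : Matrix (Fin n) (Fin d) ℝ) (k : ℕ) :
    lowRankResidual A k ≤ frobSq A := by
  simpa using lowRankResidual_le A 0 (k := k) (by simp)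

theorem lowRankResidual_eq_zero (A : Matrix (Fin n) (Fin d) ℝ) {k : ℕ} (h : d ≤ k) :
    lowRankResidual A k = 0 := by
  refine le_antisymm ?_ (lowRankResidual_nonneg A k)
  have := lowRankResidual_le A A (k := k) ((A.rank_le_width).trans h)
  simpa [frobSq] using this

/-- Deleting the last row of a competitor for t + 1 rows gives a competitor for t rows with no
larger error. -/
theorem lowRankResidual_prefixMatrix_mono (a : ℕ → Fin d → ℝ) (k : ℕ) :
    Monotone fun t => lowRankResidual (prefixMatrix a t) k := by
  refine monotone_nat_of_le_succ fun t => le_lowRankResidual _ fun X hX => ?_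
  refine (lowRankResidual_le _ (X.submatrix Fin.castSucc (Equiv.refl _))
    ((rank_submatrix_le _ _ _).trans hX)).trans ?_
  simp only [frobSq]
  rw [Fin.sum_univ_castSucc]
  refine le_add_of_le_of_nonneg (le_of_eq ?_) (Finset.sum_nonneg fun _ _ => sq_nonneg _)
  simp [prefixMatrix]

end Frobenius

/-! ### Eigenbases of Gram matrices and the Eckart–Young formula -/

section Eigen

theorem rank_conj_diagonal {m : Type*} [Fintype m] [DecidableEq m] {U : Matrix m m ℝ}
    (hU : U * Uᵀ = 1) (g : m → ℝ) :
    (U * diagonal g * Uᵀ).rank = Fintype.card {i // g i ≠ 0} := by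
  have h1 : IsUnit U.det := isUnit_det_of_right_inverse hU
  have h2 : IsUnit Uᵀ.det := isUnit_det_of_left_inverse hU
  rw [rank_mul_eq_left_of_isUnit_det _ _ h2, rank_mul_eq_right_of_isUnit_det _ _ h1, rank_diagonal]

/-- An orthonormal eigenbasis of `AᵀA` together with the positions `T` of its `min k d` largest
eigenvalues. -/
structure TopEigen {n d : ℕ} (A : Matrix (Fin n) (Fin d) ℝ) (k : ℕ) where
  U : Matrix (Fin d) (Fin d) ℝ
  g : Fin d → ℝ
  T : Finset (Fin d)
  mul_transpose : U * Uᵀ = 1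
  transpose_mul : Uᵀ * U = 1
  gram_eq : Aᵀ * A = U * diagonal g * Uᵀ
  nonneg : ∀ i, 0 ≤ g i
  card_eq : T.card = min k d
  le_of_mem : ∀ i ∈ T, ∀ j ∉ T, g j ≤ g i

theorem exists_top_finset {ι : Type*} [Fintype ι] (g : ι → ℝ) (r : ℕ)
    (hr : r ≤ Fintype.card ι) : ∃ T : Finset ι, T.card = r ∧ ∀ i ∈ T, ∀ j ∉ T, g j ≤ g i := by
  classical
  induction r with
  | zero => exact ⟨∅, by simp, by simp⟩
  | succ r ih =>
    obtain ⟨T, hT, hle⟩ := ih (by omega)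
    have hne : Tᶜ.Nonempty := by
      rw [← Finset.card_pos, Finset.card_compl]; omega
    obtain ⟨i₀, hi₀, hmax⟩ := Finset.exists_max_image Tᶜ g hne
    rw [Finset.mem_compl] at hi₀
    refine ⟨insert i₀ T, by rw [Finset.card_insert_of_notMem hi₀, hT], ?_⟩
    intro i hi j hj
    rw [Finset.mem_insert, not_or] at hj
    rcases Finset.mem_insert.1 hi with rfl | hi
    · exact hmax j (by simpa using hj.2)
    · exact hle i hi j hj.2

variable {n d : ℕ} {A : Matrix (Fin n) (Fin d) ℝ} {k : ℕ}

theorem eigenvalue_eq_gram {U : Matrix (Fin d) (Fin d) ℝ} {g : Fin d → ℝ} (hU : Uᵀ * U = 1)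
    (hG : Aᵀ * A = U * diagonal g * Uᵀ) (i : Fin d) :
    g i = (A *ᵥ U.col i) ⬝ᵥ (A *ᵥ U.col i) := by
  have hcol : Uᵀ *ᵥ U.col i = Pi.single i 1 := by
    rw [← mulVec_single_one, mulVec_mulVec, hU, one_mulVec]
  rw [← dotProduct_gram_mulVec, hG, dotProduct_conj_diagonal_mulVec, hcol]
  rw [Finset.sum_eq_single i] <;> simp +contextual

theorem nonempty_topEigen (A : Matrix (Fin n) (Fin d) ℝ) (k : ℕ) : Nonempty (TopEigen A k) := by
  obtain ⟨U, g, h1, h2, h3⟩ := exists_orthogonal_diagonalization (Aᵀ * A) (transpose_gram A)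
  obtain ⟨T, hT, hle⟩ := exists_top_finset g (min k d) (by simp)
  exact ⟨⟨U, g, T, h1, h2, h3, fun i => by
    rw [eigenvalue_eq_gram h2 h3]; exact dotProduct_self_nonneg _, hT, hle⟩⟩

namespace TopEigen

theorem sum_eq_frobSq (E : TopEigen A k) : ∑ i, E.g i = frobSq A := by
  rw [frobSq_eq_trace, E.gram_eq, trace_mul_comm, ← Matrix.mul_assoc, E.transpose_mul,
    Matrix.one_mul, trace_diagonal]

/-- The projection onto the span of the top eigenvectors. -/
noncomputable def proj (E : TopEigen A k) : Matrix (Fin d) (Fin d) ℝ :=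
  E.U * diagonal (fun i => if i ∈ E.T then 1 else 0) * E.Uᵀ

theorem conj_mul_conj (E : TopEigen A k) (X Y : Matrix (Fin d) (Fin d) ℝ) :
    E.U * X * E.Uᵀ * (E.U * Y * E.Uᵀ) = E.U * (X * Y) * E.Uᵀ := by
  calc E.U * X * E.Uᵀ * (E.U * Y * E.Uᵀ) = E.U * X * (E.Uᵀ * E.U) * Y * E.Uᵀ := by
        simp only [Matrix.mul_assoc]
    _ = E.U * (X * Y) * E.Uᵀ := by
        rw [E.transpose_mul]; simp only [Matrix.mul_assoc, Matrix.mul_one]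

theorem transpose_conj_diagonal (E : TopEigen A k) (v : Fin d → ℝ) :
    (E.U * diagonal v * E.Uᵀ)ᵀ = E.U * diagonal v * E.Uᵀ := by
  simp [Matrix.transpose_mul, Matrix.mul_assoc]

theorem proj_isRankOrthProj (E : TopEigen A k) (hk : k ≤ d) : IsRankOrthProj k E.proj := by
  refine ⟨?_, E.transpose_conj_diagonal _, ?_⟩
  · rw [proj, conj_mul_conj, diagonal_mul_diagonal]
    simp only [mul_ite, mul_one, mul_zero, ← ite_and, and_self]
  · rw [proj, rank_conj_diagonal E.mul_transpose]
    simp [Fintype.card_subtype, E.card_eq, hk]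

theorem trace_conj_diagonal (E : TopEigen A k) (v : Fin d → ℝ) :
    (E.U * diagonal v * E.Uᵀ).trace = ∑ i, v i := by
  rw [trace_mul_comm, ← Matrix.mul_assoc, E.transpose_mul, Matrix.one_mul, trace_diagonal]

theorem frobSq_sub_proj (E : TopEigen A k) : frobSq (A - A * E.proj) = ∑ i ∈ E.Tᶜ, E.g i := by
  have hp : E.proj * E.proj = E.proj := by
    rw [proj, conj_mul_conj, diagonal_mul_diagonal]
    simp only [mul_ite, mul_one, mul_zero, ← ite_and, and_self]
  rw [frobSq_sub_mul_proj A hp (E.transpose_conj_diagonal _), sub_mul, Matrix.one_mul, trace_sub,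
    proj, E.gram_eq, conj_mul_conj, diagonal_mul_diagonal, E.trace_conj_diagonal,
    E.trace_conj_diagonal, ← Finset.sum_sub_distrib, ← Finset.sum_subset (Finset.subset_univ E.Tᶜ)]
  · exact Finset.sum_congr rfl fun i hi => by simp [Finset.mem_compl.1 hi]
  · intro i _ hi
    simp [Finset.mem_compl.not_left.1 hi]

/-- A fractional knapsack bound: weights in [0, 1] of total mass at least d - k do best on the
smallest eigenvalues. Both sides are compared with the largest eigenvalue outside `T`. -/
theorem sum_compl_le_sum_mul (E : TopEigen A k) (z : Fin d → ℝ) (h0 : ∀ i, 0 ≤ z i)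
    (h1 : ∀ i, z i ≤ 1) (hz : (d : ℝ) - k ≤ ∑ i, z i) :
    ∑ i ∈ E.Tᶜ, E.g i ≤ ∑ i, E.g i * z i := by
  rcases E.Tᶜ.eq_empty_or_nonempty with he | hne
  · rw [he, Finset.sum_empty]
    exact Finset.sum_nonneg fun i _ => mul_nonneg (E.nonneg i) (h0 i)
  obtain ⟨j₀, hj₀, hmax⟩ := Finset.exists_max_image E.Tᶜ E.g hne
  rw [Finset.mem_compl] at hj₀
  have hcard : (E.Tᶜ.card : ℝ) = d - k := by
    have h2 : E.T.card < d := by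
      have := Finset.card_lt_univ_of_notMem hj₀
      simpa using this
    have h3 : E.T.card = k := by have := E.card_eq; omega
    rw [Finset.card_compl, Fintype.card_fin, Nat.cast_sub h2.le, h3]
  have ht : ∑ i ∈ E.T, E.g j₀ * z i ≤ ∑ i ∈ E.T, E.g i * z i :=
    Finset.sum_le_sum fun i hi => mul_le_mul_of_nonneg_right (E.le_of_mem i hi j₀ hj₀) (h0 i)
  have hc : ∑ i ∈ E.Tᶜ, E.g i * (1 - z i) ≤ ∑ i ∈ E.Tᶜ, E.g j₀ * (1 - z i) :=
    Finset.sum_le_sum fun i hi => mul_le_mul_of_nonneg_right (hmax i hi) (sub_nonneg.2 (h1 i))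
  have hsplit := Finset.sum_add_sum_compl E.T (fun i => E.g i * z i)
  have hsplit2 := Finset.sum_add_sum_compl E.T z
  simp only [mul_sub, mul_one, Finset.sum_sub_distrib, ← Finset.mul_sum, Finset.sum_const,
    nsmul_eq_mul, hcard] at ht hc
  have := E.nonneg j₀
  rw [← hsplit]
  have h5 : E.g j₀ * ((d : ℝ) - k) ≤ E.g j₀ * ∑ i, z i := mul_le_mul_of_nonneg_left hz this
  rw [← hsplit2] at h5
  linarith

/-- Eckart–Young. For the lower bound, an orthonormal eigenbasis of XᵀX contains at least d - k
vectors killed by X, on which A - X acts as A. The squared entries of the change of basis are doubly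
stochastic, which reduces the claim to the knapsack bound. -/
theorem lowRankResidual_eq (E : TopEigen A k) : lowRankResidual A k = ∑ i ∈ E.Tᶜ, E.g i := by
  refine le_antisymm ?_ (le_lowRankResidual A fun X hX => ?_)
  · rcases le_total k d with hk | hk
    · rw [← E.frobSq_sub_proj]
      exact lowRankResidual_le _ _ ((rank_mul_le_right _ _).trans (E.proj_isRankOrthProj hk).2.2.le)
    · rw [lowRankResidual_eq_zero A hk]
      exact Finset.sum_nonneg fun i _ => E.nonneg i
  · obtain ⟨V, s, h1, h2, h3⟩ := exists_orthogonal_diagonalization (Xᵀ * X) (transpose_gram X)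
    have hrank : Fintype.card {i // s i ≠ 0} ≤ k := by
      rw [← rank_conj_diagonal h1, ← h3, rank_transpose_mul_self]; exact hX
    set Z : Finset (Fin d) := Finset.univ.filter fun i => s i = 0 with hZ
    have hZc : (d : ℝ) - k ≤ Z.card := by
      rw [Fintype.card_subtype] at hrank
      have := Finset.card_filter_add_card_filter_not (s := Finset.univ) (fun i => s i = 0)
      rw [Finset.card_univ, Fintype.card_fin] at this
      have h4 : d ≤ Z.card + k := by
        have h5 : (Finset.univ.filter fun i => ¬ s i = 0).card ≤ k := hrank
        rw [hZ]; omega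
      have : (d : ℝ) ≤ Z.card + k := by exact_mod_cast h4
      linarith
    have hX0 : ∀ i ∈ Z, X *ᵥ V.col i = 0 := by
      intro i hi
      rw [← dotProduct_self_eq_zero, ← eigenvalue_eq_gram h2 h3]
      exact (Finset.mem_filter.1 hi).2
    set W := E.Uᵀ * V with hW
    have hWW : W * Wᵀ = 1 := by
      rw [hW, Matrix.transpose_mul, transpose_transpose, Matrix.mul_assoc, ← Matrix.mul_assoc V, h1,
        Matrix.one_mul, E.transpose_mul]
    have hWW' : Wᵀ * W = 1 := mul_eq_one_comm.1 hWW
    have hrow : ∀ j, ∑ i, W j i ^ 2 = 1 := by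
      intro j
      have := congrFun (congrFun hWW j) j
      simpa [mul_apply, ← pow_two] using this
    have hcol : ∀ i, ∑ j, W j i ^ 2 = 1 := by
      intro i
      have := congrFun (congrFun hWW' i) i
      simpa [mul_apply, ← pow_two] using this
    have hfro : ∑ i, ((A - X) *ᵥ V.col i) ⬝ᵥ ((A - X) *ᵥ V.col i) = frobSq (A - X) := by
      have e : frobSq (A - X) = (((A - X) * V)ᵀ * ((A - X) * V)).trace := by
        rw [Matrix.transpose_mul, trace_mul_comm, Matrix.mul_assoc, ← Matrix.mul_assoc V, h1,
          Matrix.one_mul, trace_mul_comm, frobSq_eq_trace]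
      rw [e, ← frobSq_eq_trace, frobSq, Finset.sum_comm]
      simp only [dotProduct, mulVec, mul_apply, col_apply, ← pow_two]
    have hAi : ∀ i, (A *ᵥ V.col i) ⬝ᵥ (A *ᵥ V.col i) = ∑ j, E.g j * W j i ^ 2 := by
      intro i
      rw [← dotProduct_gram_mulVec, E.gram_eq, dotProduct_conj_diagonal_mulVec]
      simp only [hW, mul_apply, mulVec, dotProduct, col_apply]
    calc ∑ i ∈ E.Tᶜ, E.g i ≤ ∑ j, E.g j * ∑ i ∈ Z, W j i ^ 2 := by
          refine E.sum_compl_le_sum_mul _ (fun j => Finset.sum_nonneg fun _ _ => sq_nonneg _)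
            (fun j => ?_) ?_
          · rw [← hrow j]
            exact Finset.sum_le_sum_of_subset_of_nonneg (Finset.subset_univ _)
              fun _ _ _ => sq_nonneg _
          · rw [Finset.sum_comm]
            simpa [hcol] using hZc
      _ = ∑ i ∈ Z, ∑ j, E.g j * W j i ^ 2 := by
          rw [Finset.sum_comm]
          exact Finset.sum_congr rfl fun j _ => Finset.mul_sum _ _ _
      _ = ∑ i ∈ Z, ((A - X) *ᵥ V.col i) ⬝ᵥ ((A - X) *ᵥ V.col i) := by
          refine Finset.sum_congr rfl fun i hi => ?_
          rw [← hAi, sub_mulVec, hX0 i hi, sub_zero]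
      _ ≤ frobSq (A - X) := by
          rw [← hfro]
          exact Finset.sum_le_sum_of_subset_of_nonneg (Finset.subset_univ _)
              fun _ _ _ => dotProduct_self_nonneg _

/-- The columns of U are eigenvectors of the adjoint composed with the map of A, so each eigenvalue
is a squared singular value. -/
theorem sq_le_of_singularValuesGE (E : TopEigen A k) {μ : ℝ} (hμ : 0 < μ)
    (h : SingularValuesGE A μ) (j : Fin d) (hj : E.g j ≠ 0) : μ ^ 2 ≤ E.g j := by
  set L := Matrix.toEuclideanLin A with hL
  have hadj : LinearMap.adjoint L = Matrix.toEuclideanLin Aᵀ := by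
    rw [hL, ← Matrix.toEuclideanLin_conjTranspose_eq_adjoint, conjTranspose_eq_transpose_of_trivial]
  have hcol : E.Uᵀ *ᵥ E.U.col j = Pi.single j 1 := by
    rw [← mulVec_single_one, mulVec_mulVec, E.transpose_mul, one_mulVec]
  have heig : (Aᵀ * A) *ᵥ E.U.col j = E.g j • E.U.col j := by
    rw [E.gram_eq, ← mulVec_mulVec, hcol, ← mulVec_mulVec, diagonal_mulVec_single, mul_one,
      ← mulVec_single_one, ← mulVec_smul, ← Pi.single_smul, smul_eq_mul, mul_one]
  have hev : Module.End.HasEigenvalue (LinearMap.adjoint L ∘ₗ L) (E.g j) := by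
    refine Module.End.hasEigenvalue_of_hasEigenvector (x := WithLp.toLp 2 (E.U.col j)) ⟨?_, ?_⟩
    · rw [Module.End.mem_eigenspace_iff, hadj, hL, LinearMap.comp_apply]
      rw [toLpLin_toLp, toLpLin_toLp, toLin'_apply, toLin'_apply, mulVec_mulVec, heig]
      rfl
    · intro h0
      have h1 : E.U.col j = 0 := by simpa using h0
      rw [h1, mulVec_zero] at hcol
      have := congrFun hcol j
      simp at this
  obtain ⟨i, hi⟩ := L.isSymmetric_adjoint_comp_self.exists_eigenvalues_eq rfl hev
  have hsq := L.sq_singularValues_fin rfl i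
  have hi' : L.isSymmetric_adjoint_comp_self.eigenvalues rfl i = E.g j := by simpa using hi
  rw [hi'] at hsq
  have hne : L.singularValues i ≠ 0 := by
    intro h0; rw [h0] at hsq; exact hj (by simpa using hsq.symm)
  rw [← hsq]
  exact pow_le_pow_left₀ hμ.le (h i hne) 2

end TopEigen

/-- The witness is the orthogonal projection of y onto the row space of A, that is, y without its
components along zero eigenvalues. Only the eigenbasis is used, so the value 0 given to `TopEigen`
is arbitrary. -/
theorem exists_mulVec_eq_of_singularValuesGE {μ : ℝ} (hμ : 0 < μ) (h : SingularValuesGE A μ)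
    (y : Fin d → ℝ) : ∃ y', A *ᵥ y' = A *ᵥ y ∧ μ ^ 2 * (y' ⬝ᵥ y') ≤ y ⬝ᵥ ((Aᵀ * A) *ᵥ y) := by
  obtain ⟨E⟩ := nonempty_topEigen A 0
  set v : Fin d → ℝ := fun i => if E.g i = 0 then 0 else 1 with hv
  set y' := (E.U * diagonal v * E.Uᵀ) *ᵥ y with hy'
  have hUy : E.Uᵀ *ᵥ y' = fun i => v i * (E.Uᵀ *ᵥ y) i := by
    rw [hy', mulVec_mulVec, ← Matrix.mul_assoc, ← Matrix.mul_assoc, E.transpose_mul, Matrix.one_mul,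
      ← mulVec_mulVec]
    ext i
    rw [mulVec_diagonal]
  refine ⟨y', ?_, ?_⟩
  · rw [← sub_eq_zero, ← mulVec_sub, ← dotProduct_self_eq_zero, ← dotProduct_gram_mulVec, E.gram_eq,
      dotProduct_conj_diagonal_mulVec, mulVec_sub, hUy]
    refine Finset.sum_eq_zero fun i _ => ?_
    by_cases hi : E.g i = 0 <;> simp [hv, hi]
  · rw [E.gram_eq, dotProduct_conj_diagonal_mulVec,
      ← dotProduct_transpose_mulVec_self E.U E.mul_transpose, hUy, Finset.mul_sum]
    refine Finset.sum_le_sum fun i _ => ?_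
    by_cases hi : E.g i = 0
    · simp [hv, hi]
    · simp only [hv, hi, if_false, one_mul]
      exact mul_le_mul_of_nonneg_right (E.sq_le_of_singularValuesGE hμ h i hi) (sq_nonneg _)

theorem sq_le_lowRankResidual {μ : ℝ} (hμ : 0 < μ) (h : SingularValuesGE A μ) (k : ℕ)
    (h0 : lowRankResidual A k ≠ 0) : μ ^ 2 ≤ lowRankResidual A k := by
  obtain ⟨E⟩ := nonempty_topEigen A k
  rw [E.lowRankResidual_eq] at h0 ⊢
  obtain ⟨i, hi, hne⟩ := Finset.exists_ne_zero_of_sum_ne_zero h0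
  exact (E.sq_le_of_singularValuesGE hμ h i hne).trans
    (Finset.single_le_sum (fun j _ => E.nonneg j) hi)

theorem sq_le_frobSq {μ : ℝ} (hμ : 0 < μ) (h : SingularValuesGE A μ) (h0 : frobSq A ≠ 0) :
    μ ^ 2 ≤ frobSq A := by
  obtain ⟨E⟩ := nonempty_topEigen A 0
  rw [← E.sum_eq_frobSq] at h0 ⊢
  obtain ⟨i, hi, hne⟩ := Finset.exists_ne_zero_of_sum_ne_zero h0
  exact (E.sq_le_of_singularValuesGE hμ h i hne).trans
    (Finset.single_le_sum (fun j _ => E.nonneg j) hi)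

end Eigen


/-! ### Projection-cost preservation from a spectral bound and a tail trace bound -/

section ProjectionCost

variable {d : ℕ}

theorem trace_eq_rank_of_orthProj {k : ℕ} {P : Matrix (Fin d) (Fin d) ℝ} (h : IsRankOrthProj k P) :
    P.trace = k := by
  obtain ⟨h1, h2, h3⟩ := h
  obtain ⟨U, p, hU, hU', rfl⟩ := exists_orthogonal_diagonalization P h2
  have hp : ∀ i, p i * p i = p i := by
    intro i
    have e1 : ∀ X : Matrix (Fin d) (Fin d) ℝ, Uᵀ * (U * X * Uᵀ) * U = X := by
      intro X
      rw [show Uᵀ * (U * X * Uᵀ) * U = (Uᵀ * U) * X * (Uᵀ * U) by simp only [Matrix.mul_assoc], hU']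
      simp
    have e2 : U * diagonal p * Uᵀ * (U * diagonal p * Uᵀ) =
        U * (diagonal p * diagonal p) * Uᵀ := by
      rw [show U * diagonal p * Uᵀ * (U * diagonal p * Uᵀ) =
        U * diagonal p * (Uᵀ * U) * diagonal p * Uᵀ by simp only [Matrix.mul_assoc], hU']
      simp only [Matrix.mul_assoc, Matrix.mul_one]
    have e3 := congrArg (fun X => (Uᵀ * X * U) i i) h1
    simp only [e2, e1, diagonal_mul_diagonal, diagonal_apply_eq] at e3
    exact e3
  rw [trace_mul_comm, ← Matrix.mul_assoc, hU', Matrix.one_mul, trace_diagonal, ← h3,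
    rank_conj_diagonal hU, Fintype.card_subtype, Finset.card_filter]
  push_cast
  refine Finset.sum_congr rfl fun i _ => ?_
  by_cases hi : p i = 0
  · simp [hi]
  · simp only [ne_eq, hi, not_false_eq_true, if_true]
    exact mul_right_cancel₀ hi (by rw [hp i, one_mul])

/-- Cauchy–Schwarz for an indefinite form dominated by a diagonal one. Subtracting the bounds at s x
+ y and s x - y and applying the parallelogram law to N gives a nonnegative quadratic in s, whose
discriminant is the claim. -/
theorem bilinear_sq_le {D : Matrix (Fin d) (Fin d) ℝ} (hD : Dᵀ = D) {N : (Fin d → ℝ) → ℝ} {η : ℝ}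
    {w : Fin d → ℝ} (hN : ∀ x, N x = ∑ j, w j * x j ^ 2) (h : ∀ x, |x ⬝ᵥ (D *ᵥ x)| ≤ η * N x)
    (x y : Fin d → ℝ) : (x ⬝ᵥ (D *ᵥ y)) ^ 2 ≤ η * N x * (η * N y) := by
  have hsymm : y ⬝ᵥ (D *ᵥ x) = x ⬝ᵥ (D *ᵥ y) := by
    rw [dotProduct_mulVec, ← mulVec_transpose, hD, dotProduct_comm]
  have key : ∀ s : ℝ, 0 ≤ η * N x * (s * s) + (-(2 * (x ⬝ᵥ (D *ᵥ y)))) * s + η * N y := by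
    intro s
    have h1 := (abs_le.1 (h (s • x + y))).2
    have h2 := (abs_le.1 (h (s • x - y))).1
    have e1 : N (s • x + y) + N (s • x - y) = 2 * (s * s * N x + N y) := by
      simp only [hN, Finset.mul_sum, ← Finset.sum_add_distrib, Pi.add_apply, Pi.sub_apply,
        Pi.smul_apply, smul_eq_mul]
      exact Finset.sum_congr rfl fun j _ => by ring
    simp only [mulVec_add, mulVec_sub, mulVec_smul, add_dotProduct, sub_dotProduct, dotProduct_add,
      dotProduct_sub, smul_dotProduct, dotProduct_smul, smul_eq_mul, hsymm] at h1 h2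
    have e2 : η * N (s • x + y) + η * N (s • x - y) = η * (2 * (s * s * N x + N y)) := by
      rw [← e1]; ring
    nlinarith
  have := discrim_le_zero key
  rw [discrim] at this
  nlinarith

/-- A projection is the sum of the outer products of its columns. Truncating each column to S turns
the block sum into a sum of values of the form of D, to which the hypothesis applies. -/
theorem abs_sum_proj_mul_le {D R : Matrix (Fin d) (Fin d) ℝ} {η : ℝ} {w : Fin d → ℝ}
    (h : ∀ x : Fin d → ℝ, |x ⬝ᵥ (D *ᵥ x)| ≤ η * ∑ j, w j * x j ^ 2)
    (hR : R * R = R) (hR' : Rᵀ = R) (S : Finset (Fin d)) :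
    |∑ i ∈ S, ∑ j ∈ S, R i j * D i j| ≤ η * ∑ j ∈ S, w j * R j j := by
  have hRR : ∀ i j, R i j = ∑ l, R i l * R j l := by
    intro i j
    conv_lhs => rw [← hR, mul_apply]
    refine Finset.sum_congr rfl fun l _ => ?_
    rw [← congrFun (congrFun hR' l) j, transpose_apply]
  set v : Fin d → Fin d → ℝ := fun l i => if i ∈ S then R i l else 0 with hv
  have e1 : ∑ i ∈ S, ∑ j ∈ S, R i j * D i j = ∑ l, v l ⬝ᵥ (D *ᵥ v l) := by
    have : ∀ l, v l ⬝ᵥ (D *ᵥ v l) = ∑ i ∈ S, ∑ j ∈ S, R i l * R j l * D i j := by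
      intro l
      simp only [dotProduct, mulVec]
      rw [← Finset.sum_subset (Finset.subset_univ S) (fun i _ hi => by simp [hv, hi])]
      refine Finset.sum_congr rfl fun i hi => ?_
      rw [← Finset.sum_subset (Finset.subset_univ S) (fun j _ hj => by simp [hv, hj]),
        Finset.mul_sum]
      refine Finset.sum_congr rfl fun j hj => ?_
      simp only [hv, hi, hj, if_true]
      ring
    simp only [this]
    conv_rhs => rw [Finset.sum_comm]
    refine Finset.sum_congr rfl fun i _ => ?_
    rw [Finset.sum_comm]
    refine Finset.sum_congr rfl fun j _ => ?_
    rw [hRR i j, Finset.sum_mul]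
  have e2 : ∑ l, ∑ j, w j * v l j ^ 2 = ∑ j ∈ S, w j * R j j := by
    rw [Finset.sum_comm, ← Finset.sum_subset (Finset.subset_univ S)]
    · refine Finset.sum_congr rfl fun j hj => ?_
      rw [hRR j j, Finset.mul_sum]
      exact Finset.sum_congr rfl fun l _ => by simp [hv, hj, pow_two]
    · intro j _ hj
      simp [hv, hj]
  rw [e1, ← e2, Finset.mul_sum]
  exact (Finset.abs_sum_le_sum_abs _ _).trans (Finset.sum_le_sum fun l _ => h _)

/-- The projection-cost bound in eigencoordinates. -/
theorem abs_sum_compl_proj_mul_le {D P : Matrix (Fin d) (Fin d) ℝ} {g : Fin d → ℝ}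
    {lam η k : ℝ} (hD : Dᵀ = D) (hg : ∀ i, 0 ≤ g i) (hlam : 0 ≤ lam) (hη : 0 ≤ η)
    (h : ∀ x : Fin d → ℝ, |x ⬝ᵥ (D *ᵥ x)| ≤ η * ∑ j, (g j + lam) * x j ^ 2)
    (htail : |∑ j with g j < lam, D j j| ≤ η * (k * lam))
    (hhead : (Finset.univ.filter fun j => ¬ g j < lam).card * lam ≤ 2 * (k * lam))
    (hP : P * P = P) (hP' : Pᵀ = P) (htr : P.trace = k)
    (hcost : k * lam ≤ ∑ j, g j * (1 - P) j j) :
    |∑ i, ∑ j, (1 - P) i j * D i j| ≤ 11 * η * ∑ j, g j * (1 - P) j j := by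
  set Q := 1 - P with hQ
  have hQQ : Q * Q = Q := by rw [hQ, mul_sub, sub_mul, sub_mul, hP]; simp
  have hQ' : Qᵀ = Q := by rw [hQ, transpose_sub, transpose_one, hP']
  have diag_nonneg : ∀ {R : Matrix (Fin d) (Fin d) ℝ}, R * R = R → Rᵀ = R → ∀ j, 0 ≤ R j j ∧
      R j j = ∑ l, R j l ^ 2 := by
    intro R h1 h2 j
    have : R j j = ∑ l, R j l ^ 2 := by
      conv_lhs => rw [← h1, mul_apply]
      refine Finset.sum_congr rfl fun l _ => ?_
      rw [pow_two, ← congrFun (congrFun h2 l) j, transpose_apply]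
    exact ⟨this ▸ Finset.sum_nonneg fun _ _ => sq_nonneg _, this⟩
  set T := ∑ j, g j * Q j j with hT
  have hT0 : ∀ j, 0 ≤ g j * Q j j := fun j => mul_nonneg (hg j) (diag_nonneg hQQ hQ' j).1
  set Tl := Finset.univ.filter fun j => g j < lam with hTl
  set Hd := Finset.univ.filter fun j => ¬ g j < lam with hHd
  have hsum : ∀ f : Fin d → ℝ, ∑ i, f i = ∑ i ∈ Hd, f i + ∑ i ∈ Tl, f i := by
    intro f
    rw [add_comm]; exact (Finset.sum_filter_add_sum_filter_not _ _ _).symm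
  have hmemH : ∀ {j}, j ∈ Hd → lam ≤ g j := fun hj => not_lt.1 (Finset.mem_filter.1 hj).2
  have hmemT : ∀ {j}, j ∈ Tl → g j ≤ lam := fun hj => (Finset.mem_filter.1 hj).2.le
  have hTH : ∑ j ∈ Hd, g j * Q j j ≤ T :=
    Finset.sum_le_sum_of_subset_of_nonneg (Finset.subset_univ _) fun j _ _ => hT0 j
  -- head block
  have hhh : |∑ i ∈ Hd, ∑ j ∈ Hd, Q i j * D i j| ≤ 2 * η * T := by
    refine (abs_sum_proj_mul_le h hQQ hQ' Hd).trans ?_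
    have : ∑ j ∈ Hd, (g j + lam) * Q j j ≤ 2 * T := by
      refine le_trans ?_ (mul_le_mul_of_nonneg_left hTH zero_le_two)
      rw [Finset.mul_sum]
      refine Finset.sum_le_sum fun j hj => ?_
      have := hmemH hj
      have := (diag_nonneg hQQ hQ' j).1
      nlinarith
    nlinarith
  -- tail block
  have htt : |∑ i ∈ Tl, ∑ j ∈ Tl, Q i j * D i j| ≤ 3 * η * T := by
    have e : ∑ i ∈ Tl, ∑ j ∈ Tl, Q i j * D i j =
        ∑ j ∈ Tl, D j j - ∑ i ∈ Tl, ∑ j ∈ Tl, P i j * D i j := by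
      rw [← Finset.sum_sub_distrib]
      refine Finset.sum_congr rfl fun i hi => ?_
      simp only [hQ, Matrix.sub_apply, sub_mul, Finset.sum_sub_distrib, one_apply, ite_mul, one_mul,
        zero_mul, Finset.sum_ite_eq, hi, if_true]
    -- On the tail the weights are at most 2 lam and P has trace k, so this error does not grow with
    -- the number of tail directions.
    have hPt : ∑ j ∈ Tl, (g j + lam) * P j j ≤ 2 * (k * lam) := by
      calc ∑ j ∈ Tl, (g j + lam) * P j j ≤ ∑ j ∈ Tl, 2 * lam * P j j := by
            refine Finset.sum_le_sum fun j hj => ?_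
            have := hmemT hj
            have := (diag_nonneg hP hP' j).1
            nlinarith
        _ ≤ ∑ j, 2 * lam * P j j :=
            Finset.sum_le_sum_of_subset_of_nonneg (Finset.subset_univ _) fun j _ _ =>
              mul_nonneg (by positivity) (diag_nonneg hP hP' j).1
        _ = 2 * (k * lam) := by
            rw [← Finset.mul_sum, ← htr]; simp only [trace, diag_apply]; ring
    have h1 := abs_sum_proj_mul_le h hP hP' Tl
    rw [e]
    refine (abs_sub _ _).trans ?_
    nlinarith
  -- cross block
  have hht : |2 * ∑ i ∈ Hd, ∑ j ∈ Tl, Q i j * D i j| ≤ 6 * η * T := by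
    set v : Fin d → Fin d → ℝ := fun i j => if j ∈ Tl then Q i j else 0 with hv
    have e : ∀ i, ∑ j ∈ Tl, Q i j * D i j = (Pi.single i 1 : Fin d → ℝ) ⬝ᵥ (D *ᵥ v i) := by
      intro i
      rw [single_one_dotProduct]
      simp only [mulVec, dotProduct, hv, mul_ite, mul_zero, Finset.sum_ite_mem, Finset.univ_inter]
      exact Finset.sum_congr rfl fun j _ => mul_comm _ _
    have hb : ∀ i ∈ Hd, |2 * ∑ j ∈ Tl, Q i j * D i j| ≤ 2 * η * (g i * Q i i + lam) := by
      intro i hi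
      rw [e, abs_mul, abs_two, mul_assoc]
      refine mul_le_mul_of_nonneg_left ?_ zero_le_two
      have hQi := (diag_nonneg hQQ hQ' i)
      -- Cauchy–Schwarz between the i-th unit vector and the tail part of row i of Q, followed by
      -- 4ab ≤ (a + b)² with a = g i * Q i i and b = lam. The terms lam, summed over the head, total
      -- at most 2 k lam by `hhead`.
      refine abs_le_of_sq_le_sq ?_ (by have := hT0 i; positivity)
      refine (bilinear_sq_le hD (fun _ => rfl) h _ _).trans ?_
      have n1 : ∑ j, (g j + lam) * (Pi.single i 1 : Fin d → ℝ) j ^ 2 = g i + lam := by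
        rw [Finset.sum_eq_single i] <;> simp +contextual
      have n2 : ∑ j, (g j + lam) * v i j ^ 2 ≤ 2 * lam * Q i i := by
        rw [hQi.2, Finset.mul_sum]
        refine Finset.sum_le_sum fun j _ => ?_
        by_cases hj : j ∈ Tl
        · have := hmemT hj
          simp only [hv, hj, if_true]
          nlinarith [sq_nonneg (Q i j)]
        · simp only [hv, hj, if_false]
          have := sq_nonneg (Q i j)
          simp only [ne_eq, OfNat.ofNat_ne_zero, not_false_eq_true, zero_pow, mul_zero]
          positivity
      rw [n1]
      have hgi := hmemH hi
      calc η * (g i + lam) * (η * ∑ j, (g j + lam) * v i j ^ 2)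
          ≤ η * (2 * g i) * (η * (2 * lam * Q i i)) := by
            have : 0 ≤ ∑ j, (g j + lam) * v i j ^ 2 := Finset.sum_nonneg fun j _ =>
              mul_nonneg (add_nonneg (hg j) hlam) (sq_nonneg _)
            have := hg i
            gcongr
            linarith
        _ = η ^ 2 * (4 * (g i * Q i i) * lam) := by ring
        _ ≤ η ^ 2 * (g i * Q i i + lam) ^ 2 := by
            gcongr
            nlinarith [sq_nonneg (g i * Q i i - lam)]
        _ = (η * (g i * Q i i + lam)) ^ 2 := by ring
    rw [Finset.mul_sum]
    refine (Finset.abs_sum_le_sum_abs _ _).trans ((Finset.sum_le_sum hb).trans ?_)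
    rw [← Finset.mul_sum, Finset.sum_add_distrib, Finset.sum_const, nsmul_eq_mul]
    nlinarith
  have hsymm : ∑ i ∈ Tl, ∑ j ∈ Hd, Q i j * D i j = ∑ i ∈ Hd, ∑ j ∈ Tl, Q i j * D i j := by
    rw [Finset.sum_comm]
    refine Finset.sum_congr rfl fun i _ => Finset.sum_congr rfl fun j _ => ?_
    rw [← congrFun (congrFun hQ' i) j, ← congrFun (congrFun hD i) j, transpose_apply,
      transpose_apply]
  have etot : ∑ i, ∑ j, Q i j * D i j = ∑ i ∈ Hd, ∑ j ∈ Hd, Q i j * D i j +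
      2 * ∑ i ∈ Hd, ∑ j ∈ Tl, Q i j * D i j + ∑ i ∈ Tl, ∑ j ∈ Tl, Q i j * D i j := by
    rw [hsum]
    simp only [hsum fun j => Q _ j * D _ j, Finset.sum_add_distrib, hsymm]
    ring
  -- The head, cross and tail blocks contribute 2 + 6 + 3 = 11.
  rw [etot]
  refine (abs_add_three _ _ _).trans ?_
  linarith

variable {n k : ℕ} {A : Matrix (Fin n) (Fin d) ℝ}

/-- The trace of `D` on the span of the eigenvectors of `AᵀA` with eigenvalue below `lam`. -/
noncomputable def TopEigen.tailTrace (E : TopEigen A k) (lam : ℝ) (D : Matrix (Fin d) (Fin d) ℝ) :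
    ℝ :=
  ∑ j with E.g j < lam, (E.Uᵀ * D * E.U) j j

/-- At most k head indices lie in `T`. Each of the others takes at least lam out of the residual. -/
theorem TopEigen.card_head_mul_le (E : TopEigen A k) {lam : ℝ} (hlam : 0 ≤ lam)
    (h : lowRankResidual A k ≤ k * lam) :
    (Finset.univ.filter fun j => ¬ E.g j < lam).card * lam ≤ 2 * (k * lam) := by
  have h1 : ((Finset.univ.filter fun j => ¬ E.g j < lam).card : ℝ) * lam =
      ∑ j with ¬ E.g j < lam, lam := by simp
  have hT : (E.T.card : ℝ) ≤ k := by
    rw [E.card_eq]; exact_mod_cast min_le_left _ _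
  rw [h1, Finset.sum_filter, ← Finset.sum_add_sum_compl E.T]
  have h2 : ∑ i ∈ E.T, (if ¬ E.g i < lam then lam else 0) ≤ k * lam := by
    refine (Finset.sum_le_sum (g := fun _ => lam) fun i _ => ?_).trans ?_
    · split_ifs <;> simp [hlam]
    · rw [Finset.sum_const, nsmul_eq_mul]; gcongr
  have h3 : ∑ i ∈ E.Tᶜ, (if ¬ E.g i < lam then lam else 0) ≤ ∑ i ∈ E.Tᶜ, E.g i := by
    refine Finset.sum_le_sum fun i _ => ?_
    by_cases hi : E.g i < lam
    · simpa [hi] using E.nonneg i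
    · rw [if_pos hi]; exact not_lt.1 hi
  rw [← E.lowRankResidual_eq] at h3
  linarith

/-- Conjugating by the eigenbasis makes AᵀA diagonal. The cost of P is at least the residual because
A P has rank at most k. -/
theorem abs_trace_compl_proj_mul_le (hk : 1 ≤ k) (E : TopEigen A k) {D : Matrix (Fin d) (Fin d) ℝ}
    (hD : Dᵀ = D) {η : ℝ} (hη : 0 ≤ η)
    (h : ∀ x : Fin d → ℝ, |x ⬝ᵥ (D *ᵥ x)| ≤
      η * (x ⬝ᵥ ((Aᵀ * A) *ᵥ x) + lowRankResidual A k / k * (x ⬝ᵥ x)))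
    (htail : |E.tailTrace (lowRankResidual A k / k) D| ≤ η * lowRankResidual A k)
    {P : Matrix (Fin d) (Fin d) ℝ} (hP : IsRankOrthProj k P) :
    |((1 - P) * D).trace| ≤ 11 * η * ((1 - P) * (Aᵀ * A)).trace := by
  have hk0 : (0 : ℝ) < k := by exact_mod_cast hk
  set lam := lowRankResidual A k / k with hlam
  have hlam0 : 0 ≤ lam := div_nonneg (lowRankResidual_nonneg A k) hk0.le
  have hkl : k * lam = lowRankResidual A k := by rw [hlam]; field_simp
  have hconj : ∀ X Y : Matrix (Fin d) (Fin d) ℝ,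
      (E.Uᵀ * X * E.U) * (E.Uᵀ * Y * E.U) = E.Uᵀ * (X * Y) * E.U := by
    intro X Y
    rw [show (E.Uᵀ * X * E.U) * (E.Uᵀ * Y * E.U) = E.Uᵀ * X * (E.U * E.Uᵀ) * Y * E.U by
      simp only [Matrix.mul_assoc], E.mul_transpose]
    simp only [Matrix.mul_assoc, Matrix.mul_one]
  have htrc : ∀ X : Matrix (Fin d) (Fin d) ℝ, (E.Uᵀ * X * E.U).trace = X.trace := by
    intro X
    rw [trace_mul_comm, ← Matrix.mul_assoc, E.mul_transpose, Matrix.one_mul]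
  have htrans : ∀ X : Matrix (Fin d) (Fin d) ℝ, (E.Uᵀ * X * E.U)ᵀ = E.Uᵀ * Xᵀ * E.U := by
    intro X
    simp [Matrix.transpose_mul, Matrix.mul_assoc]
  have hG : E.Uᵀ * (Aᵀ * A) * E.U = diagonal E.g := by
    rw [E.gram_eq, show E.Uᵀ * (E.U * diagonal E.g * E.Uᵀ) * E.U =
      (E.Uᵀ * E.U) * diagonal E.g * (E.Uᵀ * E.U) by simp only [Matrix.mul_assoc], E.transpose_mul]
    simp
  set P' := E.Uᵀ * P * E.U with hP'
  set D' := E.Uᵀ * D * E.U with hD'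
  have hQ : E.Uᵀ * (1 - P) * E.U = 1 - P' := by
    rw [hP', mul_sub, sub_mul, Matrix.mul_one, E.transpose_mul]
  have hD's : D'ᵀ = D' := by rw [hD', htrans, hD]
  have hQ's : (1 - P')ᵀ = 1 - P' := by rw [hP', transpose_sub, transpose_one, htrans, hP.2.1]
  have hcost : ((1 - P) * (Aᵀ * A)).trace = ∑ j, E.g j * (1 - P') j j := by
    rw [← htrc, ← hconj, hQ, hG]
    simp only [trace, diag_apply, mul_diagonal, mul_comm]
  have hexp : ((1 - P) * D).trace = ∑ i, ∑ j, (1 - P') i j * D' i j := by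
    rw [← htrc, ← hconj, hQ, ← hD']
    simp only [trace, diag_apply, mul_apply]
    refine Finset.sum_congr rfl fun i _ => Finset.sum_congr rfl fun j _ => ?_
    rw [← congrFun (congrFun hD's j) i, transpose_apply]
  rw [hcost, hexp]
  refine abs_sum_compl_proj_mul_le hD's E.nonneg hlam0 hη (fun x => ?_) ?_
    (E.card_head_mul_le hlam0 hkl.ge) ?_ ?_ ?_ ?_ (k := k)
  · have h1 := h (E.U *ᵥ x)
    have hq : ∀ X : Matrix (Fin d) (Fin d) ℝ,
        (E.U *ᵥ x) ⬝ᵥ (X *ᵥ (E.U *ᵥ x)) = x ⬝ᵥ ((E.Uᵀ * X * E.U) *ᵥ x) := by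
      intro X
      rw [← mulVec_mulVec, ← mulVec_mulVec, dotProduct_mulVec x, ← mulVec_transpose,
        transpose_transpose]
    have h2 : (E.U *ᵥ x) ⬝ᵥ (E.U *ᵥ x) = x ⬝ᵥ x := by
      have := hq 1
      rwa [Matrix.mul_one, E.transpose_mul, one_mulVec, one_mulVec] at this
    rw [hq, hq, h2, hG] at h1
    refine h1.trans (le_of_eq ?_)
    simp only [dotProduct, mulVec_diagonal, add_mul, Finset.sum_add_distrib, Finset.mul_sum]
    congr 2
    · exact Finset.sum_congr rfl fun _ _ => by ring
    · exact Finset.sum_congr rfl fun _ _ => by ring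
  · rw [hkl]; exact htail
  · rw [hP', hconj, hP.1]
  · rw [hP', htrans, hP.2.1]
  · rw [hP', htrc, trace_eq_rank_of_orthProj hP]
  · rw [← hcost, hkl, ← frobSq_sub_mul_proj A hP.1 hP.2.1]
    exact lowRankResidual_le _ _ ((rank_mul_le_right _ _).trans hP.2.2.le)

end ProjectionCost


/-! ### Sums of online ridge leverage scores -/

section Leverage

variable {d : ℕ}

/-- The Gram matrix of the first `t` rows. -/
noncomputable def prefixGram (a : ℕ → Fin d → ℝ) (t : ℕ) : Matrix (Fin d) (Fin d) ℝ :=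
  (prefixMatrix a t)ᵀ * prefixMatrix a t

theorem prefixGram_zero (a : ℕ → Fin d → ℝ) : prefixGram a 0 = 0 := by
  ext i j; simp [prefixGram, mul_apply]

theorem prefixGram_succ (a : ℕ → Fin d → ℝ) (t : ℕ) :
    prefixGram a (t + 1) = prefixGram a t + vecMulVec (a t) (a t) := by
  ext i j
  simp [prefixGram, mul_apply, Fin.sum_univ_castSucc, prefixMatrix, vecMulVec_apply]

theorem transpose_prefixGram (a : ℕ → Fin d → ℝ) (t : ℕ) : (prefixGram a t)ᵀ = prefixGram a t :=
  transpose_gram _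

theorem dotProduct_prefixGram_mulVec (a : ℕ → Fin d → ℝ) (t : ℕ) (y : Fin d → ℝ) :
    y ⬝ᵥ (prefixGram a t *ᵥ y) = ∑ i ∈ Finset.range t, (a i ⬝ᵥ y) ^ 2 := by
  induction t with
  | zero => simp [prefixGram_zero]
  | succ t ih =>
    rw [prefixGram_succ, add_mulVec, dotProduct_add, ih, dotProduct_vecMulVec_self_mulVec,
      Finset.sum_range_succ, pow_two (a t ⬝ᵥ y)]

theorem posDef_of_dotProduct {M : Matrix (Fin d) (Fin d) ℝ} (hM : Mᵀ = M)
    (h : ∀ y, y ≠ 0 → 0 < y ⬝ᵥ (M *ᵥ y)) : M.PosDef := by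
  refine PosDef.of_dotProduct_mulVec_pos ?_ fun y hy => ?_
  · rw [IsHermitian, conjTranspose_eq_transpose_of_trivial, hM]
  · simpa using h y hy

theorem dotProduct_add_smul_one_mulVec (G : Matrix (Fin d) (Fin d) ℝ) (lam : ℝ) (y : Fin d → ℝ) :
    y ⬝ᵥ ((G + lam • 1) *ᵥ y) = y ⬝ᵥ (G *ᵥ y) + lam * (y ⬝ᵥ y) := by
  rw [add_mulVec, dotProduct_add, smul_mulVec, one_mulVec, dotProduct_smul, smul_eq_mul]

theorem transpose_add_smul_one {G : Matrix (Fin d) (Fin d) ℝ} (hG : Gᵀ = G) (lam : ℝ) :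
    (G + lam • (1 : Matrix (Fin d) (Fin d) ℝ))ᵀ = G + lam • 1 := by
  rw [transpose_add, transpose_smul, transpose_one, hG]

theorem posDef_prefixGram_add (a : ℕ → Fin d → ℝ) (t : ℕ) {lam : ℝ} (hlam : 0 < lam) :
    (prefixGram a t + lam • 1).PosDef := by
  refine posDef_of_dotProduct (transpose_add_smul_one (transpose_prefixGram a t) lam) fun y hy => ?_
  rw [dotProduct_add_smul_one_mulVec, dotProduct_prefixGram_mulVec]
  have h1 : 0 < y ⬝ᵥ y := lt_of_le_of_ne (dotProduct_self_nonneg y)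
    fun h => hy (dotProduct_self_eq_zero.1 h.symm)
  have : 0 ≤ ∑ i ∈ Finset.range t, (a i ⬝ᵥ y) ^ 2 := Finset.sum_nonneg fun _ _ => sq_nonneg _
  positivity

/-- The matrix determinant lemma gives det N = det M (1 - u) with u the score of x, and -log(1 - u)
≥ u. -/
theorem dotProduct_inv_mulVec_le_log_det {M N : Matrix (Fin d) (Fin d) ℝ} {x : Fin d → ℝ}
    (hM : M.PosDef) (hN : N.PosDef) (h : M = N + vecMulVec x x) :
    x ⬝ᵥ (M⁻¹ *ᵥ x) ≤ Real.log M.det - Real.log N.det := by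
  have hMd := hM.det_pos
  have hNd := hN.det_pos
  have e : N.det = M.det * (1 - x ⬝ᵥ (M⁻¹ *ᵥ x)) := by
    have h1 : N = M + replicateCol Unit (-x) * replicateRow Unit x := by
      rw [h, ← vecMulVec_eq, neg_vecMulVec]; abel
    rw [h1, det_add_replicateCol_mul_replicateRow hMd.ne'.isUnit]
    congr 1
    rw [det_unique, Matrix.add_apply, one_apply_eq, Matrix.mul_assoc, sub_eq_add_neg]
    congr 1
    simp [mul_apply, dotProduct, mulVec, Finset.mul_sum]
  have hx : 0 < 1 - x ⬝ᵥ (M⁻¹ *ᵥ x) := by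
    rw [e] at hNd; exact pos_of_mul_pos_right hNd hMd.le
  rw [e, Real.log_mul hMd.ne' hx.ne']
  have := Real.log_le_sub_one_of_pos hx
  linarith

/-- `log det (I + AᵀA / lam)`. -/
noncomputable def logPot {n : ℕ} (A : Matrix (Fin n) (Fin d) ℝ) (lam : ℝ) : ℝ :=
  Real.log (Aᵀ * A + lam • 1).det - d * Real.log lam

variable {n k : ℕ} {A : Matrix (Fin n) (Fin d) ℝ}

theorem TopEigen.logPot_eq (E : TopEigen A k) {lam : ℝ} (hlam : 0 < lam) :
    logPot A lam = ∑ i, Real.log (1 + E.g i / lam) := by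
  have e : Aᵀ * A + lam • 1 = E.U * diagonal (fun i => E.g i + lam) * E.Uᵀ := by
    rw [E.gram_eq, ← diagonal_add, Matrix.mul_add, Matrix.add_mul]
    congr 1
    rw [← smul_one_eq_diagonal, Matrix.mul_smul, Matrix.smul_mul, Matrix.mul_one, E.mul_transpose]
  have hdet : (Aᵀ * A + lam • 1).det = ∏ i, (E.g i + lam) := by
    rw [e, det_mul, det_mul, mul_comm E.U.det, mul_assoc, ← det_mul, E.mul_transpose, det_one,
      mul_one, det_diagonal]
  have hpos : ∀ i, 0 < E.g i + lam := fun i => add_pos_of_nonneg_of_pos (E.nonneg i) hlam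
  rw [logPot, hdet, Real.log_prod fun i _ => (hpos i).ne']
  have : (d : ℝ) * Real.log lam = ∑ _i : Fin d, Real.log lam := by simp
  rw [this, ← Finset.sum_sub_distrib]
  refine Finset.sum_congr rfl fun i _ => ?_
  rw [← Real.log_div (hpos i).ne' hlam.ne', add_div, div_self hlam.ne', add_comm]

/-- The first bound serves the k largest eigenvalues. The second serves the remaining ones, whose
sum is the residual. -/
theorem log_one_add_div_sub_le {g s r : ℝ} (hg : 0 ≤ g) (hs : 0 < s) (hr : s ≤ r) :
    Real.log (1 + g / s) - Real.log (1 + g / r) ≤ Real.log (r / s) ∧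
      Real.log (1 + g / s) - Real.log (1 + g / r) ≤ g / s * Real.log (r / s) := by
  have hr0 : 0 < r := hs.trans_le hr
  have h1 : 0 < 1 + g / s := by positivity
  have h2 : 0 < 1 + g / r := by positivity
  rw [← Real.log_div h1.ne' h2.ne']
  constructor
  · refine Real.log_le_log (by positivity) ?_
    rw [div_le_iff₀ h2, mul_add, mul_one]
    have : r / s * (g / r) = g / s := by field_simp
    rw [this]
    gcongr
    exact (one_le_div hs).2 hr
  · have h3 := Real.log_le_sub_one_of_pos (div_pos h1 h2)
    have h4 := Real.one_sub_inv_le_log_of_pos (div_pos hr0 hs)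
    refine h3.trans (le_trans ?_ (mul_le_mul_of_nonneg_left h4 (by positivity)))
    have e : (1 + g / s) / (1 + g / r) - 1 = (g / s * (1 - (r / s)⁻¹)) / (1 + g / r) := by
      field_simp; ring
    rw [e]
    refine div_le_self (mul_nonneg (by positivity) ?_) (le_add_of_nonneg_right (by positivity))
    rw [inv_div, sub_nonneg]
    exact (div_le_one hr0).2 hr

/-- The top eigenvalues cost log(r / s) each, and the others together cost (residual / s) log(r /
s). Both contributions are at most k log(r / s). -/
theorem logPot_le_add (A : Matrix (Fin n) (Fin d) ℝ) {s r : ℝ} (hs : 0 < s) (hr : s ≤ r)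
    (h : lowRankResidual A k ≤ k * s) :
    logPot A s ≤ logPot A r + 2 * k * Real.log (r / s) := by
  obtain ⟨E⟩ := nonempty_topEigen A k
  rw [E.logPot_eq hs, E.logPot_eq (hs.trans_le hr), ← sub_le_iff_le_add', ← Finset.sum_sub_distrib,
    ← Finset.sum_add_sum_compl E.T]
  have hl : 0 ≤ Real.log (r / s) := Real.log_nonneg ((one_le_div hs).2 hr)
  have hT : (E.T.card : ℝ) ≤ k := by rw [E.card_eq]; exact_mod_cast min_le_left _ _
  have h1 := Finset.sum_le_sum fun i (_ : i ∈ E.T) => (log_one_add_div_sub_le (E.nonneg i) hs hr).1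
  have h2 := Finset.sum_le_sum fun i (_ : i ∈ E.Tᶜ) => (log_one_add_div_sub_le (E.nonneg i) hs hr).2
  rw [Finset.sum_const, nsmul_eq_mul] at h1
  rw [← Finset.sum_mul, ← Finset.sum_div, ← E.lowRankResidual_eq] at h2
  have h3 : lowRankResidual A k / s ≤ k := (div_le_iff₀ hs).2 h
  nlinarith

theorem logPot_le (A : Matrix (Fin n) (Fin d) ℝ) {s μ : ℝ} (hμ : 0 < μ) (hs : 0 < s)
    (h : lowRankResidual A k ≤ k * s) (hsμ : μ ^ 2 ≤ k * s) (hA : μ ^ 2 ≤ frobSq A) :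
    logPot A s ≤ k * (3 + Real.log (frobSq A / μ ^ 2)) := by
  obtain ⟨E⟩ := nonempty_topEigen A k
  have hμ2 : 0 < μ ^ 2 := by positivity
  set r := frobSq A / μ ^ 2 with hr
  have hr1 : 1 ≤ r := (one_le_div hμ2).2 hA
  have hr0 : 0 < 1 + r := by linarith
  rw [E.logPot_eq hs, ← Finset.sum_add_sum_compl E.T]
  have hT : (E.T.card : ℝ) ≤ k := by rw [E.card_eq]; exact_mod_cast min_le_left _ _
  have hc : ∑ i ∈ E.Tᶜ, Real.log (1 + E.g i / s) ≤ k := by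
    have : ∑ i ∈ E.Tᶜ, Real.log (1 + E.g i / s) ≤ ∑ i ∈ E.Tᶜ, E.g i / s := by
      refine Finset.sum_le_sum fun i _ => ?_
      have := Real.log_le_sub_one_of_pos (x := 1 + E.g i / s)
        (by have := E.nonneg i; positivity)
      linarith
    rw [← Finset.sum_div, ← E.lowRankResidual_eq] at this
    exact this.trans ((div_le_iff₀ hs).2 h)
  have hh : ∑ i ∈ E.T, Real.log (1 + E.g i / s) ≤ k * Real.log (1 + r) + k := by
    -- The tangent line of log at 1 + r replaces Jensen's inequality over the top eigenvalues.
    have h1 : ∀ i, Real.log (1 + E.g i / s) ≤ Real.log (1 + r) + E.g i / s / (1 + r) := by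
      intro i
      have hp : 0 < 1 + E.g i / s := by have := E.nonneg i; positivity
      have := Real.log_le_sub_one_of_pos (div_pos hp hr0)
      rw [Real.log_div hp.ne' hr0.ne', add_div] at this
      have h2 : 1 / (1 + r) ≤ 1 := (div_le_one hr0).2 (by linarith)
      linarith
    refine (Finset.sum_le_sum fun i _ => h1 i).trans ?_
    rw [Finset.sum_add_distrib, Finset.sum_const, nsmul_eq_mul, ← Finset.sum_div, ← Finset.sum_div]
    have h2 : ∑ i ∈ E.T, E.g i ≤ frobSq A := by
      rw [← E.sum_eq_frobSq]
      exact Finset.sum_le_sum_of_subset_of_nonneg (Finset.subset_univ _) fun i _ _ => E.nonneg i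
    have h3 : (∑ i ∈ E.T, E.g i) / s / (1 + r) ≤ k := by
      rw [div_le_iff₀ hr0, div_le_iff₀ hs]
      have h4 : frobSq A = r * μ ^ 2 := by rw [hr]; field_simp
      calc ∑ i ∈ E.T, E.g i ≤ r * μ ^ 2 := h4 ▸ h2
        _ ≤ r * (k * s) := by gcongr
        _ ≤ k * (1 + r) * s := by
            have : 0 ≤ k * s := hμ2.le.trans hsμ
            nlinarith
    have h5 : 0 ≤ Real.log (1 + r) := Real.log_nonneg (by linarith)
    gcongr
  have hlog : Real.log (1 + r) ≤ 1 + Real.log r := by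
    have h1 : Real.log (1 + r) ≤ Real.log (2 * r) := Real.log_le_log hr0 (by linarith)
    rw [Real.log_mul two_ne_zero (by linarith)] at h1
    have := Real.log_two_lt_d9
    linarith
  have hk0 : (0 : ℝ) ≤ k := Nat.cast_nonneg k
  nlinarith

/-- The regularization `‖A_t - (A_t)_k‖² / k`, replaced by `μ² / k` when it vanishes. -/
noncomputable def ridge (a : ℕ → Fin d → ℝ) (k : ℕ) (μ : ℝ) (t : ℕ) : ℝ :=
  open Classical in
  if lowRankResidual (prefixMatrix a t) k = 0 then μ ^ 2 / k
  else lowRankResidual (prefixMatrix a t) k / k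

section Ridge

variable {a : ℕ → Fin d → ℝ} {μ : ℝ}

theorem sq_le_mul_ridge (hk : 1 ≤ k) (hμ : 0 < μ) {t : ℕ}
    (h : SingularValuesGE (prefixMatrix a t) μ) : μ ^ 2 ≤ k * ridge a k μ t := by
  have hk0 : (0 : ℝ) < k := by exact_mod_cast hk
  rw [ridge]
  split_ifs with h0
  · rw [mul_div_cancel₀ _ hk0.ne']
  · rw [mul_div_cancel₀ _ hk0.ne']
    exact sq_le_lowRankResidual hμ h k h0

theorem ridge_pos (hk : 1 ≤ k) (hμ : 0 < μ) (t : ℕ) : 0 < ridge a k μ t := by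
  have hk0 : (0 : ℝ) < k := by exact_mod_cast hk
  rw [ridge]
  split_ifs with h0
  · positivity
  · exact div_pos (lt_of_le_of_ne (lowRankResidual_nonneg _ _) (Ne.symm h0)) hk0

theorem lowRankResidual_div_le_ridge (a : ℕ → Fin d → ℝ) (k : ℕ) (μ : ℝ) (t : ℕ) :
    lowRankResidual (prefixMatrix a t) k / k ≤ ridge a k μ t := by
  rw [ridge]
  split_ifs with h0
  · rw [h0, zero_div]; positivity
  · exact le_rfl

theorem lowRankResidual_le_mul_ridge (hk : 1 ≤ k) (a : ℕ → Fin d → ℝ) (μ : ℝ) (t : ℕ) :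
    lowRankResidual (prefixMatrix a t) k ≤ k * ridge a k μ t := by
  have hk0 : (0 : ℝ) < k := by exact_mod_cast hk
  rw [← div_le_iff₀' hk0]
  exact lowRankResidual_div_le_ridge a k μ t

/-- A nonzero residual is at least μ², so the passage from the substitute μ² / k to a genuine
residual also goes upwards. -/
theorem ridge_mono (hk : 1 ≤ k) (hμ : 0 < μ) {s t : ℕ} (hst : s ≤ t)
    (h : SingularValuesGE (prefixMatrix a t) μ) : ridge a k μ s ≤ ridge a k μ t := by
  have hk0 : (0 : ℝ) < k := by exact_mod_cast hk
  have hm := lowRankResidual_prefixMatrix_mono a k hst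
  have h1 := sq_le_mul_ridge hk hμ h
  rw [ridge]
  split_ifs with h0
  · rwa [div_le_iff₀' hk0]
  · rw [div_le_iff₀' hk0]
    exact hm.trans (lowRankResidual_le_mul_ridge hk a μ t)

theorem frob_sq {n : ℕ} (A : Matrix (Fin n) (Fin d) ℝ) : frob A ^ 2 = frobSq A :=
  Real.sq_sqrt (frobSq_nonneg A)

/-- The sum of the online ridge leverage scores. -/
theorem sum_online_leverage_le (hk : 1 ≤ k) (hμ : 0 < μ) (n : ℕ)
    (h : ∀ t ≤ n, SingularValuesGE (prefixMatrix a t) μ) :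
    ∑ i ∈ Finset.range n, a i ⬝ᵥ ((prefixGram a (i + 1) + ridge a k μ (i + 1) • 1)⁻¹ *ᵥ a i) ≤
      6 * k * (1 + Real.log (frob (prefixMatrix a n) / μ)) ^ 2 := by
  have hk0 : (0 : ℝ) < k := by exact_mod_cast hk
  -- The invariant telescopes: a new row is paid for by the increase of log det at the new ridge,
  -- and switching the potential from the old ridge to the new one is paid for by the logarithm of
  -- the ridge.
  have key : ∀ t ≤ n,
      ∑ i ∈ Finset.range t, a i ⬝ᵥ ((prefixGram a (i + 1) + ridge a k μ (i + 1) • 1)⁻¹ *ᵥ a i) ≤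
      logPot (prefixMatrix a t) (ridge a k μ t) +
        2 * k * Real.log (ridge a k μ t / (μ ^ 2 / k)) := by
    intro t
    induction t with
    | zero =>
      intro ht
      rw [Finset.sum_range_zero]
      have h1 : logPot (prefixMatrix a 0) (ridge a k μ 0) = 0 := by
        have := prefixGram_zero a
        rw [prefixGram] at this
        rw [logPot, this, zero_add, det_smul, det_one, mul_one, Fintype.card_fin, Real.log_pow,
          sub_self]
      rw [h1, zero_add]
      have h2 := sq_le_mul_ridge (k := k) hk hμ (h 0 ht)
      refine mul_nonneg (by positivity) (Real.log_nonneg ?_)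
      rw [one_le_div (by positivity), div_le_iff₀' hk0]
      exact h2
    | succ t ih =>
      intro ht
      have h1 := ih (by omega)
      have hr0 := ridge_pos (a := a) (k := k) hk hμ t
      have hr1 := ridge_pos (a := a) (k := k) hk hμ (t + 1)
      have h2 := logPot_le_add (k := k) (prefixMatrix a t) hr0
        (ridge_mono hk hμ t.le_succ (h _ ht)) (lowRankResidual_le_mul_ridge hk a μ t)
      have h3 := dotProduct_inv_mulVec_le_log_det (x := a t)
        (posDef_prefixGram_add a (t + 1) hr1) (posDef_prefixGram_add a t hr1)
        (by rw [prefixGram_succ]; abel)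
      have h4 : Real.log (ridge a k μ (t + 1) / (μ ^ 2 / k)) =
          Real.log (ridge a k μ t / (μ ^ 2 / k)) +
            Real.log (ridge a k μ (t + 1) / ridge a k μ t) := by
        rw [← Real.log_mul (by positivity) (by positivity)]
        congr 1
        field_simp
      have h5 : logPot (prefixMatrix a (t + 1)) (ridge a k μ (t + 1)) -
          logPot (prefixMatrix a t) (ridge a k μ (t + 1)) =
          Real.log (prefixGram a (t + 1) + ridge a k μ (t + 1) • 1).det -
            Real.log (prefixGram a t + ridge a k μ (t + 1) • 1).det := by
        rw [logPot, logPot, prefixGram, prefixGram]; ring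
      rw [Finset.sum_range_succ, h4, mul_add]
      linarith
  by_cases h0 : frobSq (prefixMatrix a n) = 0
  · have ha : ∀ i < n, a i = 0 := by
      intro i hi
      have h1 := (Finset.sum_eq_zero_iff_of_nonneg
        (fun _ _ => Finset.sum_nonneg fun _ _ => sq_nonneg _)).1 h0 ⟨i, hi⟩ (Finset.mem_univ _)
      ext j
      have h2 := (Finset.sum_eq_zero_iff_of_nonneg (fun _ _ => sq_nonneg _)).1 h1 j
        (Finset.mem_univ _)
      simpa [prefixMatrix] using h2
    rw [Finset.sum_eq_zero fun i hi => by simp [ha i (Finset.mem_range.1 hi)]]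
    positivity
  · have hF := sq_le_frobSq hμ (h n le_rfl) h0
    have h1 := key n le_rfl
    have h2 := logPot_le (k := k) (prefixMatrix a n) hμ (ridge_pos hk hμ n)
      (lowRankResidual_le_mul_ridge hk a μ n) (sq_le_mul_ridge hk hμ (h n le_rfl)) hF
    set ℓ := Real.log (frob (prefixMatrix a n) / μ) with hℓ
    have e1 : Real.log (frobSq (prefixMatrix a n) / μ ^ 2) = 2 * ℓ := by
      rw [← frob_sq, ← div_pow, Real.log_pow]; norm_num [hℓ]
    have hℓ0 : 0 ≤ ℓ := by
      have : 0 ≤ Real.log (frobSq (prefixMatrix a n) / μ ^ 2) :=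
        Real.log_nonneg ((one_le_div (by positivity)).2 hF)
      linarith
    have h3 : Real.log (ridge a k μ n / (μ ^ 2 / k)) ≤ 2 * ℓ := by
      rw [← e1]
      have := ridge_pos (a := a) (k := k) hk hμ n
      refine Real.log_le_log (by positivity) ?_
      rw [div_div_eq_mul_div]
      gcongr
      rw [ridge]
      split_ifs
      · rw [div_mul_cancel₀ _ hk0.ne']; exact hF
      · rw [div_mul_cancel₀ _ hk0.ne']; exact lowRankResidual_le_frobSq _ _
    -- The bounds collected give k (3 + 6ℓ), linear in ℓ. The quadratic bound of the statement is
    -- weaker.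
    rw [e1] at h2
    nlinarith [mul_le_mul_of_nonneg_left h3 hk0.le, mul_nonneg hk0.le hℓ0,
      mul_nonneg hk0.le (sq_nonneg ℓ)]

/-- Passing to the row space, the regularization `ridge` is as good as the residual. -/
theorem exists_mulVec_eq_ridge_le (hk : 1 ≤ k) (hμ : 0 < μ) {t : ℕ}
    (h : SingularValuesGE (prefixMatrix a t) μ) (y : Fin d → ℝ) :
    ∃ y', prefixMatrix a t *ᵥ y' = prefixMatrix a t *ᵥ y ∧
      y' ⬝ᵥ ((prefixGram a t + ridge a k μ t • 1) *ᵥ y') ≤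
        2 * (y ⬝ᵥ (prefixGram a t *ᵥ y) +
          lowRankResidual (prefixMatrix a t) k / k * (y ⬝ᵥ y)) := by
  have hG : 0 ≤ y ⬝ᵥ (prefixGram a t *ᵥ y) := by
    rw [dotProduct_prefixGram_mulVec]; positivity
  by_cases h0 : lowRankResidual (prefixMatrix a t) k = 0
  · obtain ⟨y', h1, h2⟩ := exists_mulVec_eq_of_singularValuesGE hμ h y
    refine ⟨y', h1, ?_⟩
    have h3 : y' ⬝ᵥ (prefixGram a t *ᵥ y') = y ⬝ᵥ (prefixGram a t *ᵥ y) := by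
      rw [prefixGram, dotProduct_gram_mulVec, dotProduct_gram_mulVec, h1]
    rw [dotProduct_add_smul_one_mulVec, h3, ridge, if_pos h0, h0, zero_div, zero_mul]
    have hk1 : (1 : ℝ) ≤ k := by exact_mod_cast hk
    have h4 : μ ^ 2 / k * (y' ⬝ᵥ y') ≤ μ ^ 2 * (y' ⬝ᵥ y') :=
      mul_le_mul_of_nonneg_right (div_le_self (by positivity) hk1) (dotProduct_self_nonneg _)
    rw [← prefixGram] at h2
    linarith
  · refine ⟨y, rfl, ?_⟩
    rw [dotProduct_add_smul_one_mulVec, ridge, if_neg h0]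
    have : 0 ≤ lowRankResidual (prefixMatrix a t) k / k * (y ⬝ᵥ y) :=
      mul_nonneg (div_nonneg (lowRankResidual_nonneg _ _) (Nat.cast_nonneg _))
        (dotProduct_self_nonneg _)
    linarith

end Ridge

end Leverage


/-! ### The pseudoinverse quadratic form -/

section Pinv

variable {d : ℕ} {N : Matrix (Fin d) (Fin d) ℝ}

theorem isHermitian_of_transpose_eq (hN : Nᵀ = N) : N.IsHermitian := by
  rw [IsHermitian, conjTranspose_eq_transpose_of_trivial, hN]

theorem transpose_pinv (N : Matrix (Fin d) (Fin d) ℝ) : (pinv N)ᵀ = pinv N := by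
  rw [pinv]
  split_ifs with h
  · have : star (h.eigenvectorUnitary : Matrix (Fin d) (Fin d) ℝ) =
        (h.eigenvectorUnitary : Matrix (Fin d) (Fin d) ℝ)ᵀ := by
      rw [star_eq_conjTranspose, conjTranspose_eq_transpose_of_trivial]
    rw [this]
    simp [Matrix.transpose_mul, Matrix.mul_assoc]
  · simp

theorem pinv_eq_inv (hN : N.PosDef) : pinv N = N⁻¹ := by
  have hu : IsUnit N.det := hN.det_pos.ne'.isUnit
  have h := (pinv_penrose N hN.isHermitian).1
  have h2 : N⁻¹ * (N * pinv N * N) * N⁻¹ = N⁻¹ * N * N⁻¹ := by rw [h]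
  rwa [Matrix.mul_assoc N, ← Matrix.mul_assoc N⁻¹, nonsing_inv_mul _ hu, Matrix.one_mul,
    Matrix.one_mul, Matrix.mul_assoc, mul_nonsing_inv _ hu, Matrix.mul_one] at h2

theorem posSemidef_bilinear_sq_le (hN : Nᵀ = N) (h0 : ∀ y, 0 ≤ y ⬝ᵥ (N *ᵥ y)) (x y : Fin d → ℝ) :
    (x ⬝ᵥ (N *ᵥ y)) ^ 2 ≤ (x ⬝ᵥ (N *ᵥ x)) * (y ⬝ᵥ (N *ᵥ y)) := by
  have hsymm : y ⬝ᵥ (N *ᵥ x) = x ⬝ᵥ (N *ᵥ y) := by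
    rw [dotProduct_mulVec, ← mulVec_transpose, hN, dotProduct_comm]
  have key : ∀ s : ℝ, 0 ≤ (x ⬝ᵥ (N *ᵥ x)) * (s * s) + (2 * (x ⬝ᵥ (N *ᵥ y))) * s +
      y ⬝ᵥ (N *ᵥ y) := by
    intro s
    have h1 := h0 (s • x + y)
    simp only [mulVec_add, mulVec_smul, add_dotProduct, dotProduct_add, smul_dotProduct,
      dotProduct_smul, smul_eq_mul, hsymm] at h1
    linarith
  have := discrim_le_zero key
  rw [discrim] at this
  linarith

theorem pinv_mulVec_quad (hN : Nᵀ = N) (x : Fin d → ℝ) :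
    (pinv N *ᵥ x) ⬝ᵥ (N *ᵥ (pinv N *ᵥ x)) = x ⬝ᵥ (pinv N *ᵥ x) := by
  have h := (pinv_penrose N (isHermitian_of_transpose_eq hN)).2.1
  have e : ∀ z, (pinv N *ᵥ x) ⬝ᵥ z = x ⬝ᵥ (pinv N *ᵥ z) := by
    intro z
    conv_rhs => rw [dotProduct_mulVec, ← mulVec_transpose, transpose_pinv]
  rw [e, mulVec_mulVec, mulVec_mulVec, h]

theorem pinv_quad_nonneg (hN : Nᵀ = N) (h0 : ∀ y, 0 ≤ y ⬝ᵥ (N *ᵥ y)) (x : Fin d → ℝ) :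
    0 ≤ x ⬝ᵥ (pinv N *ᵥ x) := by
  rw [← pinv_mulVec_quad hN]; exact h0 _

/-- If `x xᵀ ≤ N` then `x xᵀ ≤ (xᵀ N† x) N`. -/
theorem sq_dotProduct_le_pinv (hN : Nᵀ = N) {x : Fin d → ℝ} {r : ℝ}
    (hx : ∀ y, (x ⬝ᵥ y) ^ 2 ≤ r * (y ⬝ᵥ (N *ᵥ y))) (h0 : ∀ y, 0 ≤ y ⬝ᵥ (N *ᵥ y))
    (y : Fin d → ℝ) :
    (x ⬝ᵥ y) ^ 2 ≤ (x ⬝ᵥ (pinv N *ᵥ x)) * (y ⬝ᵥ (N *ᵥ y)) := by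
  have h := (pinv_penrose N (isHermitian_of_transpose_eq hN)).1
  -- `hx` forces x to be orthogonal to the kernel of N, and y - N†N y lies in that kernel.
  have e : x ⬝ᵥ y = (pinv N *ᵥ x) ⬝ᵥ (N *ᵥ y) := by
    have h1 := hx (y - pinv N *ᵥ (N *ᵥ y))
    have h2 : N *ᵥ (y - pinv N *ᵥ (N *ᵥ y)) = 0 := by
      rw [mulVec_sub, mulVec_mulVec, mulVec_mulVec, h, sub_self]
    rw [h2, dotProduct_zero, mul_zero] at h1
    have h3 : x ⬝ᵥ (y - pinv N *ᵥ (N *ᵥ y)) = 0 := by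
      have := sq_nonneg (x ⬝ᵥ (y - pinv N *ᵥ (N *ᵥ y)))
      exact pow_eq_zero_iff two_ne_zero |>.1 (le_antisymm h1 this)
    rw [dotProduct_sub, sub_eq_zero] at h3
    rw [h3, dotProduct_mulVec x, ← mulVec_transpose, transpose_pinv]
  rw [e, ← pinv_mulVec_quad hN]
  exact posSemidef_bilinear_sq_le hN h0 _ _

/-- Testing at y = N†x turns both sides into powers of the score. Together with
`sq_dotProduct_le_pinv` this characterizes the score variationally, which is how scores of different
matrices are compared. -/
theorem pinv_quad_le (hN : Nᵀ = N) {x : Fin d → ℝ} {s : ℝ} (hs : 0 ≤ s)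
    (h : ∀ y, (x ⬝ᵥ y) ^ 2 ≤ s * (y ⬝ᵥ (N *ᵥ y))) : x ⬝ᵥ (pinv N *ᵥ x) ≤ s := by
  have h1 := h (pinv N *ᵥ x)
  rw [pinv_mulVec_quad hN] at h1
  by_contra! hlt
  nlinarith

theorem sq_dotProduct_le_inv (hN : N.PosDef) (x y : Fin d → ℝ) :
    (x ⬝ᵥ y) ^ 2 ≤ (x ⬝ᵥ (N⁻¹ *ᵥ x)) * (y ⬝ᵥ (N *ᵥ y)) := by
  have hs : Nᵀ = N := by
    have := hN.isHermitian
    rwa [IsHermitian, conjTranspose_eq_transpose_of_trivial] at this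
  have hu : IsUnit N.det := hN.det_pos.ne'.isUnit
  have h0 : ∀ y, 0 ≤ y ⬝ᵥ (N *ᵥ y) := fun y => by simpa using hN.posSemidef.dotProduct_mulVec_nonneg y
  have e : ∀ z, x ⬝ᵥ z = (N⁻¹ *ᵥ x) ⬝ᵥ (N *ᵥ z) := by
    intro z
    rw [dotProduct_mulVec, ← mulVec_transpose, hs, mulVec_mulVec, mul_nonsing_inv _ hu, one_mulVec]
  rw [e, e (N⁻¹ *ᵥ x)]
  exact posSemidef_bilinear_sq_le hs h0 _ _

open Filter Topology in
-- The pseudoinverse is not continuous in N, but for x in the range of N the regularized form lies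
-- between q - δ |N†x|² and q. Sampling probabilities are thereby limits of rational functions of
-- the matrix entries.
theorem tendsto_inv_quad_pinv (hN : Nᵀ = N) {x : Fin d → ℝ} {r : ℝ}
    (hx : ∀ y, (x ⬝ᵥ y) ^ 2 ≤ r * (y ⬝ᵥ (N *ᵥ y))) (h0 : ∀ y, 0 ≤ y ⬝ᵥ (N *ᵥ y)) :
    Tendsto (fun m : ℕ => x ⬝ᵥ ((N + ((m : ℝ) + 1)⁻¹ • 1)⁻¹ *ᵥ x)) atTop
      (𝓝 (x ⬝ᵥ (pinv N *ᵥ x))) := by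
  set q := x ⬝ᵥ (pinv N *ᵥ x) with hq
  have hq0 : 0 ≤ q := pinv_quad_nonneg hN h0 x
  have hpd : ∀ δ : ℝ, 0 < δ → (N + δ • 1).PosDef := by
    intro δ hδ
    refine posDef_of_dotProduct (transpose_add_smul_one hN δ) fun y hy => ?_
    rw [dotProduct_add_smul_one_mulVec]
    have h1 : 0 < y ⬝ᵥ y := lt_of_le_of_ne (dotProduct_self_nonneg y)
      fun h => hy (dotProduct_self_eq_zero.1 h.symm)
    have := h0 y
    positivity
  set B := (pinv N *ᵥ x) ⬝ᵥ (pinv N *ᵥ x) with hB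
  have hB0 : 0 ≤ B := dotProduct_self_nonneg _
  have hup : ∀ δ : ℝ, 0 < δ → x ⬝ᵥ ((N + δ • 1)⁻¹ *ᵥ x) ≤ q := by
    intro δ hδ
    rw [← pinv_eq_inv (hpd δ hδ)]
    refine pinv_quad_le (transpose_add_smul_one hN δ) hq0 fun y => ?_
    refine (sq_dotProduct_le_pinv hN hx h0 y).trans ?_
    rw [dotProduct_add_smul_one_mulVec]
    have := dotProduct_self_nonneg y
    gcongr
    exact le_add_of_nonneg_right (by positivity)
  have hlo : ∀ δ : ℝ, 0 < δ → q - δ * B ≤ x ⬝ᵥ ((N + δ • 1)⁻¹ *ᵥ x) := by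
    intro δ hδ
    have h1 := sq_dotProduct_le_inv (hpd δ hδ) x (pinv N *ᵥ x)
    rw [dotProduct_add_smul_one_mulVec, pinv_mulVec_quad hN, ← hq, ← hB] at h1
    have hδB : 0 ≤ δ * B := by positivity
    rcases (add_nonneg hq0 hδB).eq_or_lt with h2 | h2
    · have : 0 ≤ x ⬝ᵥ ((N + δ • 1)⁻¹ *ᵥ x) := by
        rw [← pinv_eq_inv (hpd δ hδ)]
        refine pinv_quad_nonneg (transpose_add_smul_one hN δ) (fun y => ?_) x
        simpa using (hpd δ hδ).posSemidef.dotProduct_mulVec_nonneg y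
      linarith
    · by_contra! hlt
      nlinarith
  have hinv : Tendsto (fun m : ℕ => ((m : ℝ) + 1)⁻¹) atTop (𝓝 0) := by
    simpa using tendsto_one_div_add_atTop_nhds_zero_nat (𝕜 := ℝ)
  have hlow : Tendsto (fun m : ℕ => q - ((m : ℝ) + 1)⁻¹ * B) atTop (𝓝 q) := by
    simpa using (hinv.mul_const B).const_sub q
  exact tendsto_of_tendsto_of_tendsto_of_le_of_le hlow tendsto_const_nhds
    (fun m => hlo _ (by positivity)) (fun m => hup _ (by positivity))

/-! ### Measurability of the pseudoinverse form -/

section Measurable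

variable {Ω : Type*} [MeasurableSpace Ω]

theorem measurable_det {M : Ω → Matrix (Fin d) (Fin d) ℝ}
    (hM : ∀ i j, Measurable fun ω => M ω i j) : Measurable fun ω => (M ω).det := by
  simp only [det_apply]
  refine Finset.measurable_sum _ fun σ _ => ?_
  simp only [Units.smul_def, zsmul_eq_mul]
  exact measurable_const.mul (Finset.measurable_prod _ fun i _ => hM _ _)

theorem measurable_inv_apply {M : Ω → Matrix (Fin d) (Fin d) ℝ}
    (hM : ∀ i j, Measurable fun ω => M ω i j) (i j : Fin d) :
    Measurable fun ω => (M ω)⁻¹ i j := by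
  simp only [inv_def, Matrix.smul_apply, smul_eq_mul, adjugate_apply, Ring.inverse_eq_inv']
  refine (measurable_det hM).inv.mul (measurable_det fun k l => ?_)
  by_cases hk : k = j
  · subst hk; simp
  · simp only [updateRow_ne hk]; exact hM k l

theorem measurable_quad {M : Ω → Matrix (Fin d) (Fin d) ℝ}
    (hM : ∀ i j, Measurable fun ω => M ω i j) (x : Fin d → ℝ) :
    Measurable fun ω => x ⬝ᵥ (M ω *ᵥ x) := by
  simp only [dotProduct, mulVec]
  exact Finset.measurable_sum _ fun i _ => measurable_const.mul
    (Finset.measurable_sum _ fun j _ => (hM i j).mul measurable_const)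

theorem measurable_pinv_quad {M : Ω → Matrix (Fin d) (Fin d) ℝ} {x : Fin d → ℝ} {r : ℝ}
    (hM : ∀ i j, Measurable fun ω => M ω i j) (hs : ∀ ω, (M ω)ᵀ = M ω)
    (hx : ∀ ω y, (x ⬝ᵥ y) ^ 2 ≤ r * (y ⬝ᵥ (M ω *ᵥ y))) (h0 : ∀ ω y, 0 ≤ y ⬝ᵥ (M ω *ᵥ y)) :
    Measurable fun ω => x ⬝ᵥ (pinv (M ω) *ᵥ x) := by
  refine measurable_of_tendsto_metrizable (f := fun (m : ℕ) ω =>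
    x ⬝ᵥ ((M ω + ((m : ℝ) + 1)⁻¹ • 1)⁻¹ *ᵥ x)) (fun m => ?_) ?_
  · refine measurable_quad (measurable_inv_apply fun i j => ?_) x
    simp only [Matrix.add_apply]
    exact (hM i j).add measurable_const
  · rw [tendsto_pi_nhds]
    exact fun ω => tendsto_inv_quad_pinv (hs ω) (hx ω) (h0 ω)

end Measurable

end Pinv


/-! ### The algorithm as a function of the coin outcomes -/

section History

variable {d : ℕ}

/-- The rows kept by `onlineLRA` if the outcomes of the coins (most recent first) are `h`. -/
noncomputable def histRows (c : ℝ) (a : ℕ → Fin d → ℝ) (est : ℕ → ℝ) : List Bool → List (Fin d → ℝ)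
  | [] => []
  | b :: h =>
    if b then histRows c a est h ++ [(1 / √(samplingProb c (rowsMatrix (histRows c a est h))
      (a h.length) (1 / 2 * est (h.length + 1)))) • a h.length]
    else histRows c a est h

/-- The probability of keeping the next row if the outcomes of the previous coins are `h`. -/
noncomputable def histProb (c : ℝ) (a : ℕ → Fin d → ℝ) (est : ℕ → ℝ) (h : List Bool) : ℝ :=
  samplingProb c (rowsMatrix (histRows c a est h)) (a h.length) (1 / 2 * est (h.length + 1))

/-- The outcomes of the first `t` coins, most recent first. -/
noncomputable def coins (π : List Bool → ℝ) : (t : ℕ) → (Fin t → unitInterval) → List Bool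
  | 0, _ => []
  | t + 1, u =>
    open Classical in
    decide ((u (Fin.last t) : ℝ) < π (coins π t (Fin.init u))) :: coins π t (Fin.init u)

theorem length_coins (π : List Bool → ℝ) (t : ℕ) (u : Fin t → unitInterval) :
    (coins π t u).length = t := by
  induction t with
  | zero => rfl
  | succ t ih => simp [coins, ih]

variable {c : ℝ} {a : ℕ → Fin d → ℝ} {est : ℕ → ℝ}

theorem onlineLRA_eq_histRows (t : ℕ) (u : Fin t → unitInterval) :
    onlineLRA c a est t u = histRows c a est (coins (histProb c a est) t u) := by
  induction t with
  | zero => rfl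
  | succ t ih =>
    simp only [onlineLRA]
    rw [ih]
    simp only [coins, histRows, length_coins]
    simp only [histProb, length_coins, decide_eq_true_eq]

theorem length_histRows (h : List Bool) : (histRows c a est h).length = h.count true := by
  induction h with
  | nil => rfl
  | cons b h ih => cases b <;> simp [histRows, ih]

/-- The Gram matrix of the kept rows. -/
noncomputable def histGram (c : ℝ) (a : ℕ → Fin d → ℝ) (est : ℕ → ℝ) (h : List Bool) :
    Matrix (Fin d) (Fin d) ℝ :=
  (rowsMatrix (histRows c a est h))ᵀ * rowsMatrix (histRows c a est h)

theorem gram_rowsMatrix_apply (L : List (Fin d → ℝ)) (i j : Fin d) :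
    ((rowsMatrix L)ᵀ * rowsMatrix L) i j = (L.map fun v => v i * v j).sum := by
  simp only [mul_apply, transpose_apply, rowsMatrix, of_apply, List.get_eq_getElem]
  exact Fin.sum_univ_fun_getElem L fun v => v i * v j

theorem histGram_nil : histGram c a est [] = 0 := by
  ext i j
  rw [histGram, gram_rowsMatrix_apply]; simp [histRows]

theorem transpose_histGram (h : List Bool) : (histGram c a est h)ᵀ = histGram c a est h :=
  transpose_gram _

theorem histGram_quad_nonneg (h : List Bool) (y : Fin d → ℝ) :
    0 ≤ y ⬝ᵥ (histGram c a est h *ᵥ y) := by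
  rw [histGram, dotProduct_gram_mulVec]; exact dotProduct_self_nonneg _

/-- The matrix whose pseudoinverse determines the sampling probability. -/
noncomputable def histReg (c : ℝ) (a : ℕ → Fin d → ℝ) (est : ℕ → ℝ) (h : List Bool) :
    Matrix (Fin d) (Fin d) ℝ :=
  histGram c a est h + vecMulVec (a h.length) (a h.length) + (1 / 2 * est (h.length + 1)) • 1

theorem histProb_eq (h : List Bool) : histProb c a est h =
    min (2 * c * (a h.length ⬝ᵥ (pinv (histReg c a est h) *ᵥ a h.length))) 1 := rfl

theorem transpose_histReg (h : List Bool) : (histReg c a est h)ᵀ = histReg c a est h := by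
  rw [histReg, transpose_add, transpose_add, transpose_histGram, transpose_vecMulVec_self,
    transpose_smul, transpose_one]

theorem histReg_quad (h : List Bool) (y : Fin d → ℝ) :
    y ⬝ᵥ (histReg c a est h *ᵥ y) = y ⬝ᵥ (histGram c a est h *ᵥ y) + (a h.length ⬝ᵥ y) ^ 2 +
      1 / 2 * est (h.length + 1) * (y ⬝ᵥ y) := by
  rw [histReg, dotProduct_add_smul_one_mulVec, add_mulVec, dotProduct_add,
    dotProduct_vecMulVec_self_mulVec, ← pow_two]

variable (hest : ∀ t, 0 ≤ est t)

include hest in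
theorem sq_le_histReg_quad (h : List Bool) (y : Fin d → ℝ) :
    (a h.length ⬝ᵥ y) ^ 2 ≤ 1 * (y ⬝ᵥ (histReg c a est h *ᵥ y)) := by
  rw [histReg_quad]
  have := histGram_quad_nonneg (c := c) (a := a) (est := est) h y
  have := hest (h.length + 1)
  have := dotProduct_self_nonneg y
  have : 0 ≤ 1 / 2 * est (h.length + 1) * (y ⬝ᵥ y) := by positivity
  linarith

include hest in
theorem histReg_quad_nonneg (h : List Bool) (y : Fin d → ℝ) :
    0 ≤ y ⬝ᵥ (histReg c a est h *ᵥ y) := by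
  have := sq_le_histReg_quad (c := c) (a := a) hest h y
  nlinarith [sq_nonneg (a h.length ⬝ᵥ y)]

include hest in
theorem histProb_mem (hc : 0 ≤ c) (h : List Bool) :
    0 ≤ histProb c a est h ∧ histProb c a est h ≤ 1 := by
  rw [histProb_eq]
  refine ⟨le_min ?_ zero_le_one, min_le_right _ _⟩
  have := pinv_quad_nonneg (transpose_histReg (c := c) (a := a) (est := est) h)
    (histReg_quad_nonneg hest h) (a h.length)
  positivity

include hest in
theorem histGram_cons (hc : 0 ≤ c) (b : Bool) (h : List Bool) :
    histGram c a est (b :: h) = histGram c a est h +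
      (if b then (histProb c a est h)⁻¹ else 0) • vecMulVec (a h.length) (a h.length) := by
  cases b with
  | false =>
    have e : histRows c a est (false :: h) = histRows c a est h := by simp [histRows]
    rw [histGram, e]
    simp [histGram]
  | true =>
    ext i j
    have hp := (histProb_mem (a := a) hest hc h).1
    rw [Matrix.add_apply, histGram, histGram, gram_rowsMatrix_apply, gram_rowsMatrix_apply, histRows]
    simp only [if_true, List.map_append, List.sum_append, List.map_cons, List.map_nil,
      List.sum_cons, List.sum_nil, add_zero, Pi.smul_apply, smul_eq_mul, Matrix.smul_apply,
      vecMulVec_apply]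
    rw [← histProb]
    congr 1
    have : (1 / √(histProb c a est h)) * (1 / √(histProb c a est h)) = (histProb c a est h)⁻¹ := by
      rw [div_mul_div_comm, Real.mul_self_sqrt hp, one_mul, one_div]
    rw [← this]
    ring

/-- The difference of the Gram matrices of the kept rows and of all rows. -/
noncomputable def histDev (c : ℝ) (a : ℕ → Fin d → ℝ) (est : ℕ → ℝ) (h : List Bool) :
    Matrix (Fin d) (Fin d) ℝ :=
  histGram c a est h - prefixGram a h.length

theorem histDev_nil : histDev c a est [] = 0 := by
  simp [histDev, histGram_nil, prefixGram_zero]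

theorem transpose_histDev (h : List Bool) : (histDev c a est h)ᵀ = histDev c a est h := by
  rw [histDev, transpose_sub, transpose_histGram, transpose_prefixGram]

include hest in
theorem histDev_cons (hc : 0 ≤ c) (b : Bool) (h : List Bool) :
    histDev c a est (b :: h) = histDev c a est h +
      ((if b then (histProb c a est h)⁻¹ else 0) - 1) • vecMulVec (a h.length) (a h.length) := by
  rw [histDev, histDev, histGram_cons hest hc, List.length_cons, prefixGram_succ, sub_smul, one_smul]
  abel

theorem prefixMatrix_mulVec_eq_iff {t : ℕ} {y y' : Fin d → ℝ} :
    prefixMatrix a t *ᵥ y' = prefixMatrix a t *ᵥ y ↔ ∀ i < t, a i ⬝ᵥ y' = a i ⬝ᵥ y := by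
  constructor
  · intro h i hi
    exact congrFun h ⟨i, hi⟩
  · intro h
    ext i
    exact h i i.2

include hest in
-- The deviation is a linear combination of outer products of the rows read, so its form sees y only
-- through the inner products with them. This permits replacing y by its representative in the row
-- space.
theorem histDev_quad_congr (hc : 0 ≤ c) (h : List Bool) {y y' : Fin d → ℝ}
    (hy : ∀ i < h.length, a i ⬝ᵥ y' = a i ⬝ᵥ y) :
    y' ⬝ᵥ (histDev c a est h *ᵥ y') = y ⬝ᵥ (histDev c a est h *ᵥ y) := by
  induction h with
  | nil => simp [histDev_nil]
  | cons b h ih =>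
    rw [histDev_cons hest hc, add_mulVec, add_mulVec, dotProduct_add, dotProduct_add, smul_mulVec,
      smul_mulVec, dotProduct_smul, dotProduct_smul, dotProduct_vecMulVec_self_mulVec,
      dotProduct_vecMulVec_self_mulVec, hy _ (by simp),
      ih fun i hi => hy i (by rw [List.length_cons]; omega)]

theorem exists_rows_histRows (h : List Bool) : ∃ l : List (ℕ × ℝ),
    histRows c a est h = l.map (fun q => q.2 • a q.1) ∧ l.Pairwise (fun q q' => q.1 < q'.1) ∧
      ∀ q ∈ l, q.1 < h.length := by
  induction h with
  | nil => exact ⟨[], by simp [histRows]⟩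
  | cons b h ih =>
    obtain ⟨l, h1, h2, h3⟩ := ih
    cases b with
    | false => exact ⟨l, by simpa [histRows] using h1, h2, fun q hq => (h3 q hq).trans (by simp)⟩
    | true =>
      refine ⟨l ++ [(h.length, 1 / √(histProb c a est h))], ?_, ?_, ?_⟩
      · rw [List.map_append, ← h1]; simp [histRows, histProb]
      · rw [List.pairwise_append]
        refine ⟨h2, by simp, fun q hq q' hq' => ?_⟩
        obtain rfl := List.mem_singleton.1 hq'
        exact h3 q hq
      · intro q hq
        rcases List.mem_append.1 hq with hq | hq
        · exact (h3 q hq).trans (by simp)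
        · obtain rfl := List.mem_singleton.1 hq
          simp

theorem isRescaledRowSample_histRows {n : ℕ} {h : List Bool} (hn : h.length = n) :
    IsRescaledRowSample (prefixMatrix a n) (rowsMatrix (histRows c a est h)) := by
  obtain ⟨l, h1, h2, h3⟩ := exists_rows_histRows (c := c) (a := a) (est := est) h
  rw [h1]
  have hl : (l.map (fun q => q.2 • a q.1)).length = l.length := List.length_map _
  refine ⟨fun i => ⟨(l.get (i.cast hl)).1, hn ▸ h3 _ (List.get_mem _ _)⟩,
    fun i => (l.get (i.cast hl)).2, fun i j hij => ?_, fun i j => ?_⟩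
  · exact List.pairwise_iff_get.1 h2 (i.cast hl) (j.cast hl) hij
  · simp [rowsMatrix, prefixMatrix]

end History

/-! ### The law of the coin outcomes -/

section Law

open unitInterval

variable {Ω : Type*} [MeasurableSpace Ω]

/-- The thresholds depend on the seed and on earlier coins. Once the earlier outcomes are fixed to
be h, the last coin is compared with the measurable function ω ↦ π ω h. -/
theorem measurableSet_coins_eq {π : Ω → List Bool → ℝ} (n : ℕ)
    (hπ : ∀ h : List Bool, h.length < n → Measurable fun ω => π ω h) (l : List Bool) :
    MeasurableSet {x : Ω × (Fin n → I) | coins (π x.1) n x.2 = l} := by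
  classical
  induction n generalizing l with
  | zero =>
    simp only [coins]
    exact MeasurableSet.const _
  | succ n ih =>
    cases l with
    | nil => simp [coins]
    | cons b h =>
      by_cases hh : h.length = n
      swap
      · convert MeasurableSet.empty using 1
        ext x
        simp only [Set.mem_ofPred_eq, Set.mem_empty_iff_false, iff_false]
        intro hx
        have := congrArg List.length hx
        rw [length_coins, List.length_cons] at this
        omega
      have e : {x : Ω × (Fin (n + 1) → I) | coins (π x.1) (n + 1) x.2 = b :: h} =
          (fun x : Ω × (Fin (n + 1) → I) => (x.1, (Fin.init x.2 : Fin n → I))) ⁻¹'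
            {x : Ω × (Fin n → I) | coins (π x.1) n x.2 = h} ∩
          {x | decide (((x.2 (Fin.last n) : I) : ℝ) < π x.1 h) = b} := by
        ext x
        simp only [coins, Set.mem_ofPred_eq, List.cons.injEq, Set.mem_inter_iff, Set.mem_preimage]
        constructor
        · rintro ⟨h1, h2⟩
          rw [h2] at h1
          exact ⟨h2, by convert h1⟩
        · rintro ⟨h1, h2⟩
          rw [h1]
          exact ⟨by convert h2, rfl⟩
      rw [e]
      refine MeasurableSet.inter (measurableSet_preimage ?_
        (ih (fun h hh => hπ h (by omega)) h)) ?_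
      · refine measurable_fst.prodMk (measurable_pi_lambda _ fun i => ?_)
        exact (measurable_pi_apply _).comp measurable_snd
      · have hlt : MeasurableSet {x : Ω × (Fin (n + 1) → I) |
            ((x.2 (Fin.last n) : I) : ℝ) < π x.1 h} :=
          measurableSet_lt (measurable_subtype_coe.comp
            ((measurable_pi_apply _).comp measurable_snd))
            ((hπ h (by omega)).comp measurable_fst)
        cases b with
        | true => simpa using hlt
        | false =>
          convert hlt.compl using 1
          ext x
          simp

theorem measurableSet_coins_mem {π : Ω → List Bool → ℝ} (n : ℕ)
    (hπ : ∀ h : List Bool, h.length < n → Measurable fun ω => π ω h) {Bad : Ω → List Bool → Prop}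
    (hB : ∀ h : List Bool, h.length = n → MeasurableSet {ω | Bad ω h}) :
    MeasurableSet {x : Ω × (Fin n → I) | Bad x.1 (coins (π x.1) n x.2)} := by
  have e : {x : Ω × (Fin n → I) | Bad x.1 (coins (π x.1) n x.2)} =
      ⋃ l : {l : List Bool // l.length = n}, {x | coins (π x.1) n x.2 = l} ∩
        Prod.fst ⁻¹' {ω | Bad ω l} := by
    ext x
    simp only [Set.mem_ofPred_eq, Set.mem_iUnion, Set.mem_inter_iff, Set.mem_preimage]
    exact ⟨fun h => ⟨⟨_, length_coins _ _ _⟩, rfl, h⟩, fun ⟨l, h1, h2⟩ => h1 ▸ h2⟩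
  rw [e]
  exact MeasurableSet.iUnion fun l =>
    (measurableSet_coins_eq n hπ l).inter (measurable_fst (hB l l.2))

theorem measurable_coins (π : List Bool → ℝ) (n : ℕ) (F : List Bool → ENNReal) :
    Measurable fun u : Fin n → I => F (coins π n u) := by
  let _ : MeasurableSpace (List Bool) := ⊤
  have h1 : Measurable fun u : Fin n → I => coins π n u := by
    refine measurable_to_countable' fun l => ?_
    have := measurableSet_coins_eq (Ω := Unit) (π := fun _ => π) n (fun _ _ => measurable_const) l
    exact (measurable_const (a := ())).prodMk measurable_id this
  exact (measurable_from_top (f := F)).comp h1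

/-- The most recent coin is integrated first: given the earlier ones it falls below its threshold
with probability π h, which is the recursion of `treeExp`. -/
theorem lintegral_coins {π : List Bool → ℝ} (hπ : ∀ h, 0 ≤ π h ∧ π h ≤ 1) (n : ℕ)
    {F : List Bool → ℝ} (hF : ∀ h, 0 ≤ F h) :
    ∫⁻ u : Fin n → I, ENNReal.ofReal (F (coins π n u)) = ENNReal.ofReal (treeExp π n F) := by
  classical
  induction n generalizing F with
  | zero => simp [coins, treeExp, lintegral_const]
  | succ n ih =>
    have hF' : ∀ h, 0 ≤ π h * F (true :: h) + (1 - π h) * F (false :: h) := fun h =>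
      add_nonneg (mul_nonneg (hπ h).1 (hF _)) (mul_nonneg (sub_nonneg.2 (hπ h).2) (hF _))
    rw [treeExp, ← ih hF']
    have hmp := (volume_preserving_piFinSuccAbove (fun _ : Fin (n + 1) => I) (Fin.last n)).symm
    rw [← hmp.lintegral_comp (measurable_coins π (n + 1) fun l => ENNReal.ofReal (F l))]
    have hm : Measurable fun x : I × (Fin n → I) => ENNReal.ofReal (F (coins π (n + 1)
        ((MeasurableEquiv.piFinSuccAbove (fun _ => I) (Fin.last n)).symm x))) :=
      (measurable_coins π (n + 1) fun l => ENNReal.ofReal (F l)).comp (MeasurableEquiv.measurable _)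
    rw [Measure.volume_eq_prod, lintegral_prod_symm _ hm.aemeasurable]
    refine lintegral_congr fun w => ?_
    have hc : ∀ v : I, coins π (n + 1)
        ((MeasurableEquiv.piFinSuccAbove (fun _ => I) (Fin.last n)).symm (v, w)) =
        decide ((v : ℝ) < π (coins π n w)) :: coins π n w := by
      intro v
      have h1 : (Fin.init ((MeasurableEquiv.piFinSuccAbove (fun _ => I) (Fin.last n)).symm (v, w)) :
          Fin n → I) = w := by
        ext i
        simp [Fin.init, MeasurableEquiv.piFinSuccAbove, Fin.insertNthEquiv]
      have h2 : (MeasurableEquiv.piFinSuccAbove (fun _ => I) (Fin.last n)).symm (v, w)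
          (Fin.last n) = v := by
        simp [MeasurableEquiv.piFinSuccAbove, Fin.insertNthEquiv]
      rw [coins, h1, h2]
    simp only [hc]
    set h := coins π n w
    have hp := hπ h
    set S : Set I := {v : I | (v : ℝ) < π h} with hS
    have hSe : S = Set.Iio ⟨π h, hp.1, hp.2⟩ := by
      ext v; exact Iff.rfl
    have hSm : MeasurableSet S := hSe ▸ measurableSet_Iio
    have e : ∀ v : I, ENNReal.ofReal (F (decide ((v : ℝ) < π h) :: h)) =
        S.indicator (fun _ => ENNReal.ofReal (F (true :: h))) v +
          Sᶜ.indicator (fun _ => ENNReal.ofReal (F (false :: h))) v := by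
      intro v
      by_cases hv : (v : ℝ) < π h
      · have : v ∈ S := hv
        simp [hv, this]
      · have : v ∉ S := hv
        simp [hv, this]
    simp only [e]
    rw [lintegral_add_left (measurable_const.indicator hSm), lintegral_indicator_const hSm,
      lintegral_indicator_const hSm.compl, prob_compl_eq_one_sub hSm, hSe, volume_Iio,
      ENNReal.ofReal_add (mul_nonneg hp.1 (hF _)) (mul_nonneg (sub_nonneg.2 hp.2) (hF _)),
      ENNReal.ofReal_mul hp.1, ENNReal.ofReal_mul (sub_nonneg.2 hp.2), ENNReal.ofReal_sub _ hp.1,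
      ENNReal.ofReal_one, mul_comm, mul_comm (ENNReal.ofReal (F (false :: h)))]

open Classical in
theorem volume_coins_mem {π : List Bool → ℝ} (hπ : ∀ h, 0 ≤ π h ∧ π h ≤ 1) (n : ℕ)
    (Bad : List Bool → Prop) : volume {u : Fin n → I | Bad (coins π n u)} =
      ENNReal.ofReal (treeExp π n fun h => if Bad h then 1 else 0) := by
  rw [← lintegral_coins hπ n (F := fun h => if Bad h then 1 else 0)
    (fun h => by split_ifs <;> norm_num)]
  have hm : MeasurableSet {u : Fin n → I | Bad (coins π n u)} := by
    have := measurableSet_coins_mem (Ω := Unit) (π := fun _ => π) n (fun _ _ => measurable_const)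
      (Bad := fun _ => Bad) (fun _ _ => MeasurableSet.const _)
    exact (measurable_const (a := ())).prodMk measurable_id this
  rw [← lintegral_indicator_one hm]
  refine lintegral_congr fun u => ?_
  by_cases hu : Bad (coins π n u) <;> simp [Set.indicator, hu]

end Law


/-! ### Failure probability of the sampling process -/

section Whitening

variable {d : ℕ}

theorem exists_whitening {M : Matrix (Fin d) (Fin d) ℝ} (hM : M.PosDef) :
    ∃ K : Matrix (Fin d) (Fin d) ℝ, Kᵀ * M * K = 1 ∧ K * (Kᵀ * M) = 1 ∧ K * Kᵀ = M⁻¹ := by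
  have hs : Mᵀ = M := by
    have := hM.isHermitian
    rwa [IsHermitian, conjTranspose_eq_transpose_of_trivial] at this
  obtain ⟨U, g, h1, h2, h3⟩ := exists_orthogonal_diagonalization M hs
  have hg : ∀ i, 0 < g i := by
    intro i
    have hcol : Uᵀ *ᵥ U.col i = Pi.single i 1 := by
      rw [← mulVec_single_one, mulVec_mulVec, h2, one_mulVec]
    have hne : U.col i ≠ 0 := by
      intro h0
      rw [h0, mulVec_zero] at hcol
      have := congrFun hcol i
      simp at this
    have h4 := hM.dotProduct_mulVec_pos hne
    rw [star_trivial, h3, dotProduct_conj_diagonal_mulVec, hcol, Finset.sum_eq_single i] at h4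
    · simpa using h4
    · intro j _ hj; simp [hj]
    · simp
  set s : Fin d → ℝ := fun i => (√(g i))⁻¹ with hsdef
  have e1 : (U * diagonal s)ᵀ * M * (U * diagonal s) = 1 := by
    rw [Matrix.transpose_mul, diagonal_transpose, h3,
      show diagonal s * Uᵀ * (U * diagonal g * Uᵀ) * (U * diagonal s) =
        diagonal s * (Uᵀ * U) * diagonal g * (Uᵀ * U) * diagonal s by simp only [Matrix.mul_assoc],
      h2, Matrix.mul_one, Matrix.mul_one, diagonal_mul_diagonal, diagonal_mul_diagonal,
      ← diagonal_one]
    congr 1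
    ext i
    have := Real.mul_self_sqrt (hg i).le
    have h5 := Real.sqrt_pos.2 (hg i)
    simp only [hsdef]
    field_simp
    linarith
  refine ⟨U * diagonal s, e1, mul_eq_one_comm.1 e1, (inv_eq_left_inv ?_).symm⟩
  rw [Matrix.mul_assoc]; exact mul_eq_one_comm.1 e1

theorem dotProduct_transpose_mulVec (K : Matrix (Fin d) (Fin d) ℝ) (x y : Fin d → ℝ) :
    (Kᵀ *ᵥ x) ⬝ᵥ y = x ⬝ᵥ (K *ᵥ y) := by
  rw [dotProduct_mulVec x, ← mulVec_transpose]

theorem dotProduct_conj_mulVec (K X : Matrix (Fin d) (Fin d) ℝ) (y : Fin d → ℝ) :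
    y ⬝ᵥ ((Kᵀ * X * K) *ᵥ y) = (K *ᵥ y) ⬝ᵥ (X *ᵥ (K *ᵥ y)) := by
  rw [← mulVec_mulVec, ← mulVec_mulVec, ← dotProduct_transpose_mulVec, transpose_transpose]

theorem conj_vecMulVec (K : Matrix (Fin d) (Fin d) ℝ) (x : Fin d → ℝ) :
    Kᵀ * vecMulVec x x * K = vecMulVec (Kᵀ *ᵥ x) (Kᵀ *ᵥ x) := by
  rw [mul_vecMulVec, vecMulVec_mul, ← mulVec_transpose]

end Whitening

section PastGood

theorem pastGood_drop_succ {Good : List Bool → Prop} {h : List Bool} {s : ℕ} (hs : s < h.length) :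
    PastGood Good (h.drop (h.length - (s + 1))) ↔
      Good (h.drop (h.length - s)) ∧ PastGood Good (h.drop (h.length - s)) := by
  have h1 : h.length - (s + 1) < h.length := by omega
  rw [List.drop_eq_getElem_cons h1, show h.length - (s + 1) + 1 = h.length - s by omega]
  exact Iff.rfl

/-- The history after s coins is `h.drop (h.length - s)`. Goodness of each such prefix may be proved
assuming that all earlier ones are good. -/
theorem pastGood_drop_of_forall {Good : List Bool → Prop} {h : List Bool} {t : ℕ}
    (ht : t ≤ h.length) (H : ∀ s < t, PastGood Good (h.drop (h.length - s)) →
      Good (h.drop (h.length - s))) : PastGood Good (h.drop (h.length - t)) := by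
  induction t with
  | zero => simp [PastGood]
  | succ t ih =>
    have h1 := ih (by omega) fun s hs => H s (by omega)
    rw [pastGood_drop_succ (by omega)]
    exact ⟨H t (by omega) h1, h1⟩

end PastGood

section Sampling

variable {d : ℕ} {c : ℝ} {a : ℕ → Fin d → ℝ} {est : ℕ → ℝ} {k n : ℕ} {μ η : ℝ}

/-- The regularized Gram matrix of the first `t` rows. -/
noncomputable def ridgeGram (a : ℕ → Fin d → ℝ) (k : ℕ) (μ : ℝ) (t : ℕ) :
    Matrix (Fin d) (Fin d) ℝ :=
  prefixGram a t + ridge a k μ t • 1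

/-- The online ridge leverage score of row `i` among the first `t` rows. -/
noncomputable def leverage (a : ℕ → Fin d → ℝ) (k : ℕ) (μ : ℝ) (t i : ℕ) : ℝ :=
  a i ⬝ᵥ ((ridgeGram a k μ t)⁻¹ *ᵥ a i)

theorem ridgeGram_quad (t : ℕ) (y : Fin d → ℝ) : y ⬝ᵥ (ridgeGram a k μ t *ᵥ y) =
    y ⬝ᵥ (prefixGram a t *ᵥ y) + ridge a k μ t * (y ⬝ᵥ y) :=
  dotProduct_add_smul_one_mulVec _ _ _

theorem posDef_ridgeGram (hk : 1 ≤ k) (hμ : 0 < μ) (t : ℕ) : (ridgeGram a k μ t).PosDef :=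
  posDef_prefixGram_add a t (ridge_pos hk hμ t)

theorem prefixGram_quad_nonneg (t : ℕ) (y : Fin d → ℝ) : 0 ≤ y ⬝ᵥ (prefixGram a t *ᵥ y) := by
  rw [dotProduct_prefixGram_mulVec]; positivity

theorem prefixGram_quad_mono {s t : ℕ} (hst : s ≤ t) (y : Fin d → ℝ) :
    y ⬝ᵥ (prefixGram a s *ᵥ y) ≤ y ⬝ᵥ (prefixGram a t *ᵥ y) := by
  rw [dotProduct_prefixGram_mulVec, dotProduct_prefixGram_mulVec]
  exact Finset.sum_le_sum_of_subset_of_nonneg (Finset.range_mono hst) fun _ _ _ => sq_nonneg _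

theorem histDev_quad (h : List Bool) (y : Fin d → ℝ) : y ⬝ᵥ (histDev c a est h *ᵥ y) =
    y ⬝ᵥ (histGram c a est h *ᵥ y) - y ⬝ᵥ (prefixGram a h.length *ᵥ y) := by
  rw [histDev, sub_mulVec, dotProduct_sub]

theorem histReg_quad_eq (h : List Bool) (y : Fin d → ℝ) :
    y ⬝ᵥ (histReg c a est h *ᵥ y) = y ⬝ᵥ (histDev c a est h *ᵥ y) +
      y ⬝ᵥ (prefixGram a (h.length + 1) *ᵥ y) + 1 / 2 * est (h.length + 1) * (y ⬝ᵥ y) := by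
  rw [histReg_quad, histDev_quad, prefixGram_succ, add_mulVec, dotProduct_add,
    dotProduct_vecMulVec_self_mulVec]
  ring

theorem transpose_ridgeGram (t : ℕ) : (ridgeGram a k μ t)ᵀ = ridgeGram a k μ t :=
  transpose_add_smul_one (transpose_prefixGram a t) _

theorem leverage_nonneg (hk : 1 ≤ k) (hμ : 0 < μ) (t i : ℕ) : 0 ≤ leverage a k μ t i := by
  have hM := posDef_ridgeGram (a := a) (k := k) hk hμ t
  rw [leverage, ← pinv_eq_inv hM]
  refine pinv_quad_nonneg (transpose_ridgeGram t) (fun y => ?_) _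
  simpa using hM.posSemidef.dotProduct_mulVec_nonneg y

section Bounds

variable (hk : 1 ≤ k) (hμ : 0 < μ) (hc : 0 < c)
  (hSV : ∀ t ≤ n, SingularValuesGE (prefixMatrix a t) μ)
  (hest : ∀ t, 1 / 2 * (lowRankResidual (prefixMatrix a t) k / k) ≤ est t ∧
    est t ≤ 2 * (lowRankResidual (prefixMatrix a t) k / k))

include hest in
theorem est_nonneg (t : ℕ) : 0 ≤ est t :=
  le_trans (mul_nonneg (by norm_num) (div_nonneg (lowRankResidual_nonneg _ _) (Nat.cast_nonneg _)))
    (hest t).1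

include hk hμ hc hSV hest in
/-- As long as the kept rows do not overshoot, the sampling probabilities dominate the leverage
scores. -/
theorem min_leverage_le_histProb {t : ℕ} (ht : t ≤ n) {h : List Bool} (hh : h.length < t)
    (hG : ∀ y, y ⬝ᵥ (histDev c a est h *ᵥ y) ≤ y ⬝ᵥ (ridgeGram a k μ t *ᵥ y)) :
    min 1 (c * leverage a k μ t h.length) ≤ histProb c a est h := by
  have he0 := est_nonneg hest
  set q := a h.length ⬝ᵥ (pinv (histReg c a est h) *ᵥ a h.length) with hq
  have hq0 : 0 ≤ q := pinv_quad_nonneg (transpose_histReg h) (histReg_quad_nonneg he0 h) _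
  -- The deviation and the regularized Gram matrix of the rows read are each at most the ridge Gram
  -- matrix of time t, hence the factor 2. The factor 1/2 on the estimate offsets its
  -- 2-approximation.
  have hlev : leverage a k μ t h.length ≤ 2 * q := by
    have hM := posDef_ridgeGram (a := a) (k := k) hk hμ t
    rw [leverage, ← pinv_eq_inv hM]
    refine pinv_quad_le (transpose_ridgeGram t) (by positivity)
      fun y => ?_
    refine (sq_dotProduct_le_pinv (transpose_histReg (c := c) h) (sq_le_histReg_quad he0 h)
      (histReg_quad_nonneg he0 h) y).trans ?_
    rw [← hq, mul_comm 2 q, mul_assoc]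
    refine mul_le_mul_of_nonneg_left ?_ hq0
    have h1 := hG y
    have h2 := prefixGram_quad_mono (a := a) (show h.length + 1 ≤ t from hh) y
    have h3 : 1 / 2 * est (h.length + 1) ≤ ridge a k μ t := by
      have h4 := (hest (h.length + 1)).2
      have h5 := lowRankResidual_div_le_ridge a k μ (h.length + 1)
      have h6 := ridge_mono (k := k) hk hμ (show h.length + 1 ≤ t from hh) (hSV t ht)
      linarith
    have h7 := mul_le_mul_of_nonneg_right h3 (dotProduct_self_nonneg y)
    rw [histReg_quad_eq]
    rw [ridgeGram_quad] at h1 ⊢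
    linarith
  rw [histProb_eq, ← hq, min_comm]
  refine min_le_min ?_ le_rfl
  nlinarith

include hk hμ hc hSV hest in
/-- As long as the kept rows are a good approximation, the sampling probabilities are dominated by
the leverage scores. -/
theorem histProb_le_leverage (hη0 : 0 ≤ η) (hη : η ≤ 1 / 16) {h : List Bool} (hh : h.length < n)
    (hG : ∀ y, |y ⬝ᵥ (histDev c a est h *ᵥ y)| ≤ η * (y ⬝ᵥ (ridgeGram a k μ h.length *ᵥ y))) :
    histProb c a est h ≤ 32 * c * leverage a k μ (h.length + 1) h.length := by
  have he0 := est_nonneg hest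
  have hk0 : (0 : ℝ) < k := by exact_mod_cast hk
  set τ := leverage a k μ (h.length + 1) h.length with hτ
  have hτ0 : 0 ≤ τ := leverage_nonneg hk hμ _ _
  -- The deviation costs at most 1/8 of G + lam' and half the estimate is at least lam' / 4, leaving
  -- 7/8 of G and 1/8 of lam'. Multiplication by 16 reaches the required 2 (G + lam').
  have hq : a h.length ⬝ᵥ (pinv (histReg c a est h) *ᵥ a h.length) ≤ 16 * τ := by
    refine pinv_quad_le (transpose_histReg h) (by positivity) fun y => ?_
    -- The estimate may vanish while `ridge` is μ² / k, so the ridge Gram matrices are evaluated at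
    -- row space representatives of y, one for each of the two times.
    obtain ⟨y', hy1, hy2⟩ := exists_mulVec_eq_ridge_le hk hμ (hSV (h.length + 1) hh) y
    obtain ⟨z, hz1, hz2⟩ := exists_mulVec_eq_ridge_le hk hμ (hSV h.length hh.le) y
    rw [prefixMatrix_mulVec_eq_iff] at hy1 hz1
    rw [← hy1 h.length (by omega)]
    refine (sq_dotProduct_le_inv (posDef_ridgeGram (a := a) (k := k) hk hμ (h.length + 1)) _ _).trans ?_
    rw [← leverage, ← hτ, mul_comm 16 τ, mul_assoc]
    refine mul_le_mul_of_nonneg_left ?_ hτ0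
    have h1 := (abs_le.1 (hG z)).1
    rw [histDev_quad_congr he0 hc.le h hz1] at h1
    set lam := lowRankResidual (prefixMatrix a h.length) k / k with hlam
    set lam' := lowRankResidual (prefixMatrix a (h.length + 1)) k / k with hlam'
    have hll : lam ≤ lam' := by
      rw [hlam, hlam']
      gcongr
      exact lowRankResidual_prefixMatrix_mono a k (Nat.le_succ _)
    have hl0 : 0 ≤ lam := div_nonneg (lowRankResidual_nonneg _ _) hk0.le
    have hyy := dotProduct_self_nonneg y
    have h2 := prefixGram_quad_mono (a := a) (Nat.le_succ h.length) y
    have h3 := prefixGram_quad_nonneg (a := a) h.length y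
    have h4 := (hest (h.length + 1)).1
    rw [← hlam'] at h4
    have hz3 : z ⬝ᵥ (ridgeGram a k μ h.length *ᵥ z) ≤
        2 * (y ⬝ᵥ (prefixGram a h.length *ᵥ y) + lam * (y ⬝ᵥ y)) := hz2
    have h5 : η * (z ⬝ᵥ (ridgeGram a k μ h.length *ᵥ z)) ≤
        1 / 16 * (2 * (y ⬝ᵥ (prefixGram a h.length *ᵥ y) + lam * (y ⬝ᵥ y))) := by
      have : 0 ≤ 2 * (y ⬝ᵥ (prefixGram a h.length *ᵥ y) + lam * (y ⬝ᵥ y)) := by positivity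
      calc _ ≤ η * (2 * (y ⬝ᵥ (prefixGram a h.length *ᵥ y) + lam * (y ⬝ᵥ y))) := by gcongr
        _ ≤ _ := by gcongr
    have h6 : lam * (y ⬝ᵥ y) ≤ lam' * (y ⬝ᵥ y) := by gcongr
    have h7 : 1 / 2 * lam' * (y ⬝ᵥ y) ≤ est (h.length + 1) * (y ⬝ᵥ y) := by gcongr
    rw [histReg_quad_eq]
    refine hy2.trans ?_
    linarith
  rw [histProb_eq]
  refine (min_le_left _ _).trans ?_
  nlinarith

include hk hμ hc hSV hest in
open Classical in
/-- The probability of a spectral deviation at time `s`, measured against the first `t` rows. -/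
theorem treeExp_histDev_le (hη0 : 0 ≤ η) (hη : η ≤ 1 / 16) {s t : ℕ} (hst : s ≤ t) (ht : t ≤ n) :
    treeExp (histProb c a est) s (fun h => if PastGood (fun h' => ∀ y,
      y ⬝ᵥ (histDev c a est h' *ᵥ y) ≤ y ⬝ᵥ (ridgeGram a k μ t *ᵥ y)) h ∧
      ∃ y, η * (y ⬝ᵥ (ridgeGram a k μ t *ᵥ y)) < |y ⬝ᵥ (histDev c a est h *ᵥ y)| then 1 else 0) ≤
      2 * d * Real.exp (-(c * η ^ 2 / 4)) := by
  have he0 := est_nonneg hest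
  -- Whitening is done once, at the later time t: the squared lengths become the leverage scores
  -- among the first t rows, and the outer products of the first s rows sum to at most the identity.
  obtain ⟨K, h1, h2, h3⟩ := exists_whitening (posDef_ridgeGram (a := a) (k := k) hk hμ t)
  have hlev : ∀ i, (Kᵀ *ᵥ a i) ⬝ᵥ (Kᵀ *ᵥ a i) = leverage a k μ t i := by
    intro i
    rw [dotProduct_transpose_mulVec, mulVec_mulVec, h3, leverage]
  have hquad : ∀ y, (K *ᵥ y) ⬝ᵥ (ridgeGram a k μ t *ᵥ (K *ᵥ y)) = y ⬝ᵥ y := by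
    intro y
    rw [← dotProduct_conj_mulVec, h1, one_mulVec]
  have key := treeExp_deviation_le (histProb_mem (a := a) he0 hc.le) s (fun i => Kᵀ *ᵥ a i)
    (fun h' => ∀ y, y ⬝ᵥ (histDev c a est h' *ᵥ y) ≤ y ⬝ᵥ (ridgeGram a k μ t *ᵥ y)) hc hη0
    (by linarith) (fun h hh hG => ?_) (fun h => Kᵀ * histDev c a est h * K) ?_ ?_ ?_
  · rw [Fintype.card_fin] at key
    refine le_trans (treeExp_mono (histProb_mem (a := a) he0 hc.le) s fun h _ => ?_) key
    by_cases hb : PastGood (fun h' => ∀ y,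
      y ⬝ᵥ (histDev c a est h' *ᵥ y) ≤ y ⬝ᵥ (ridgeGram a k μ t *ᵥ y)) h ∧
      ∃ y, η * (y ⬝ᵥ (ridgeGram a k μ t *ᵥ y)) < |y ⬝ᵥ (histDev c a est h *ᵥ y)|
    · rw [if_pos hb, if_pos]
      obtain ⟨hb1, y, hy⟩ := hb
      refine ⟨hb1, (Kᵀ * ridgeGram a k μ t) *ᵥ y, ?_⟩
      rw [dotProduct_conj_mulVec, ← hquad, mulVec_mulVec, h2, one_mulVec]
      exact hy
    · rw [if_neg hb]
      split_ifs <;> norm_num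
  · rw [hlev]
    exact min_leverage_le_histProb hk hμ hc hSV hest ht (by omega) hG
  · simp [histDev_nil]
  · intro b h
    simp only [histDev_cons he0 hc.le b h, Matrix.mul_add, Matrix.add_mul, Matrix.mul_smul,
      Matrix.smul_mul, conj_vecMulVec]
  · intro y
    have : ∀ i, (Kᵀ *ᵥ a i) ⬝ᵥ y = a i ⬝ᵥ (K *ᵥ y) := fun i => dotProduct_transpose_mulVec K _ _
    simp only [this]
    rw [← dotProduct_prefixGram_mulVec, ← hquad, ridgeGram_quad]
    refine (prefixGram_quad_mono hst _).trans (le_add_of_nonneg_right ?_)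
    exact mul_nonneg (ridge_pos hk hμ t).le (dotProduct_self_nonneg _)

end Bounds

/-! ### Tail traces -/

section Tail

variable {A : Matrix (Fin n) (Fin d) ℝ}

theorem TopEigen.tailTrace_add (E : TopEigen A k) (lam : ℝ) (X Y : Matrix (Fin d) (Fin d) ℝ) :
    E.tailTrace lam (X + Y) = E.tailTrace lam X + E.tailTrace lam Y := by
  simp only [TopEigen.tailTrace, Matrix.mul_add, Matrix.add_mul, Matrix.add_apply,
    Finset.sum_add_distrib]

theorem TopEigen.tailTrace_smul (E : TopEigen A k) (lam r : ℝ) (X : Matrix (Fin d) (Fin d) ℝ) :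
    E.tailTrace lam (r • X) = r * E.tailTrace lam X := by
  simp only [TopEigen.tailTrace, Matrix.mul_smul, Matrix.smul_mul, Matrix.smul_apply, smul_eq_mul,
    Finset.mul_sum]

theorem TopEigen.tailTrace_vecMulVec (E : TopEigen A k) (lam : ℝ) (x : Fin d → ℝ) :
    E.tailTrace lam (vecMulVec x x) = ∑ j with E.g j < lam, (E.Uᵀ *ᵥ x) j ^ 2 := by
  simp only [TopEigen.tailTrace, conj_vecMulVec, vecMulVec_apply, pow_two]

theorem TopEigen.tailTrace_gram (E : TopEigen A k) (lam : ℝ) :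
    E.tailTrace lam (Aᵀ * A) = ∑ j with E.g j < lam, E.g j := by
  have hG : E.Uᵀ * (Aᵀ * A) * E.U = diagonal E.g := by
    rw [E.gram_eq, show E.Uᵀ * (E.U * diagonal E.g * E.Uᵀ) * E.U =
      (E.Uᵀ * E.U) * diagonal E.g * (E.Uᵀ * E.U) by simp only [Matrix.mul_assoc], E.transpose_mul]
    simp
  simp only [TopEigen.tailTrace, hG, diagonal_apply_eq]

theorem TopEigen.sum_tail_le (E : TopEigen A k) {lam : ℝ} (hlam : 0 ≤ lam)
    (h : lowRankResidual A k ≤ k * lam) : ∑ j with E.g j < lam, E.g j ≤ 2 * (k * lam) := by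
  have hT : (E.T.card : ℝ) ≤ k := by
    rw [E.card_eq]; exact_mod_cast min_le_left _ _
  rw [Finset.sum_filter, ← Finset.sum_add_sum_compl E.T]
  have h2 : ∑ i ∈ E.T, (if E.g i < lam then E.g i else 0) ≤ k * lam := by
    refine (Finset.sum_le_sum (g := fun _ => lam) fun i _ => ?_).trans ?_
    · split_ifs with hi
      · exact hi.le
      · exact hlam
    · rw [Finset.sum_const, nsmul_eq_mul]; gcongr
  have h3 : ∑ i ∈ E.Tᶜ, (if E.g i < lam then E.g i else 0) ≤ ∑ i ∈ E.Tᶜ, E.g i := by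
    refine Finset.sum_le_sum fun i _ => ?_
    have := E.nonneg i
    split_ifs
    · exact le_rfl
    · exact this
  rw [← E.lowRankResidual_eq] at h3
  linarith

/-- The part of a row in the tail is small compared to its leverage score. -/
theorem TopEigen.tailTrace_vecMulVec_le (E : TopEigen A k) {lam : ℝ} (hlam : 0 < lam)
    (x : Fin d → ℝ) (hM : (Aᵀ * A + lam • 1).PosDef) :
    E.tailTrace lam (vecMulVec x x) ≤ 2 * lam * (x ⬝ᵥ ((Aᵀ * A + lam • 1)⁻¹ *ᵥ x)) := by
  set τ := x ⬝ᵥ ((Aᵀ * A + lam • 1)⁻¹ *ᵥ x) with hτ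
  set w := E.tailTrace lam (vecMulVec x x) with hw
  -- The test vector is the tail part of x in the eigenbasis, on which AᵀA + lam is at most 2 lam.
  set v : Fin d → ℝ := fun j => if E.g j < lam then (E.Uᵀ *ᵥ x) j else 0 with hv
  have hUv : E.Uᵀ *ᵥ (E.U *ᵥ v) = v := by rw [mulVec_mulVec, E.transpose_mul, one_mulVec]
  have hwv : w = ∑ j, v j ^ 2 := by
    rw [hw, E.tailTrace_vecMulVec, Finset.sum_filter]
    refine Finset.sum_congr rfl fun j _ => ?_
    by_cases hj : E.g j < lam <;> simp [hv, hj]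
  have hxv : x ⬝ᵥ (E.U *ᵥ v) = w := by
    rw [← dotProduct_transpose_mulVec, hwv]
    simp only [dotProduct]
    refine Finset.sum_congr rfl fun j _ => ?_
    by_cases hj : E.g j < lam <;> simp [hv, hj, pow_two]
  have hMv : (E.U *ᵥ v) ⬝ᵥ ((Aᵀ * A + lam • 1) *ᵥ (E.U *ᵥ v)) ≤ 2 * lam * w := by
    rw [dotProduct_add_smul_one_mulVec, E.gram_eq, dotProduct_conj_diagonal_mulVec,
      ← dotProduct_transpose_mulVec_self E.U E.mul_transpose, hUv, hwv, two_mul, add_mul]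
    rw [Finset.mul_sum]
    refine add_le_add_left (Finset.sum_le_sum fun j _ => ?_) _
    by_cases hj : E.g j < lam
    · exact mul_le_mul_of_nonneg_right hj.le (sq_nonneg _)
    · simp [hv, hj]
  have h1 := sq_dotProduct_le_inv hM x (E.U *ᵥ v)
  rw [hxv, ← hτ] at h1
  have hw0 : 0 ≤ w := hwv ▸ Finset.sum_nonneg fun _ _ => sq_nonneg _
  have hτ0 : 0 ≤ τ := by
    have hs : (Aᵀ * A + lam • (1 : Matrix (Fin d) (Fin d) ℝ))ᵀ = Aᵀ * A + lam • 1 :=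
      transpose_add_smul_one (transpose_gram A) lam
    rw [hτ, ← pinv_eq_inv hM]
    exact pinv_quad_nonneg hs (fun y => by simpa using hM.posSemidef.dotProduct_mulVec_nonneg y) _
  have h2 : w ^ 2 ≤ τ * (2 * lam * w) := h1.trans (mul_le_mul_of_nonneg_left hMv hτ0)
  rcases hw0.eq_or_lt with h0 | h0
  · rw [← h0]; positivity
  · have : w * w ≤ 2 * lam * τ * w := by nlinarith
    exact le_of_mul_le_mul_right this h0

end Tail

end Sampling


section Sampling

variable {d : ℕ} {c : ℝ} {a : ℕ → Fin d → ℝ} {est : ℕ → ℝ} {k n : ℕ} {μ η : ℝ}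

theorem TopEigen.tailTrace_prefixGram {A : Matrix (Fin n) (Fin d) ℝ} (E : TopEigen A k) (lam : ℝ)
    (t : ℕ) : E.tailTrace lam (prefixGram a t) =
      ∑ i ∈ Finset.range t, E.tailTrace lam (vecMulVec (a i) (a i)) := by
  induction t with
  | zero => simp [prefixGram_zero, TopEigen.tailTrace]
  | succ t ih => rw [prefixGram_succ, E.tailTrace_add, ih, Finset.sum_range_succ]

/-- Success of the sampling process with history `h`: projection costs are preserved, and few rows
are kept. -/
def HistSuccess (c : ℝ) (a : ℕ → Fin d → ℝ) (est : ℕ → ℝ) (k n : ℕ) (μ η r : ℝ)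
    (h : List Bool) : Prop :=
  (∀ P : Matrix (Fin d) (Fin d) ℝ, IsRankOrthProj k P →
    |((1 - P) * histDev c a est h).trace| ≤ 22 * η * ((1 - P) * prefixGram a n).trace) ∧
  (h.count true : ℝ) ≤ 384 * c * k * (1 + Real.log (frob (prefixMatrix a n) / μ)) ^ 2 + r

variable (hk : 1 ≤ k) (hμ : 0 < μ) (hc : 0 < c)
  (hSV : ∀ t ≤ n, SingularValuesGE (prefixMatrix a t) μ)
  (hest : ∀ t, 1 / 2 * (lowRankResidual (prefixMatrix a t) k / k) ≤ est t ∧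
    est t ≤ 2 * (lowRankResidual (prefixMatrix a t) k / k))

include hk hμ hc hSV hest in
open Classical in
/-- The probability that the mass of the kept rows in the tail directions deviates. -/
theorem treeExp_tailTrace_le (hη0 : 0 ≤ η) (hη : η ≤ 1 / 16) (E : TopEigen (prefixMatrix a n) k) :
    treeExp (histProb c a est) n (fun h => if PastGood (fun h' => ∀ y,
      y ⬝ᵥ (histDev c a est h' *ᵥ y) ≤ y ⬝ᵥ (ridgeGram a k μ n *ᵥ y)) h ∧
      2 * η * lowRankResidual (prefixMatrix a n) k <
        |E.tailTrace (lowRankResidual (prefixMatrix a n) k / k) (histDev c a est h)|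
        then 1 else 0) ≤ 2 * Real.exp (-(c * η ^ 2 / 4)) := by
  have he0 := est_nonneg hest
  have hk0 : (0 : ℝ) < k := by exact_mod_cast hk
  have hk1 : (1 : ℝ) ≤ k := by exact_mod_cast hk
  have hπ := histProb_mem (a := a) he0 hc.le
  set R := lowRankResidual (prefixMatrix a n) k with hR
  -- If the residual is zero, no eigenvalue lies below the threshold and the tail is empty.
  rcases (lowRankResidual_nonneg (prefixMatrix a n) k).eq_or_lt with h0 | hpos
  · rw [← hR] at h0
    refine le_trans (le_of_eq ?_) (by positivity)
    refine (treeExp_congr n (F' := fun _ => 0) fun h _ => if_neg ?_).trans (treeExp_zero n)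
    rintro ⟨-, hlt⟩
    have hem : (Finset.univ.filter fun j => E.g j < R / k) = ∅ := by
      ext j
      have := E.nonneg j
      simp [← h0, this]
    rw [TopEigen.tailTrace, hem, ← h0] at hlt
    simp at hlt
  rw [← hR] at hpos
  set lam := R / k with hlam
  have hl0 : 0 < lam := div_pos hpos hk0
  have hkl : k * lam = R := by rw [hlam]; field_simp
  set w : ℕ → ℝ := fun i => E.tailTrace lam (vecMulVec (a i) (a i)) with hw
  have hw0 : ∀ i, 0 ≤ w i := fun i => by
    simp only [hw, E.tailTrace_vecMulVec]
    exact Finset.sum_nonneg fun _ _ => sq_nonneg _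
  have hridge : ridge a k μ n = lam := by
    rw [ridge, if_neg (by rw [← hR]; exact hpos.ne')]
  have hwlev : ∀ i, w i / (2 * R) ≤ leverage a k μ n i := by
    intro i
    have hPD := posDef_ridgeGram (a := a) (k := k) hk hμ n
    rw [ridgeGram, hridge] at hPD
    have h1 := E.tailTrace_vecMulVec_le hl0 (a i) hPD
    have h2 : a i ⬝ᵥ (((prefixMatrix a n)ᵀ * prefixMatrix a n + lam • 1)⁻¹ *ᵥ a i) =
        leverage a k μ n i := by rw [leverage, ridgeGram, hridge]; rfl
    rw [h2] at h1
    have h3 := leverage_nonneg (a := a) hk hμ n i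
    rw [div_le_iff₀ (by positivity), ← hkl]
    refine h1.trans ?_
    have : lam * leverage a k μ n i * 1 ≤ lam * leverage a k μ n i * k := by gcongr
    linarith
  have hsq : ∀ i, √(w i / (2 * R)) * √(w i / (2 * R)) = w i / (2 * R) := fun i =>
    Real.mul_self_sqrt (div_nonneg (hw0 i) (by positivity))
  -- The scalar case, with tail masses divided by 2R. Their sum is then at most 1, and each is at
  -- most its leverage score since R = k lam and k ≥ 1.
  have key := treeExp_deviation_le (m := Fin 1) hπ n (fun i _ => √(w i / (2 * R)))
    (fun h' => ∀ y, y ⬝ᵥ (histDev c a est h' *ᵥ y) ≤ y ⬝ᵥ (ridgeGram a k μ n *ᵥ y)) hc hη0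
    (by linarith) (fun h hh hG => ?_)
    (fun h => Matrix.of fun _ _ => E.tailTrace lam (histDev c a est h) / (2 * R)) ?_ ?_ ?_
  · simp only [Fintype.card_fin, Nat.cast_one, mul_one] at key
    refine le_trans (treeExp_mono hπ n fun h _ => ?_) key
    by_cases hb : PastGood (fun h' => ∀ y,
      y ⬝ᵥ (histDev c a est h' *ᵥ y) ≤ y ⬝ᵥ (ridgeGram a k μ n *ᵥ y)) h ∧
      2 * η * R < |E.tailTrace lam (histDev c a est h)|
    · rw [if_pos hb, if_pos]
      refine ⟨hb.1, fun _ => 1, ?_⟩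
      simp only [dotProduct, mulVec, Finset.univ_unique, Finset.sum_singleton, of_apply, mul_one,
        one_mul]
      rw [abs_div, abs_of_pos (show 0 < 2 * R by positivity), lt_div_iff₀ (by positivity)]
      linarith [hb.2]
    · rw [if_neg hb]
      split_ifs <;> norm_num
  · refine le_trans (min_le_min le_rfl ?_)
      (min_leverage_le_histProb hk hμ hc hSV hest le_rfl hh hG)
    simp only [dotProduct, Finset.univ_unique, Finset.sum_singleton, hsq]
    exact mul_le_mul_of_nonneg_left (hwlev _) hc.le
  · ext i j
    simp [histDev_nil, TopEigen.tailTrace]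
  · intro b h
    ext i j
    have hwi : E.tailTrace lam (vecMulVec (a h.length) (a h.length)) = w h.length := rfl
    simp only [histDev_cons he0 hc.le b h, E.tailTrace_add, E.tailTrace_smul, of_apply,
      Matrix.add_apply, Matrix.smul_apply, vecMulVec_apply, hsq, smul_eq_mul, hwi]
    ring
  · intro y
    simp only [dotProduct, Finset.univ_unique, Finset.sum_singleton, mul_pow, ← Finset.sum_mul]
    simp only [pow_two, hsq, ← Finset.sum_div]
    rw [show ∑ i ∈ Finset.range n, w i = E.tailTrace lam (prefixGram a n) from
      (E.tailTrace_prefixGram lam n).symm]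
    have h1 : E.tailTrace lam (prefixGram a n) ≤ 2 * R := by
      rw [← hkl]
      exact (E.tailTrace_gram lam).trans_le (E.sum_tail_le hl0.le (by rw [hkl]))
    have h2 : E.tailTrace lam (prefixGram a n) / (2 * R) ≤ 1 := by
      rw [div_le_one (by positivity)]; exact h1
    exact mul_le_of_le_one_left (mul_self_nonneg _) h2

include hk hμ hc hSV hest in
open Classical in
/-- The failure probability of the sampling process. -/
theorem treeExp_not_histSuccess_le (hη0 : 0 ≤ η) (hη : η ≤ 1 / 16) (r : ℝ) :
    treeExp (histProb c a est) n (fun h => if ¬ HistSuccess c a est k n μ η r h then 1 else 0) ≤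
      ((n + 1) ^ 2 * (2 * d) + 2) * Real.exp (-(c * η ^ 2 / 4)) + Real.exp (-r) := by
  have he0 := est_nonneg hest
  have hπ := histProb_mem (a := a) he0 hc.le
  obtain ⟨E⟩ := nonempty_topEigen (prefixMatrix a n) k
  set W : ℕ → List Bool → Prop := fun t h' => ∀ y,
      y ⬝ᵥ (histDev c a est h' *ᵥ y) ≤ y ⬝ᵥ (ridgeGram a k μ t *ᵥ y) with hW
  set W' : List Bool → Prop := fun h' => ∀ y, |y ⬝ᵥ (histDev c a est h' *ᵥ y)| ≤
      η * (y ⬝ᵥ (ridgeGram a k μ h'.length *ᵥ y)) with hW'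
  set B : ℕ → List Bool → Prop := fun t h => PastGood (W t) h ∧
      ∃ y, η * (y ⬝ᵥ (ridgeGram a k μ t *ᵥ y)) < |y ⬝ᵥ (histDev c a est h *ᵥ y)| with hB
  set T : List Bool → Prop := fun h => PastGood (W n) h ∧
      2 * η * lowRankResidual (prefixMatrix a n) k <
        |E.tailTrace (lowRankResidual (prefixMatrix a n) k / k) (histDev c a est h)| with hT
  set Q : List Bool → Prop := fun h => PastGood W' h ∧
      2 * ∑ i ∈ Finset.range n, 32 * c * leverage a k μ (i + 1) i + r < h.count true with hQ
  have hquad : ∀ t y, 0 ≤ y ⬝ᵥ (ridgeGram a k μ t *ᵥ y) := fun t y => by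
    simpa using (posDef_ridgeGram (a := a) (k := k) hk hμ t).posSemidef.dotProduct_mulVec_nonneg y
  have hsub : ∀ h : List Bool, h.length = n → ¬ HistSuccess c a est k n μ η r h →
      (∃ t ∈ Finset.range (n + 1), ∃ s ∈ Finset.range (t + 1), B t (h.drop (n - s))) ∨
        T h ∨ Q h := by
    intro h hh hS
    by_contra hcon
    push Not at hcon
    obtain ⟨hnB, hnT, hnQ⟩ := hcon
    -- Bootstrap: if the past up to s is good, the absence of the deviation event `B t` gives the
    -- bound with η ≤ 1 at s, so s is good as well.
    have hpast : ∀ t ≤ n, PastGood (W t) (h.drop (n - t)) := by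
      intro t ht
      have := pastGood_drop_of_forall (Good := W t) (h := h) (t := t) (by omega)
      rw [hh] at this
      refine this fun s hs hp y => ?_
      have h1 := hnB t (Finset.mem_range.2 (by omega)) s (Finset.mem_range.2 (by omega))
      simp only [hB, not_and, not_exists, not_lt] at h1
      have h2 := h1 hp y
      have h3 := hquad t y
      refine (le_abs_self _).trans (h2.trans ?_)
      exact mul_le_of_le_one_left h3 (by linarith)
    -- The case s = t gives the two-sided bound relative to the current ridge Gram matrix, as needed
    -- for the row count.
    have hdiag : ∀ t ≤ n, W' (h.drop (n - t)) := by
      intro t ht y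
      have h1 := hnB t (Finset.mem_range.2 (by omega)) t (Finset.mem_range.2 (by omega))
      simp only [hB, not_and, not_exists, not_lt] at h1
      have h2 := h1 (hpast t ht) y
      rwa [List.length_drop, hh, show n - (n - t) = t by omega]
    have hWh : W' h := by simpa using hdiag n le_rfl
    have hPW : PastGood (W n) h := by simpa using hpast n le_rfl
    have hPW' : PastGood W' h := by
      have := pastGood_drop_of_forall (Good := W') (h := h) (t := n) (by omega)
      rw [hh] at this
      simpa using this fun s hs _ => hdiag s hs.le
    refine hS ⟨fun P hP => ?_, ?_⟩
    · have hD : (histDev c a est h)ᵀ = histDev c a est h := transpose_histDev h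
      have htail : |E.tailTrace (lowRankResidual (prefixMatrix a n) k / k) (histDev c a est h)| ≤
          2 * η * lowRankResidual (prefixMatrix a n) k := by
        by_contra hlt
        exact hnT ⟨hPW, not_le.1 hlt⟩
      -- Replacing `ridge` by the residual in the row space costs a factor 2, so 11 becomes 22.
      have := abs_trace_compl_proj_mul_le hk E hD (η := 2 * η) (by linarith) (fun x => ?_) htail hP
      · refine this.trans (le_of_eq ?_)
        rw [prefixGram]; ring
      · obtain ⟨x', hx1, hx2⟩ := exists_mulVec_eq_ridge_le hk hμ (hSV n le_rfl) x
        rw [prefixMatrix_mulVec_eq_iff] at hx1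
        rw [← histDev_quad_congr he0 hc.le h (by rwa [hh])]
        have h1 := hWh x'
        rw [hh] at h1
        refine h1.trans ((mul_le_mul_of_nonneg_left hx2 hη0).trans (le_of_eq ?_))
        rw [prefixGram]; ring
    · have h1 : (h.count true : ℝ) ≤
          2 * ∑ i ∈ Finset.range n, 32 * c * leverage a k μ (i + 1) i + r := by
        by_contra hlt
        exact hnQ ⟨hPW', not_le.1 hlt⟩
      rw [← Finset.mul_sum] at h1
      have h2 := sum_online_leverage_le hk hμ n hSV
      have h3 : 64 * c * ∑ i ∈ Finset.range n, leverage a k μ (i + 1) i ≤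
          64 * c * (6 * k * (1 + Real.log (frob (prefixMatrix a n) / μ)) ^ 2) :=
        mul_le_mul_of_nonneg_left h2 (by positivity)
      linarith
  have hpt : ∀ h : List Bool, h.length = n →
      (if ¬ HistSuccess c a est k n μ η r h then (1 : ℝ) else 0) ≤
      (∑ t ∈ Finset.range (n + 1), ∑ s ∈ Finset.range (t + 1),
        if B t (h.drop (n - s)) then (1 : ℝ) else 0) +
        ((if T h then 1 else 0) + if Q h then 1 else 0) := by
    intro h hh
    have n1 : ∀ t s, (0 : ℝ) ≤ if B t (h.drop (n - s)) then (1 : ℝ) else 0 := fun t s => by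
      split_ifs <;> norm_num
    have n2 : (0 : ℝ) ≤ if T h then (1 : ℝ) else 0 := by split_ifs <;> norm_num
    have n3 : (0 : ℝ) ≤ if Q h then (1 : ℝ) else 0 := by split_ifs <;> norm_num
    have n4 : (0 : ℝ) ≤ ∑ t ∈ Finset.range (n + 1), ∑ s ∈ Finset.range (t + 1),
        if B t (h.drop (n - s)) then (1 : ℝ) else 0 :=
      Finset.sum_nonneg fun t _ => Finset.sum_nonneg fun s _ => n1 t s
    by_cases hS : HistSuccess c a est k n μ η r h
    · rw [if_neg (not_not.2 hS)]; linarith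
    · rw [if_pos hS]
      rcases hsub h hh hS with ⟨t, ht, s, hs, hb⟩ | hb | hb
      · have h1 := Finset.single_le_sum (f := fun t => ∑ s ∈ Finset.range (t + 1),
          if B t (h.drop (n - s)) then (1 : ℝ) else 0)
          (fun t _ => Finset.sum_nonneg fun s _ => n1 t s) ht
        have h2 := Finset.single_le_sum (f := fun s => if B t (h.drop (n - s)) then (1 : ℝ) else 0)
          (fun s _ => n1 t s) hs
        simp only [if_pos hb] at h2
        linarith
      · rw [if_pos hb] at n2 ⊢; linarith
      · rw [if_pos hb] at n3 ⊢; linarith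
  refine (treeExp_mono hπ n hpt).trans ?_
  rw [treeExp_add, treeExp_add, treeExp_sum]
  have hb : ∀ t ∈ Finset.range (n + 1), treeExp (histProb c a est) n
      (fun h => ∑ s ∈ Finset.range (t + 1), if B t (h.drop (n - s)) then (1 : ℝ) else 0) ≤
      (n + 1) * (2 * d * Real.exp (-(c * η ^ 2 / 4))) := by
    intro t ht
    rw [Finset.mem_range] at ht
    rw [treeExp_sum]
    refine (Finset.sum_le_card_nsmul _ _ (2 * d * Real.exp (-(c * η ^ 2 / 4)))
      fun s hs => ?_).trans ?_
    · rw [Finset.mem_range] at hs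
      have h1 := treeExp_drop (π := histProb c a est) s (n - s)
        (fun h => if B t h then (1 : ℝ) else 0)
      rw [show s + (n - s) = n by omega] at h1
      rw [h1]
      exact treeExp_histDev_le hk hμ hc hSV hest hη0 hη (by omega) (by omega)
    · rw [Finset.card_range, nsmul_eq_mul]
      gcongr
      exact_mod_cast ht
  have hb' := Finset.sum_le_card_nsmul _ _ _ hb
  rw [Finset.card_range, nsmul_eq_mul] at hb'
  have h2 := treeExp_tailTrace_le hk hμ hc hSV hest hη0 hη E
  have h3 := treeExp_count_le hπ n W' (fun i => 32 * c * leverage a k μ (i + 1) i)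
    (fun h hh hG => histProb_le_leverage hk hμ hc hSV hest hη0 hη hh hG) r
  push_cast at hb'
  linarith

end Sampling


/-! ### Consequences of success -/

section Success

variable {d : ℕ} {c : ℝ} {a : ℕ → Fin d → ℝ} {est : ℕ → ℝ} {k n : ℕ} {μ ε : ℝ}

/-- Each inequality is evaluated at the projection optimal for one of the two matrices. For k > d no
rank k projection exists, but for d ≤ k both residuals vanish. -/
theorem lowRankResidual_bounds_of_isPCPSample {m : ℕ} {A : Matrix (Fin n) (Fin d) ℝ}
    {B : Matrix (Fin m) (Fin d) ℝ} (hε1 : ε ≤ 1) (h : IsPCPSample k ε A B) :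
    (1 - ε) * lowRankResidual A k ≤ lowRankResidual B k ∧
      lowRankResidual B k ≤ (1 + ε) * lowRankResidual A k := by
  rcases le_total d k with hk | hk
  · simp [lowRankResidual_eq_zero _ hk]
  have hle : ∀ {l : ℕ} (M : Matrix (Fin l) (Fin d) ℝ) {P : Matrix (Fin d) (Fin d) ℝ},
      IsRankOrthProj k P → lowRankResidual M k ≤ frobSq (M - M * P) := fun M P hP =>
    lowRankResidual_le _ _ ((rank_mul_le_right _ _).trans hP.2.2.le)
  have heq : ∀ {l : ℕ} (M : Matrix (Fin l) (Fin d) ℝ), ∃ P : Matrix (Fin d) (Fin d) ℝ,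
      IsRankOrthProj k P ∧ frobSq (M - M * P) = lowRankResidual M k := by
    intro l M
    obtain ⟨E⟩ := nonempty_topEigen M k
    exact ⟨E.proj, E.proj_isRankOrthProj hk, by rw [E.frobSq_sub_proj, E.lowRankResidual_eq]⟩
  constructor
  · obtain ⟨P, hP, he⟩ := heq B
    rw [← he]
    exact (mul_le_mul_of_nonneg_left (hle A hP) (by linarith)).trans (h.2 P hP).1
  · obtain ⟨P, hP, he⟩ := heq A
    rw [← he]
    exact (hle B hP).trans (h.2 P hP).2

theorem one_le_one_add_log_frob_div {A : Matrix (Fin n) (Fin d) ℝ} (hμ : 0 < μ)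
    (h : SingularValuesGE A μ) : 1 ≤ 1 + Real.log (frob A / μ) := by
  rw [le_add_iff_nonneg_right]
  by_cases h0 : frobSq A = 0
  · simp [frob, h0]
  · refine Real.log_nonneg ((one_le_div hμ).2 ?_)
    rw [frob]
    exact Real.le_sqrt_of_sq_le (sq_le_frobSq hμ h h0)

/-- The guarantees of part 1 of the main theorem for an output matrix `B` of `r` rows. -/
theorem success_of_histSuccess (hk : 1 ≤ k) (hε0 : 0 < ε) (hε : ε ≤ 1 / 2) (hμ : 0 < μ)
    (hSV : SingularValuesGE (prefixMatrix a n) μ) {α κ : ℝ} (hκ : 0 ≤ κ)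
    {h : List Bool} (hh : h.length = n)
    (hS : HistSuccess (oversampling α ε d) a est k n μ (ε / 22) (κ * Real.log d) h) :
    IsPCPSample k ε (prefixMatrix a n) (rowsMatrix (histRows (oversampling α ε d) a est h)) ∧
      ((histRows (oversampling α ε d) a est h).length : ℝ) ≤
        (2304 * α + κ) * rowBound k ε μ (prefixMatrix a n) := by
  have hlog : 0 ≤ Real.log d := Real.log_natCast_nonneg d
  obtain ⟨hP, hcount⟩ := hS
  refine ⟨⟨isRescaledRowSample_histRows hh, fun P hPr => ?_⟩, ?_⟩
  · have h1 := hP P hPr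
    rw [frobSq_sub_mul_proj _ hPr.1 hPr.2.1, frobSq_sub_mul_proj _ hPr.1 hPr.2.1]
    rw [show (1 - P) * histDev (oversampling α ε d) a est h =
      (1 - P) * histGram (oversampling α ε d) a est h - (1 - P) * prefixGram a n by
        rw [histDev, hh, Matrix.mul_sub], trace_sub, abs_le] at h1
    rw [histGram, prefixGram] at h1
    constructor <;> linarith [h1.1, h1.2]
  · rw [length_histRows]
    refine hcount.trans ?_
    set L := 1 + Real.log (frob (prefixMatrix a n) / μ) with hL
    have hL1 : 1 ≤ L := one_le_one_add_log_frob_div hμ hSV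
    have hk1 : (1 : ℝ) ≤ k := by exact_mod_cast hk
    have h1 : 1 ≤ k / ε ^ 2 * L ^ 2 := by
      have h2 : 1 ≤ (k : ℝ) / ε ^ 2 := by
        rw [one_le_div (by positivity)]; nlinarith
      exact one_le_mul_of_one_le_of_one_le h2 (one_le_pow₀ hL1)
    have h2 : κ * Real.log d ≤ κ * Real.log d * (k / ε ^ 2 * L ^ 2) :=
      le_mul_of_one_le_right (by positivity) h1
    refine (add_le_add_right h2 _).trans (le_of_eq ?_)
    rw [rowBound, oversampling, ← hL]
    ring

/-- Here d ≥ 2 is forced. The prefactor is at most d^(2p+5), and the remaining d^(-pq) is at most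
n^(-q). -/
theorem add_three_mul_exp_le {p q n d : ℕ} (hn : 2 ≤ n) (hnd : n ≤ d ^ p) {x y : ℝ}
    (hx : ((2 * p + 5 + p * q : ℕ) : ℝ) * Real.log d ≤ x)
    (hy : ((2 * p + 5 + p * q : ℕ) : ℝ) * Real.log d ≤ y) :
    (((n : ℝ) + 1) ^ 2 * (2 * d) + 2) * Real.exp (-x) + Real.exp (-y) ≤ 1 / (n : ℝ) ^ q := by
  have hd : 2 ≤ d := by
    by_contra hlt
    have : d ^ p ≤ 1 := pow_le_one₀ (Nat.zero_le _) (by omega)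
    omega
  have hd2 : (2 : ℝ) ≤ d := by exact_mod_cast hd
  have hd0 : (0 : ℝ) < d := by linarith
  have hnd' : (n : ℝ) ≤ (d : ℝ) ^ p := by exact_mod_cast hnd
  have hn0 : (0 : ℝ) < n := by exact_mod_cast (by omega : 0 < n)
  set κ := 2 * p + 5 + p * q with hκ
  have hexp : ∀ z, (κ : ℝ) * Real.log d ≤ z → Real.exp (-z) ≤ ((d : ℝ) ^ κ)⁻¹ := by
    intro z hz
    rw [← Real.exp_log (pow_pos hd0 κ), ← Real.exp_neg, Real.log_pow]
    exact Real.exp_le_exp.2 (neg_le_neg hz)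
  have hp1 : (1 : ℝ) ≤ (d : ℝ) ^ p := one_le_pow₀ (by linarith)
  have h1 : ((n : ℝ) + 1) ^ 2 ≤ 4 * (d : ℝ) ^ (2 * p) := by
    calc ((n : ℝ) + 1) ^ 2 ≤ (2 * (d : ℝ) ^ p) ^ 2 := by gcongr; linarith
      _ = _ := by ring
  have h2 : ((n : ℝ) + 1) ^ 2 * (2 * d) + 3 ≤ (d : ℝ) ^ (2 * p + 5) := by
    have h3 : (1 : ℝ) ≤ (d : ℝ) ^ (2 * p + 1) := one_le_pow₀ (by linarith)
    have h4 : (16 : ℝ) ≤ (d : ℝ) ^ 4 := by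
      calc (16 : ℝ) = 2 ^ 4 := by norm_num
        _ ≤ _ := by gcongr
    calc ((n : ℝ) + 1) ^ 2 * (2 * d) + 3 ≤ 4 * (d : ℝ) ^ (2 * p) * (2 * d) + 3 := by gcongr
      _ = 8 * (d : ℝ) ^ (2 * p + 1) + 3 := by ring
      _ ≤ 16 * (d : ℝ) ^ (2 * p + 1) := by linarith
      _ ≤ (d : ℝ) ^ 4 * (d : ℝ) ^ (2 * p + 1) := by gcongr
      _ = _ := by ring
  calc _ ≤ (((n : ℝ) + 1) ^ 2 * (2 * d) + 2) * ((d : ℝ) ^ κ)⁻¹ + ((d : ℝ) ^ κ)⁻¹ := by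
        gcongr
        · exact hexp x hx
        · exact hexp y hy
    _ = (((n : ℝ) + 1) ^ 2 * (2 * d) + 3) * ((d : ℝ) ^ κ)⁻¹ := by ring
    _ ≤ (d : ℝ) ^ (2 * p + 5) * ((d : ℝ) ^ κ)⁻¹ := by gcongr
    _ = 1 / ((d : ℝ) ^ p) ^ q := by
        rw [hκ, pow_add (d : ℝ) (2 * p + 5), pow_mul]
        field_simp
    _ ≤ _ := by gcongr

open Classical in
theorem treeExp_not_histSuccess_le_of_le {p q : ℕ} (hn : 2 ≤ n) (hnd : n ≤ d ^ p) (hk : 1 ≤ k)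
    (hε0 : 0 < ε) (hε : ε ≤ 1 / 2) (hμ : 0 < μ)
    (hSV : ∀ t ≤ n, SingularValuesGE (prefixMatrix a t) μ)
    (hest : ∀ t, 1 / 2 * (lowRankResidual (prefixMatrix a t) k / k) ≤ est t ∧
      est t ≤ 2 * (lowRankResidual (prefixMatrix a t) k / k))
    {α : ℝ} (hα : 323 * ((2 * p + 5 + p * q : ℕ) : ℝ) ≤ α) :
    treeExp (histProb (oversampling α ε d) a est) n (fun h =>
      if ¬ HistSuccess (oversampling α ε d) a est k n μ (ε / 22)
        (((2 * p + 5 + p * q : ℕ) : ℝ) * Real.log d) h then 1 else 0) ≤ 1 / (n : ℝ) ^ q := by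
  have hd : 2 ≤ d := by
    by_contra hlt
    have : d ^ p ≤ 1 := pow_le_one₀ (Nat.zero_le _) (by omega)
    omega
  have hlog : 0 < Real.log d := Real.log_pos (by exact_mod_cast hd)
  have hκ : (0 : ℝ) < ((2 * p + 5 + p * q : ℕ) : ℝ) := by exact_mod_cast (by omega)
  have hα0 : 0 < α := by linarith
  refine (treeExp_not_histSuccess_le hk hμ (by unfold oversampling; positivity) hSV hest
    (by positivity) (by linarith) _).trans (add_three_mul_exp_le hn hnd ?_ le_rfl)
  -- With η = ε / 22 the denominator is 4 · 22² = 1936, and 6 · 323 = 1938 exceeds it. This explains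
  -- the constant 323.
  rw [show oversampling α ε d * (ε / 22) ^ 2 / 4 = 6 * α / 1936 * Real.log d by
    rw [oversampling]; field_simp; norm_num]
  refine mul_le_mul_of_nonneg_right ?_ hlog.le
  linarith

end Success

/-! ### Measurability and locality -/

section Measurable

variable {d : ℕ} {c : ℝ} {a : ℕ → Fin d → ℝ} {k n : ℕ} {μ : ℝ}
  {Ω : Type*} [MeasurableSpace Ω] {est : Ω → ℕ → ℝ}

theorem measurable_histProb_of_histGram (hm : ∀ t, Measurable fun ω => est ω t)
    (h0 : ∀ ω t, 0 ≤ est ω t) {h : List Bool}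
    (hG : ∀ i j, Measurable fun ω => histGram c a (est ω) h i j) :
    Measurable fun ω => histProb c a (est ω) h := by
  simp only [histProb_eq]
  refine Measurable.min (Measurable.const_mul (measurable_pinv_quad (r := 1) (fun i j => ?_)
    (fun ω => transpose_histReg h) (fun ω => sq_le_histReg_quad (h0 ω) h)
    (fun ω => histReg_quad_nonneg (h0 ω) h)) _) measurable_const
  simp only [histReg, Matrix.add_apply, Matrix.smul_apply, smul_eq_mul]
  exact ((hG i j).add measurable_const).add (((hm _).const_mul _).mul_const _)

theorem measurable_histGram (hc : 0 ≤ c) (hm : ∀ t, Measurable fun ω => est ω t)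
    (h0 : ∀ ω t, 0 ≤ est ω t) (h : List Bool) (i j : Fin d) :
    Measurable fun ω => histGram c a (est ω) h i j := by
  induction h generalizing i j with
  | nil => simp [histGram_nil]
  | cons b h ih =>
    have := measurable_histProb_of_histGram hm h0 ih
    have e : ∀ ω, histGram c a (est ω) (b :: h) = _ := fun ω => histGram_cons (h0 ω) hc b h
    simp only [e, Matrix.add_apply, Matrix.smul_apply, smul_eq_mul]
    refine (ih i j).add (Measurable.mul_const ?_ _)
    cases b
    · simp
    · simp only [if_true]
      exact this.inv

theorem measurable_histProb (hc : 0 ≤ c) (hm : ∀ t, Measurable fun ω => est ω t)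
    (h0 : ∀ ω t, 0 ≤ est ω t) (h : List Bool) : Measurable fun ω => histProb c a (est ω) h :=
  measurable_histProb_of_histGram hm h0 (measurable_histGram hc hm h0 h)

/-- The condition ranges over uncountably many projections, but each is closed in the entries of the
deviation matrix, so their intersection is closed and hence measurable. -/
theorem measurableSet_histSuccess (hc : 0 ≤ c) (hm : ∀ t, Measurable fun ω => est ω t)
    (h0 : ∀ ω t, 0 ≤ est ω t) (η r : ℝ) (h : List Bool) :
    MeasurableSet {ω | HistSuccess c a (est ω) k n μ η r h} := by
  simp only [HistSuccess]
  refine MeasurableSet.inter ?_ (MeasurableSet.const _)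
  set S : Set (Fin d → Fin d → ℝ) := {D | ∀ P : Matrix (Fin d) (Fin d) ℝ, IsRankOrthProj k P →
    |((1 - P) * (Matrix.of D)).trace| ≤ 22 * η * ((1 - P) * prefixGram a n).trace} with hS
  have hSc : IsClosed S := by
    simp only [hS, Set.ofPred_forall]
    refine isClosed_iInter fun P => isClosed_iInter fun _ => isClosed_le ?_ continuous_const
    simp only [Matrix.trace, Matrix.diag, Matrix.mul_apply, Matrix.of_apply]
    fun_prop
  have hf : Measurable fun ω => (fun i j => histDev c a (est ω) h i j : Fin d → Fin d → ℝ) := by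
    refine measurable_pi_iff.2 fun i => measurable_pi_iff.2 fun j => ?_
    simp only [histDev, Matrix.sub_apply]
    exact (measurable_histGram hc hm h0 h i j).sub measurable_const
  exact hf hSc.measurableSet

end Measurable

section Locality

variable {d : ℕ} {c : ℝ}

theorem onlineLRA_congr {a a' : ℕ → Fin d → ℝ} {est est' : ℕ → ℝ} (t : ℕ)
    (ha : ∀ i < t, a i = a' i) (he : ∀ s, 1 ≤ s → s ≤ t → est s = est' s)
    (u : Fin t → unitInterval) : onlineLRA c a est t u = onlineLRA c a' est' t u := by
  induction t with
  | zero => rfl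
  | succ t ih =>
    simp only [onlineLRA]
    rw [ih (fun i hi => ha i (by omega)) (fun s h1 h2 => he s h1 (by omega)), ha t (by omega),
      he (t + 1) (by omega) le_rfl]

/-- The stream whose first rows are the rows of `M`. -/
noncomputable def streamOf {t : ℕ} (M : Matrix (Fin t) (Fin d) ℝ) (i : ℕ) : Fin d → ℝ :=
  if h : i < t then M ⟨i, h⟩ else 0

theorem streamOf_prefixMatrix (a : ℕ → Fin d → ℝ) {t i : ℕ} (h : i < t) :
    streamOf (prefixMatrix a t) i = a i := by
  simp only [streamOf, dif_pos h]
  rfl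

theorem prefixMatrix_congr {a a' : ℕ → Fin d → ℝ} {t : ℕ} (h : ∀ i < t, a i = a' i) :
    prefixMatrix a t = prefixMatrix a' t := by
  ext i j
  exact congrFun (h i i.2) j

/-- `‖A_t - (A_t)_k‖_F² / k`. -/
noncomputable def exactEst (a : ℕ → Fin d → ℝ) (k t : ℕ) : ℝ :=
  lowRankResidual (prefixMatrix a t) k / k

/-- `OnlineLRA` with exact residuals, recomputing its state from the rows that have arrived. -/
noncomputable def exactSampler (c : ℝ) (d k n : ℕ) : OnlineSampler d where
  Seed := Fin n → unitInterval
  law := volume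
  decide t M u :=
    -- The default coin 0 beyond index n is not consulted in the first n decisions.
    let w : ℕ → unitInterval := fun i => if h : i < n then u ⟨i, h⟩ else 0
    let p := samplingProb c (rowsMatrix (onlineLRA c (streamOf M) (exactEst (streamOf M) k) t
      fun i => w i)) (streamOf M t) (1 / 2 * exactEst (streamOf M) k (t + 1))
    open Classical in
    if (w t : ℝ) < p then some (1 / √p) else none

theorem exactSampler_output (k n : ℕ) (a : ℕ → Fin d → ℝ) (u : Fin n → unitInterval) :
    (exactSampler c d k n).output a n u = onlineLRA c a (exactEst a k) n u := by
  set w : ℕ → unitInterval := fun i => if h : i < n then u ⟨i, h⟩ else 0 with hw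
  have hwu : (fun i : Fin n => w i) = u := by
    ext i; simp [hw]
  have key : ∀ t, (exactSampler c d k n).output a t u =
      onlineLRA c a (exactEst a k) t fun i => w i := by
    intro t
    induction t with
    | zero => rfl
    | succ t ih =>
      have ha : ∀ i < t + 1, streamOf (prefixMatrix a (t + 1)) i = a i := fun i hi =>
        streamOf_prefixMatrix a hi
      have he : ∀ s ≤ t + 1, exactEst (streamOf (prefixMatrix a (t + 1))) k s = exactEst a k s :=
        fun s hs => by
          rw [exactEst, prefixMatrix_congr fun i hi => ha i (by omega)]; rfl
      simp only [OnlineSampler.output] at ih ⊢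
      rw [List.range_succ, List.filterMap_append, ih]
      have hcongr := onlineLRA_congr (c := c) t (fun i hi => ha i (by omega))
        (fun s _ h2 => he s (by omega)) (fun i => w i)
      set S := onlineLRA c a (exactEst a k) t fun i => w i with hS
      set r := samplingProb c (rowsMatrix S) (a t) (1 / 2 * exactEst a k (t + 1)) with hr
      have hdec : (exactSampler c d k n).decide t (prefixMatrix a (t + 1)) u =
          open Classical in if (w t : ℝ) < r then some (1 / √r) else none := by
        rw [hr, ← hcongr, ← he (t + 1) le_rfl, ← ha t (by omega)]
        rfl
      have hstep : onlineLRA c a (exactEst a k) (t + 1) (fun i => w i) =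
          open Classical in if (w t : ℝ) < r then S ++ [(1 / √r) • a t] else S := rfl
      rw [hstep, List.filterMap_cons, hdec]
      split_ifs <;> simp
  rw [key n, hwu]

end Locality


/-! ### The main theorem -/

section Main

variable {d : ℕ} {c : ℝ} {a : ℕ → Fin d → ℝ} {k n : ℕ} {μ ε : ℝ}

theorem rowBound_nonneg (A : Matrix (Fin n) (Fin d) ℝ) : 0 ≤ rowBound k ε μ A := by
  have := Real.log_natCast_nonneg d
  unfold rowBound
  positivity

/-- The rows `L` are a projection-cost preserving sample of `A`, and there are few of them. -/
def IsSmallPCPSample (C : ℝ) (k : ℕ) (ε μ : ℝ) (A : Matrix (Fin n) (Fin d) ℝ)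
    (L : List (Fin d → ℝ)) : Prop :=
  IsPCPSample k ε A (rowsMatrix L) ∧ (L.length : ℝ) ≤ C * rowBound k ε μ A

/-- On streams without rows the algorithm succeeds surely. -/
theorem isSmallPCPSample_zero (h : n = 0) (est : ℕ → ℝ) (u : Fin n → unitInterval) {C : ℝ}
    (hC : 0 ≤ C) : IsSmallPCPSample C k ε μ (prefixMatrix a n) (onlineLRA c a est n u) := by
  subst h
  refine ⟨⟨⟨fun i => i.elim0, fun i => i.elim0, fun i => i.elim0, fun i => i.elim0⟩,
    fun P _ => ?_⟩, ?_⟩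
  · have h0 : ∀ M : Matrix (Fin 0) (Fin d) ℝ, frobSq M = 0 := fun M => by simp [frobSq]
    have h1 : frobSq (rowsMatrix (onlineLRA c a est 0 u) -
      rowsMatrix (onlineLRA c a est 0 u) * P) = 0 := h0 _
    rw [h0, h1]
    simp
  · simpa [onlineLRA] using mul_nonneg hC (rowBound_nonneg _)

/-- The failure probability of `OnlineLRA` with residual estimates that are always accurate. -/
theorem measure_not_success_le {p q : ℕ} (hn : 2 ≤ n) (hnd : n ≤ d ^ p) (hk : 1 ≤ k)
    (hε0 : 0 < ε) (hε : ε ≤ 1 / 2) (hμ : 0 < μ)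
    (hSV : ∀ t ≤ n, SingularValuesGE (prefixMatrix a t) μ) {Ω : Type*} [MeasurableSpace Ω]
    (ν : Measure Ω) [IsProbabilityMeasure ν] {est : Ω → ℕ → ℝ}
    (hm : ∀ t, Measurable fun ω => est ω t)
    (hest : ∀ ω t, 1 / 2 * (lowRankResidual (prefixMatrix a t) k / k) ≤ est ω t ∧
      est ω t ≤ 2 * (lowRankResidual (prefixMatrix a t) k / k))
    {α : ℝ} (hα : 323 * ((2 * p + 5 + p * q : ℕ) : ℝ) ≤ α) :
    ν.prod (volume : Measure (Fin n → unitInterval)) {x |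
      ¬ IsSmallPCPSample (2304 * α + ((2 * p + 5 + p * q : ℕ) : ℝ)) k ε μ (prefixMatrix a n)
          (onlineLRA (oversampling α ε d) a (est x.1) n x.2)} ≤
      ENNReal.ofReal (1 / (n : ℝ) ^ q) := by
  have h0 : ∀ ω t, 0 ≤ est ω t := fun ω => est_nonneg (hest ω)
  have hc : 0 ≤ oversampling α ε d := by
    have := Real.log_natCast_nonneg d
    have : 0 ≤ α := le_trans (by positivity) hα
    unfold oversampling
    positivity
  set c := oversampling α ε d with hcdef
  set Bad : Ω → List Bool → Prop := fun ω h => ¬ HistSuccess c a (est ω) k n μ (ε / 22)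
    (((2 * p + 5 + p * q : ℕ) : ℝ) * Real.log d) h with hBad
  have hms : MeasurableSet {x : Ω × (Fin n → unitInterval) |
      Bad x.1 (coins (histProb c a (est x.1)) n x.2)} :=
    measurableSet_coins_mem n (fun h _ => measurable_histProb hc hm h0 h)
      fun h _ => (measurableSet_histSuccess hc hm h0 _ _ h).compl
  refine (measure_mono (t := {x : Ω × (Fin n → unitInterval) |
      Bad x.1 (coins (histProb c a (est x.1)) n x.2)}) fun x hx => ?_).trans ?_
  · rw [Set.mem_ofPred_eq] at hx ⊢
    intro hS
    refine hx ?_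
    rw [onlineLRA_eq_histRows]
    exact success_of_histSuccess hk hε0 hε hμ (hSV n le_rfl) (Nat.cast_nonneg _)
      (length_coins _ _ _) hS
  · rw [Measure.prod_apply hms]
    refine (lintegral_mono (g := fun _ => ENNReal.ofReal (1 / (n : ℝ) ^ q)) fun ω => ?_).trans
      (by simp)
    change volume {u : Fin n → unitInterval | Bad ω (coins (histProb c a (est ω)) n u)} ≤ _
    rw [volume_coins_mem (histProb_mem (h0 ω) hc)]
    refine ENNReal.ofReal_le_ofReal ?_
    convert treeExp_not_histSuccess_le_of_le hn hnd hk hε0 hε hμ hSV (hest ω) hα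

/-- A residual procedure fails on some prefix of the stream with probability at most `n * δ`. -/
theorem IsResidualProcedure.measure_exists_le {Ω : Type*} [MeasurableSpace Ω] {ν : Measure Ω}
    {δ : ℝ} {Res : (t : ℕ) → Matrix (Fin t) (Fin d) ℝ → Ω → ℝ}
    (h : IsResidualProcedure ν n k δ Res) (a : ℕ → Fin d → ℝ) :
    ν {ω | ∃ t ∈ Finset.Icc 1 n, ¬ (1 / 2 * (lowRankResidual (prefixMatrix a t) k / k) ≤
      Res t (prefixMatrix a t) ω ∧ Res t (prefixMatrix a t) ω ≤
        2 * (lowRankResidual (prefixMatrix a t) k / k))} ≤ ENNReal.ofReal (n * δ) := by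
  have e : {ω | ∃ t ∈ Finset.Icc 1 n, ¬ (1 / 2 * (lowRankResidual (prefixMatrix a t) k / k) ≤
      Res t (prefixMatrix a t) ω ∧ Res t (prefixMatrix a t) ω ≤
        2 * (lowRankResidual (prefixMatrix a t) k / k))} = ⋃ t ∈ Finset.Icc 1 n,
      {ω | ¬ (1 / 2 * (lowRankResidual (prefixMatrix a t) k / k) ≤
      Res t (prefixMatrix a t) ω ∧ Res t (prefixMatrix a t) ω ≤
        2 * (lowRankResidual (prefixMatrix a t) k / k))} := by
    ext ω; simp only [Set.mem_ofPred_eq, Set.mem_iUnion, exists_prop]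
  rw [e]
  refine (measure_biUnion_finset_le _ _).trans ?_
  refine (Finset.sum_le_card_nsmul _ _ (ENNReal.ofReal δ) fun t ht => ?_).trans ?_
  · rw [Finset.mem_Icc] at ht
    exact (h t ht.1 ht.2 _).2
  · rw [ENNReal.ofReal_mul (Nat.cast_nonneg n)]
    simp

/-- `OnlineLRA` with a residual procedure fails with small probability. -/
theorem measure_not_success_residual_le {p q : ℕ} (hnd : n ≤ d ^ p) (hk : 1 ≤ k)
    (hε0 : 0 < ε) (hε : ε ≤ 1 / 2) (hμ : 0 < μ)
    (hSV : ∀ t ≤ n, SingularValuesGE (prefixMatrix a t) μ) {Ω : Type*} [MeasurableSpace Ω]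
    (ν : Measure Ω) [IsProbabilityMeasure ν]
    {Res : (t : ℕ) → Matrix (Fin t) (Fin d) ℝ → Ω → ℝ}
    (hRes : IsResidualProcedure ν n k (1 / (n : ℝ) ^ (q + 1)) Res)
    {α : ℝ} (hα : 323 * ((2 * p + 5 + p * q : ℕ) : ℝ) ≤ α) :
    ν.prod (volume : Measure (Fin n → unitInterval)) {x |
      ¬ IsSmallPCPSample (2304 * α + ((2 * p + 5 + p * q : ℕ) : ℝ)) k ε μ (prefixMatrix a n)
        (onlineLRA (oversampling α ε d) a (fun t => Res t (prefixMatrix a t) x.1) n x.2)} ≤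
      ENNReal.ofReal (2 / (n : ℝ) ^ q) := by
  have hα0 : 0 ≤ α := le_trans (by positivity) hα
  rcases Nat.lt_or_ge n 2 with hn | hn
  -- For n = 0 and q > 0 the bound is 2 / 0 = 0, so success has to be sure. For n = 1 the bound is 2
  -- and nothing is claimed.
  · rcases Nat.eq_zero_or_pos n with hn0 | hn0
    · refine le_trans (le_of_eq ?_) (zero_le (a := ENNReal.ofReal _))
      refine (congrArg _ (Set.eq_empty_of_forall_notMem fun x hx => ?_)).trans measure_empty
      rw [Set.mem_ofPred_eq] at hx
      exact hx (isSmallPCPSample_zero hn0 _ _ (by positivity))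
    · obtain rfl : n = 1 := by omega
      refine prob_le_one.trans ?_
      rw [← ENNReal.ofReal_one]
      exact ENNReal.ofReal_le_ofReal (by simp)
  classical
  set lam : ℕ → ℝ := fun t => lowRankResidual (prefixMatrix a t) k / k with hlam
  have hl0 : ∀ t, 0 ≤ lam t := fun t => div_nonneg (lowRankResidual_nonneg _ _) (Nat.cast_nonneg _)
  -- Clamping makes the estimates accurate for every seed. They differ from the given ones at times
  -- 1, …, n only on the failure event of the procedure, whose probability is at most n ·
  -- n^(-(q+1)).
  set est : Ω → ℕ → ℝ := fun ω t => if 1 ≤ t ∧ t ≤ n then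
    max (1 / 2 * lam t) (min (Res t (prefixMatrix a t) ω) (2 * lam t)) else lam t with hest
  have hm : ∀ t, Measurable fun ω => est ω t := by
    intro t
    by_cases ht : 1 ≤ t ∧ t ≤ n
    · simp only [hest, if_pos ht]
      exact measurable_const.max ((hRes t ht.1 ht.2 _).1.min measurable_const)
    · simp only [hest, if_neg ht]
      exact measurable_const
  have hb : ∀ ω t, 1 / 2 * lam t ≤ est ω t ∧ est ω t ≤ 2 * lam t := by
    intro ω t
    have := hl0 t
    simp only [hest]
    split_ifs
    · exact ⟨le_max_left _ _, max_le (by linarith) (min_le_right _ _)⟩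
    · constructor <;> linarith
  have hmain := measure_not_success_le hn hnd hk hε0 hε hμ hSV ν hm hb hα
  have hbad := hRes.measure_exists_le a
  have hn0 : (0 : ℝ) < n := by exact_mod_cast (by omega : 0 < n)
  rw [show (n : ℝ) * (1 / (n : ℝ) ^ (q + 1)) = 1 / (n : ℝ) ^ q by
    rw [pow_succ]; field_simp] at hbad
  rw [show (2 : ℝ) / (n : ℝ) ^ q = 1 / (n : ℝ) ^ q + 1 / (n : ℝ) ^ q by ring,
    ENNReal.ofReal_add (by positivity) (by positivity)]
  set Fail := {ω | ∃ t ∈ Finset.Icc 1 n, ¬ (1 / 2 * lam t ≤ Res t (prefixMatrix a t) ω ∧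
    Res t (prefixMatrix a t) ω ≤ 2 * lam t)} with hFail
  have hprod : ν.prod (volume : Measure (Fin n → unitInterval)) (Fail ×ˢ Set.univ) ≤
      ENNReal.ofReal (1 / (n : ℝ) ^ q) := by
    rw [Measure.prod_prod, measure_univ, mul_one]
    exact hbad
  refine le_trans (measure_mono fun x hx => ?_) ((measure_union_le _ _).trans (add_le_add hprod hmain))
  by_cases hF : x.1 ∈ Fail
  · exact Or.inl ⟨hF, trivial⟩
  · refine Or.inr ?_
    have hcongr := onlineLRA_congr (c := oversampling α ε d) (a := a) n (fun _ _ => rfl)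
      (est := fun t => Res t (prefixMatrix a t) x.1) (est' := est x.1) (fun s h1 h2 => ?_) x.2
    · rw [Set.mem_ofPred_eq, hcongr] at hx
      exact hx
    · have := not_not.1 fun hn => hF ⟨s, Finset.mem_Icc.2 ⟨h1, h2⟩, hn⟩
      simp only [hest, if_pos (And.intro h1 h2)]
      rw [min_eq_left this.2, max_eq_right this.1]

/-- The failure probability of `OnlineLRA` with exact residuals. -/
theorem volume_not_success_exact_le {p q : ℕ} (hnd : n ≤ d ^ p) (hk : 1 ≤ k)
    (hε0 : 0 < ε) (hε : ε ≤ 1 / 2) (hμ : 0 < μ)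
    (hSV : ∀ t ≤ n, SingularValuesGE (prefixMatrix a t) μ)
    {α : ℝ} (hα : 323 * ((2 * p + 5 + p * q : ℕ) : ℝ) ≤ α) :
    volume {u : Fin n → unitInterval |
      ¬ IsSmallPCPSample (2304 * α + ((2 * p + 5 + p * q : ℕ) : ℝ)) k ε μ (prefixMatrix a n)
        (onlineLRA (oversampling α ε d) a (exactEst a k) n u)} ≤
      ENNReal.ofReal (1 / (n : ℝ) ^ q) := by
  have hα0 : 0 ≤ α := le_trans (by positivity) hα
  rcases Nat.lt_or_ge n 2 with hn | hn
  · rcases Nat.eq_zero_or_pos n with hn0 | hn0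
    · refine le_trans (le_of_eq ?_) (zero_le (a := ENNReal.ofReal _))
      refine (congrArg _ (Set.eq_empty_of_forall_notMem fun x hx => ?_)).trans measure_empty
      rw [Set.mem_ofPred_eq] at hx
      exact hx (isSmallPCPSample_zero hn0 _ _ (by positivity))
    · obtain rfl : n = 1 := by omega
      refine prob_le_one.trans ?_
      rw [← ENNReal.ofReal_one]
      exact ENNReal.ofReal_le_ofReal (by simp)
  have hb : ∀ (_ : Unit) t, 1 / 2 * (lowRankResidual (prefixMatrix a t) k / k) ≤ exactEst a k t ∧
      exactEst a k t ≤ 2 * (lowRankResidual (prefixMatrix a t) k / k) := by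
    intro _ t
    have : 0 ≤ lowRankResidual (prefixMatrix a t) k / k :=
      div_nonneg (lowRankResidual_nonneg _ _) (Nat.cast_nonneg _)
    rw [exactEst]
    constructor <;> linarith
  -- Exact residuals are the case of a one-point seed space.
  have h1 := measure_not_success_le hn hnd hk hε0 hε hμ hSV (Measure.dirac ())
    (est := fun _ => exactEst a k) (fun t => measurable_const) hb hα
  rw [← one_mul (volume _), ← measure_univ (μ := Measure.dirac ()), ← Measure.prod_prod]
  refine le_trans (measure_mono fun x hx => ?_) h1
  exact hx.2

theorem exactSampler_not_success_le {p q : ℕ} (hnd : n ≤ d ^ p) (hk : 1 ≤ k)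
    (hε0 : 0 < ε) (hε : ε ≤ 1 / 2) (hμ : 0 < μ)
    (hSV : ∀ t ≤ n, SingularValuesGE (prefixMatrix a t) μ)
    {α : ℝ} (hα : 323 * ((2 * p + 5 + p * q : ℕ) : ℝ) ≤ α) :
    (exactSampler (oversampling α ε d) d k n).law {ω |
      ¬ IsSmallPCPSample (2304 * α + ((2 * p + 5 + p * q : ℕ) : ℝ)) k ε μ (prefixMatrix a n)
        ((exactSampler (oversampling α ε d) d k n).output a n ω)} ≤
      ENNReal.ofReal (1 / (n : ℝ) ^ q) := by
  refine le_trans (le_of_eq (congrArg _ ?_))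
    (volume_not_success_exact_le hnd hk hε0 hε hμ hSV hα)
  exact congrArg Set.ofPred (funext fun u => congrArg (fun L => ¬ IsSmallPCPSample
    (2304 * α + ((2 * p + 5 + p * q : ℕ) : ℝ)) k ε μ (prefixMatrix a n) L)
    (exactSampler_output k n a u))

end Main

end OnlineLowRank

theorem mainTheorem5 (p q : ℕ) :
    (∃ α₀ : ℝ, 0 < α₀ ∧ (p : ℝ) ≤ α₀ ∧ ∀ α : ℝ, α₀ ≤ α → ∃ C : ℝ, 0 < C ∧
      ∀ (n d k : ℕ) (ε : ℝ), n ≤ d ^ p → 1 ≤ k → 0 < ε → ε ≤ 1 / 2 →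
      ∀ (Ω : Type*) [MeasurableSpace Ω] (ν : Measure Ω) [IsProbabilityMeasure ν]
        (Res : (t : ℕ) → Matrix (Fin t) (Fin d) ℝ → Ω → ℝ),
        OnlineLowRank.IsResidualProcedure ν n k (1 / (n : ℝ) ^ (q + 1)) Res →
      ∀ (a : ℕ → Fin d → ℝ) (μ : ℝ), 0 < μ →
        (∀ t ≤ n, OnlineLowRank.SingularValuesGE (OnlineLowRank.prefixMatrix a t) μ) →
        (ν.prod (volume : Measure (Fin n → unitInterval))) {x |
          ¬ (let A := OnlineLowRank.prefixMatrix a n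
             let L := OnlineLowRank.onlineLRA (OnlineLowRank.oversampling α ε d) a
               (fun t => Res t (OnlineLowRank.prefixMatrix a t) x.1) n x.2
             let B := OnlineLowRank.rowsMatrix L
             OnlineLowRank.IsPCPSample k ε A B ∧
             (L.length : ℝ) ≤ C * OnlineLowRank.rowBound k ε μ A ∧
             (1 - ε) * OnlineLowRank.lowRankResidual A k ≤ OnlineLowRank.lowRankResidual B k ∧
             OnlineLowRank.lowRankResidual B k ≤ (1 + ε) * OnlineLowRank.lowRankResidual A k)}
          ≤ ENNReal.ofReal (2 / (n : ℝ) ^ q)) ∧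
    (∃ C : ℝ, 0 < C ∧
      ∀ (n d k : ℕ) (ε : ℝ), n ≤ d ^ p → 1 ≤ k → 0 < ε → ε ≤ 1 / 2 →
      ∃ alg : OnlineLowRank.OnlineSampler d,
      ∀ (a : ℕ → Fin d → ℝ) (μ : ℝ), 0 < μ →
        (∀ t ≤ n, OnlineLowRank.SingularValuesGE (OnlineLowRank.prefixMatrix a t) μ) →
        alg.law {ω |
          ¬ (let A := OnlineLowRank.prefixMatrix a n
             let L := alg.output a n ω
             let B := OnlineLowRank.rowsMatrix L
             (L.length : ℝ) ≤ C * OnlineLowRank.rowBound k ε μ A ∧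
             (1 - ε) * OnlineLowRank.lowRankResidual A k ≤ OnlineLowRank.lowRankResidual B k ∧
             OnlineLowRank.lowRankResidual B k ≤ (1 + ε) * OnlineLowRank.lowRankResidual A k)}
          ≤ ENNReal.ofReal (1 / (n : ℝ) ^ q)) := by
  have hκ : (0 : ℝ) < ((2 * p + 5 + p * q : ℕ) : ℝ) := by exact_mod_cast (by omega)
  have hp : (p : ℝ) ≤ ((2 * p + 5 + p * q : ℕ) : ℝ) := by exact_mod_cast (by nlinarith)
  refine ⟨⟨323 * ((2 * p + 5 + p * q : ℕ) : ℝ), by positivity, by linarith, fun α hα =>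
    ⟨2304 * α + ((2 * p + 5 + p * q : ℕ) : ℝ), by linarith, ?_⟩⟩,
    ⟨2304 * (323 * ((2 * p + 5 + p * q : ℕ) : ℝ)) + ((2 * p + 5 + p * q : ℕ) : ℝ), by positivity, ?_⟩⟩
  · intro n d k ε hnd hk hε0 hε Ω _ ν _ Res hRes a μ hμ hSV
    refine le_trans (measure_mono fun x hx => ?_)
      (OnlineLowRank.measure_not_success_residual_le hnd hk hε0 hε hμ hSV ν hRes hα)
    rw [Set.mem_ofPred_eq] at hx ⊢
    refine fun hS => hx ?_
    exact ⟨hS.1, hS.2, OnlineLowRank.lowRankResidual_bounds_of_isPCPSample (by linarith) hS.1⟩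
  · intro n d k ε hnd hk hε0 hε
    refine ⟨OnlineLowRank.exactSampler
      (OnlineLowRank.oversampling (323 * ((2 * p + 5 + p * q : ℕ) : ℝ)) ε d) d k n,
      fun a μ hμ hSV => ?_⟩
    refine le_trans (measure_mono fun x hx => ?_)
      (OnlineLowRank.exactSampler_not_success_le hnd hk hε0 hε hμ hSV le_rfl)
    rw [Set.mem_ofPred_eq] at hx ⊢
    exact fun hS => hx
      ⟨hS.2, OnlineLowRank.lowRankResidual_bounds_of_isPCPSample (by linarith) hS.1⟩
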